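/- **Definitions.** Let $\mathbb K$ be a commutative ring; modules and tensor products are over $\mathbb K$. For a chain complex $C$ (in degrees $\ge 0$) and submodules $D_n\subseteq C_n$, let $\omega(C,D)\subseteq C$ be the largest subcomplex with components in $D$, i.e. $\omega(C,D)_n=D_n\cap\partial^{-1}(D_{n-1})$. For a simplicial module $A$ let $\mathsf N A$ be its Moore complex, $\mathsf N_nA=\bigcap_{i\ne 0}\ker(d_i:A_n\to A_{n-1})$ with differential $d_0$, and let $\rho:A_n\to \mathsf N_nA$ be the projection whose kernel is the submodule $\sum_i s_i(A_{n-1})$ of degenerate elements. A *path pair of modules* $P=(A,B)$ is a simplicial module $A$ with submodules $B_n\subseteq A_n$ such that $s_i(B_n)\subseteq B_{n+1}$ for $0\le i\le n$, and $d_0(B_n)\subseteq B_{n-1}$, $d_n(B_n)\subseteq B_{n-1}$ for $n\ge 1$. Put $\overline B_n=\rho(B_n)\subseteq \mathsf N_nA$, $\Omega P=\omega(\mathsf NA,\overline B)$ and $H_n(P)=H_n(\Omega P)$. For $n=k+l$ let $\mathsf{Sh}(l,k)$ be the set of pairs $(\mu,\nu)$ of complementary subsets $\mu=\{\mu_0<\dots<\mu_{l-1}\}$,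 $\nu=\{\nu_0<\dots<\nu_{k-1}\}$ of $\{0,\dots,n-1\}$. Write $s_\mu=s_{\mu_{l-1}}\cdots s_{\mu_0}$, $s_\nu=s_{\nu_{k-1}}\cdots s_{\nu_0}$ for the iterated degeneracies, and let $\mathrm{sgn}(\mu,\nu)$ be the sign of the permutation $(\nu_0,\dots,\nu_{k-1},\mu_0,\dots,\mu_{l-1})$ of $(0,\dots,n-1)$. The *box product* of $P=(A,B)$ and $P'=(A',B')$ is the path pair $P\square P'=(A\otimes A',B\diamond B')$, where $(A\otimes A')_n=A_n\otimes A'_n$ and $$(B\diamond B')_n=\sum_{k+l=n}\ \sum_{(\mu,\nu)\in\mathsf{Sh}(l,k)}\mathrm{Im}\bigl(s_\mu(B_k)\otimes s_\nu(B'_l)\to A_n\otimes A'_n\bigr).$$ The normalized Eilenberg–Zilber map $\varepsilon:\mathsf NA\otimes\mathsf NA'\to\mathsf N(A\otimes A')$ and Alexander–Whitney map $\alpha:\mathsf N(A\otimes A')\to\mathsf NA\otimes\mathsf NA'$ are $$\varepsilon(a\otimes a')=\rho\Bigl(\sum_{(\mu,\nu)\in\mathsf{Sh}(l,k)}\mathrm{sgn}(\mu,\nu)\,s_\mu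 a\otimes s_\nu a'\Bigr)\quad(a\in \mathsf N_kA,\ a'\in \mathsf N_lA'),$$ and, in degree $n$, $\alpha$ is the restriction to $\mathsf N_n(A\otimes A')$ of the map $$A_n\otimes A'_n\to\bigoplus_{k+l=n}\mathsf N_kA\otimes\mathsf N_lA',\qquad a\otimes a'\mapsto\sum_{k+l=n}\rho(d_{k+1}\cdots d_{n-1}d_n\,a)\otimes\rho(d_0^{\,k}a').$$ **Theorem.** Let $\mathbb K$ be a principal ideal domain and let $P=(A,B)$, $P'=(A',B')$ be path pairs of modules such that, for every $n\ge 0$, the modules $A_n$ and $A'_n$ are free, and $\overline B_n$ and $\overline B'_n$ are direct summands of $\mathsf N_nA$ and $\mathsf N_nA'$ respectively. Then $\varepsilon$ and $\alpha$ restrict to mutually inverse isomorphisms of chain complexes $$\Omega P\otimes\Omega P'\;\cong\;\Omega(P\square P').$$ Moreover, for every $n\ge 0$ there is a short exact sequence $$0\to\bigoplus_{i+j=n}H_i(P)\otimes H_j(P')\to H_n(P\square P')\to\bigoplus_{i+j=n-1}\mathsf{Tor}_1^{\mathbb K}\bigl(H_i(P),H_j(P')\bigr)\to0,$$ whose first map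 sends $[x]\otimes[y]$ to $[\varepsilon(x\otimes y)]$ for cycles $x\in\Omega_iP$, $y\in\Omega_jP'$. -/

import Mathlib

open CategoryTheory MonoidalCategory AlgebraicTopology Simplicial

universe u

namespace PathHomology

noncomputable section

/-! ### Shuffles -/

/-- The set `Sh(l, k)` of `(l, k)`-shuffles of `{0, …, n - 1}`: pairs `(μ, ν)` of complementary
subsets (that is, strictly increasing sequences) with `l` and `k` elements.
It is empty unless `n = k + l`. -/
abbrev Shuffle (n l k : ℕ) : Type :=
  {p : Finset (Fin n) × Finset (Fin n) //
    (Disjoint p.1 p.2 ∧ p.1 ∪ p.2 = Finset.univ) ∧ p.1.card = l ∧ p.2.card = k}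

/-- The monotone map `[n] → [k]`, `i ↦ #{j ∈ T | j < i}`, for a subset `T` of `{0, …, n - 1}` with
`k` elements. It is the monotone surjection that identifies `i` and `i + 1` exactly for `i ∉ T`
(see `countMap_surjective`, `countMap_eq_iff`). -/
def countMap {n k : ℕ} (T : Finset (Fin n)) (hT : T.card = k) : ⦋n⦌ ⟶ ⦋k⦌ :=
  SimplexCategory.Hom.mk
    { toFun := fun i => ⟨(T.filter fun j => j.castSucc < i).card,
        Nat.lt_succ_of_le (hT ▸ Finset.card_filter_le _ _)⟩
      monotone' := fun a b hab => by
        refine Finset.card_le_card fun j hj => ?_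
        rw [Finset.mem_filter] at hj ⊢
        exact ⟨hj.1, lt_of_lt_of_le hj.2 hab⟩ }

namespace Shuffle

variable {n l k : ℕ} (p : Shuffle n l k)

/-- The first part `μ` of the shuffle `(μ, ν)`. -/
def mu : Finset (Fin n) := p.1.1

/-- The second part `ν` of the shuffle `(μ, ν)`. -/
def nu : Finset (Fin n) := p.1.2

/-- `s^μ = s^{μ_0} ⋯ s^{μ_{l-1}} : [n] → [k]`, the monotone surjection that identifies
`i` and `i + 1` exactly for `i ∈ μ`. -/
def sMu : ⦋n⦌ ⟶ ⦋k⦌ := countMap p.nu p.2.2.2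

/-- `s^ν = s^{ν_0} ⋯ s^{ν_{k-1}} : [n] → [l]`, the monotone surjection that identifies
`i` and `i + 1` exactly for `i ∈ ν`. -/
def sNu : ⦋n⦌ ⟶ ⦋l⦌ := countMap p.mu p.2.2.1

/-- The sign of the shuffle: the sign of the permutation `(ν_0, …, ν_{k-1}, μ_0, …, μ_{l-1})` of
`(0, …, n - 1)`, that is, `-1` to the number of its inversions. -/
def sgn : ℤ := (-1) ^ ((p.nu ×ˢ p.mu).filter fun q => q.2 < q.1).card

end Shuffle

/-! ### Chain complexes with graded submodules -/

section Omega

variable {K : Type u} [CommRing K] (C : ChainComplex (ModuleCat.{u} K) ℕ)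
  (D : ∀ n, Submodule K (C.X n))

/-- `ω(C, D)_n = D_n ∩ ∂⁻¹(D_{n-1})`. -/
def omegaSub (n : ℕ) : Submodule K (C.X n) :=
  D n ⊓ ⨅ m, (D m).comap (C.d n m).hom

lemma d_mem_omegaSub (n m : ℕ) (x : C.X n) (hx : x ∈ omegaSub C D n) :
    (C.d n m).hom x ∈ omegaSub C D m := by
  refine ⟨(Submodule.mem_iInf _).1 hx.2 m, (Submodule.mem_iInf _).2 fun r => ?_⟩
  have h : (C.d m r).hom ((C.d n m).hom x) = 0 := by
    rw [← ModuleCat.comp_apply, C.d_comp_d]; rfl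
  rw [Submodule.mem_comap, h]
  exact (D r).zero_mem

/-- `ω(C, D)`: the largest subcomplex of `C` whose components lie in `D`. -/
def omega : ChainComplex (ModuleCat.{u} K) ℕ where
  X n := ModuleCat.of K (omegaSub C D n)
  d n m := ModuleCat.ofHom ((C.d n m).hom.restrict (d_mem_omegaSub C D n m))
  shape n m h := by
    refine ModuleCat.hom_ext (LinearMap.ext fun x => Subtype.ext ?_)
    change (C.d n m).hom x.1 = 0
    rw [C.shape n m h]; rfl
  d_comp_d' n m r _ _ := by
    refine ModuleCat.hom_ext (LinearMap.ext fun x => Subtype.ext ?_)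
    change (C.d m r).hom ((C.d n m).hom x.1) = 0
    rw [← ModuleCat.comp_apply, C.d_comp_d]; rfl

/-- The inclusion `ω(C, D) → C`. -/
def omegaIncl : omega C D ⟶ C where
  f n := ModuleCat.ofHom (omegaSub C D n).subtype
  comm' _ _ _ := rfl

end Omega

/-! ### Normalization of simplicial modules -/

section Simplicial

variable {K : Type u} [CommRing K]

/-- The Moore complex `N A`, with `N_n A = ⋂_{i ≠ 0} ker d_i` and differential `d_0`. -/
abbrev moore (A : SimplicialObject (ModuleCat.{u} K)) : ChainComplex (ModuleCat.{u} K) ℕ :=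
  (normalizedMooreComplex (ModuleCat.{u} K)).obj A

/-- The inclusion `N_n A → A_n`. -/
abbrev mooreIncl (A : SimplicialObject (ModuleCat.{u} K)) (n : ℕ) : (moore A).X n ⟶ A _⦋n⦌ :=
  (inclusionOfMooreComplexMap A).f n

/-- The projection `ρ : A_n → N_n A` along the submodule of degenerate elements. -/
abbrev rho (A : SimplicialObject (ModuleCat.{u} K)) (n : ℕ) : A _⦋n⦌ ⟶ (moore A).X n :=
  (DoldKan.PInftyToNormalizedMooreComplex A).f n

/-- `ρ` is the identity on the Moore complex. -/
lemma mooreIncl_rho (A : SimplicialObject (ModuleCat.{u} K)) (n : ℕ) :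
    mooreIncl A n ≫ rho A n = 𝟙 _ :=
  HomologicalComplex.congr_hom (DoldKan.splitMonoInclusionOfMooreComplexMap A).id n

/-- `ρ` vanishes on degenerate elements. -/
lemma degeneracy_rho (A : SimplicialObject (ModuleCat.{u} K)) (n : ℕ) (i : Fin (n + 1)) :
    A.σ i ≫ rho A (n + 1) = 0 := by
  have h := HomologicalComplex.congr_hom (DoldKan.PInfty_comp_PInftyToNormalizedMooreComplex A)
    (n + 1)
  rw [rho, ← h, HomologicalComplex.comp_f]
  exact (Category.assoc _ _ _).symm.trans
    ((congrArg (· ≫ _) (DoldKan.σ_comp_PInfty A i)).trans Limits.zero_comp)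

variable (A A' : SimplicialObject (ModuleCat.{u} K))

/-- The component `A_k ⊗ A'_l → (A ⊗ A')_n`, `n = k + l`, of the Eilenberg–Zilber map:
`a ⊗ a' ↦ ∑_{(μ, ν) ∈ Sh(l, k)} sgn(μ, ν) s_μ a ⊗ s_ν a'`. -/
def eilenbergZilber (k l n : ℕ) : A _⦋k⦌ ⊗ A' _⦋l⦌ ⟶ (A ⊗ A') _⦋n⦌ :=
  ∑ p : Shuffle n l k, p.sgn • (A.map p.sMu.op ⊗ₘ A'.map p.sNu.op)

/-- The component `(A ⊗ A')_n → A_k ⊗ A'_l`, `n = k + l`, of the Alexander–Whitney map: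
the tensor product of the `l`-fold last face `A_n → A_k` (restriction to the vertices `0, …, k`)
and the `k`-fold zeroth face `A'_n → A'_l` (restriction to the vertices `k, …, n`). -/
def alexanderWhitney (k l n : ℕ) (h : k + l = n) : (A ⊗ A') _⦋n⦌ ⟶ A _⦋k⦌ ⊗ A' _⦋l⦌ :=
  A.map (SimplexCategory.subinterval 0 k (by omega)).op ⊗ₘ
    A'.map (SimplexCategory.subinterval k l h.le).op

/-- The normalized Eilenberg–Zilber map `ε : (N A ⊗ N A')_n → N_n (A ⊗ A')`. -/
def normalizedEZ (n : ℕ) : (moore A ⊗ moore A').X n ⟶ (moore (A ⊗ A')).X n :=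
  HomologicalComplex.mapBifunctorDesc fun k l _ =>
    (mooreIncl A k ⊗ₘ mooreIncl A' l) ≫ eilenbergZilber A A' k l n ≫ rho (A ⊗ A') n

/-- The normalized Alexander–Whitney map `α : N_n (A ⊗ A') → (N A ⊗ N A')_n`. -/
def normalizedAW (n : ℕ) : (moore (A ⊗ A')).X n ⟶ (moore A ⊗ moore A').X n :=
  ∑ q : Finset.HasAntidiagonal.antidiagonal n,
    mooreIncl (A ⊗ A') n ≫
      alexanderWhitney A A' q.1.1 q.1.2 n (Finset.HasAntidiagonal.mem_antidiagonal.1 q.2) ≫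
      (rho A q.1.1 ⊗ₘ rho A' q.1.2) ≫
      HomologicalComplex.ιTensorObj (moore A) (moore A') q.1.1 q.1.2 n
        (Finset.HasAntidiagonal.mem_antidiagonal.1 q.2)

end Simplicial

/-! ### Path pairs -/

/-- A path pair of modules: a simplicial module `A` with submodules `B_n ⊆ A_n` that are closed
under all degeneracies and under the exterior faces `d_0` and `d_n`. -/
structure PathPair (K : Type u) [CommRing K] where
  A : SimplicialObject (ModuleCat.{u} K)
  B : ∀ n, Submodule K (A _⦋n⦌)
  degeneracy_mem : ∀ (n : ℕ) (i : Fin (n + 1)), ∀ x ∈ B n, (A.σ i).hom x ∈ B (n + 1)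
  tail_mem : ∀ n : ℕ, ∀ x ∈ B (n + 1), (A.δ (0 : Fin (n + 2))).hom x ∈ B n
  head_mem : ∀ n : ℕ, ∀ x ∈ B (n + 1), (A.δ (Fin.last (n + 1))).hom x ∈ B n

section Connected

/-! The facts on monotone maps with connected image that make the box product a path pair. -/

lemma countMap_apply {n k : ℕ} (T : Finset (Fin n)) (hT : T.card = k) (i : Fin (n + 1)) :
    ((countMap T hT i : Fin (k + 1)) : ℕ) = (T.filter fun j => j.castSucc < i).card := rfl

lemma countMap_succ {n k : ℕ} (T : Finset (Fin n)) (hT : T.card = k) (i : Fin n) :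
    ((countMap T hT i.succ : Fin (k + 1)) : ℕ) =
      (countMap T hT i.castSucc : Fin (k + 1)) + if i ∈ T then 1 else 0 := by
  rw [countMap_apply, countMap_apply]
  have h : (T.filter fun j => j.castSucc < i.succ) =
      (T.filter fun j => j.castSucc < i.castSucc) ∪ (T.filter fun j => j = i) := by
    ext j
    simp only [Finset.mem_filter, Finset.mem_union, Fin.lt_def, Fin.ext_iff, Fin.val_castSucc,
      Fin.val_succ, ← and_or_left]
    refine and_congr_right fun _ => ?_
    omega
  rw [h, Finset.card_union_of_disjoint]
  · congr 1
    rw [Finset.filter_eq']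
    split_ifs <;> simp
  · rw [Finset.disjoint_left]
    intro j hj hj'
    rw [Finset.mem_filter] at hj hj'
    rw [hj'.2] at hj
    exact lt_irrefl _ hj.2

lemma countMap_eq_iff {n k : ℕ} (T : Finset (Fin n)) (hT : T.card = k) (i : Fin n) :
    (countMap T hT i.castSucc : Fin (k + 1)) = countMap T hT i.succ ↔ i ∉ T := by
  have h := countMap_succ T hT i
  rw [Fin.ext_iff, h]
  split_ifs with hi <;> simp [hi]

lemma countMap_surjective {n k : ℕ} (T : Finset (Fin n)) (hT : T.card = k) :
    Function.Surjective (fun i : Fin (n + 1) => (countMap T hT i : Fin (k + 1))) := by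
  have key : ∀ i : Fin (n + 1), ∀ y : ℕ, y ≤ (countMap T hT i : Fin (k + 1)) →
      ∃ x : Fin (n + 1), ((countMap T hT x : Fin (k + 1)) : ℕ) = y := by
    intro i
    induction i using Fin.induction with
    | zero =>
      intro y hy
      have h0 : ((countMap T hT 0 : Fin (k + 1)) : ℕ) = 0 := by
        rw [countMap_apply]; simp
      exact ⟨0, by omega⟩
    | succ i ih =>
      intro y hy
      have h := countMap_succ T hT i
      by_cases hle : y ≤ (countMap T hT i.castSucc : Fin (k + 1))
      · exact ih y hle
      · refine ⟨i.succ, ?_⟩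
        split_ifs at h <;> omega
  intro y
  have hlast : ((countMap T hT (Fin.last n) : Fin (k + 1)) : ℕ) = k := by
    rw [countMap_apply, Finset.filter_true_of_mem (fun j _ => Fin.castSucc_lt_last j), hT]
  obtain ⟨x, hx⟩ := key (Fin.last n) y
    (hlast.symm ▸ Nat.lt_succ_iff.1 y.isLt)
  exact ⟨x, Fin.ext hx⟩

/-- The image of `f` is an interval. -/
def Conn {m n : ℕ} (f : ⦋m⦌ ⟶ ⦋n⦌) : Prop :=
  ∀ y : Fin (n + 1), (f 0 : Fin (n + 1)) ≤ y → y ≤ f (Fin.last m) → ∃ x : Fin (m + 1), f x = y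

lemma hom_mono {m n : ℕ} (f : ⦋m⦌ ⟶ ⦋n⦌) {a b : Fin (m + 1)} (h : a ≤ b) :
    (f a : Fin (n + 1)) ≤ f b := f.toOrderHom.monotone h

lemma Conn.of_surjective {m n : ℕ} (f : ⦋m⦌ ⟶ ⦋n⦌)
    (h : Function.Surjective (fun i : Fin (m + 1) => (f i : Fin (n + 1)))) : Conn f :=
  fun y _ _ => h y

lemma Conn.comp {m n r : ℕ} {f : ⦋m⦌ ⟶ ⦋n⦌} {g : ⦋n⦌ ⟶ ⦋r⦌} (hf : Conn f) (hg : Conn g) :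
    Conn (f ≫ g) := by
  intro y h0 h1
  change (g (f 0 : Fin (n + 1)) : Fin (r + 1)) ≤ y at h0
  change y ≤ (g (f (Fin.last m) : Fin (n + 1)) : Fin (r + 1)) at h1
  obtain ⟨z, hz⟩ := hg y ((hom_mono g (Fin.zero_le _)).trans h0)
    (h1.trans (hom_mono g (Fin.le_last _)))
  by_cases hz0 : z ≤ (f 0 : Fin (n + 1))
  · exact ⟨0, le_antisymm h0 (hz ▸ hom_mono g hz0)⟩
  by_cases hz1 : (f (Fin.last m) : Fin (n + 1)) ≤ z
  · exact ⟨Fin.last m, le_antisymm (hz ▸ hom_mono g hz1) h1⟩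
  obtain ⟨x, hx⟩ := hf z (le_of_not_ge hz0) (le_of_not_ge hz1)
  refine ⟨x, ?_⟩
  change (g (f x : Fin (n + 1)) : Fin (r + 1)) = y
  rw [hx, hz]

lemma conn_σ {n : ℕ} (i : Fin (n + 1)) : Conn (SimplexCategory.σ i) :=
  Conn.of_surjective _ (Fin.predAbove_surjective i)

lemma conn_δ_zero {n : ℕ} : Conn (SimplexCategory.δ (0 : Fin (n + 2))) := by
  intro y h0 _
  have h0' : (1 : Fin (n + 2)) ≤ y := h0
  have hy : y ≠ 0 := by
    rintro rfl
    exact absurd h0' (by simp)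
  obtain ⟨x, hx⟩ := Fin.exists_succ_eq.2 hy
  exact ⟨x, hx⟩

lemma conn_δ_last {n : ℕ} : Conn (SimplexCategory.δ (Fin.last (n + 1))) := by
  intro y _ h1
  have hl : (SimplexCategory.δ (Fin.last (n + 1)) (Fin.last n) : Fin (n + 2)) =
      (Fin.last n).castSucc := Fin.succAbove_last_apply _
  rw [hl] at h1
  have hy : y ≠ Fin.last (n + 1) := by
    rintro rfl
    simp [Fin.le_def] at h1
  obtain ⟨x, hx⟩ := Fin.exists_castSucc_eq.2 hy
  exact ⟨x, (Fin.succAbove_last_apply x).trans hx⟩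

lemma factor_through {n k r : ℕ} (c : ⦋n⦌ ⟶ ⦋k⦌) (f : ⦋n⦌ ⟶ ⦋r⦌)
    (hc : Function.Surjective (fun i : Fin (n + 1) => (c i : Fin (k + 1))))
    (h : ∀ i : Fin n, (c i.castSucc : Fin (k + 1)) = c i.succ →
      (f i.castSucc : Fin (r + 1)) = f i.succ) :
    ∃ f' : ⦋k⦌ ⟶ ⦋r⦌, f = c ≫ f' := by
  have key : ∀ y x : Fin (n + 1), x ≤ y → (c x : Fin (k + 1)) = c y →
      (f x : Fin (r + 1)) = f y := by
    intro y
    induction y using Fin.induction with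
    | zero => intro x hx _; rw [Fin.le_zero_iff.1 hx]
    | succ y ih =>
      intro x hx hxy
      rcases hx.eq_or_lt with rfl | hlt
      · rfl
      · have hle : x ≤ y.castSucc := Fin.le_castSucc_iff.2 hlt
        have h1 : (c x : Fin (k + 1)) ≤ c y.castSucc := hom_mono c hle
        have h2 : (c y.castSucc : Fin (k + 1)) ≤ c y.succ := hom_mono c (Fin.castSucc_le_succ y)
        have h3 : (c x : Fin (k + 1)) = c y.castSucc := le_antisymm h1 (hxy ▸ h2)
        exact (ih x hle h3).trans (h y (h3.symm.trans hxy))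
  have key' : ∀ x y : Fin (n + 1), (c x : Fin (k + 1)) = c y → (f x : Fin (r + 1)) = f y := by
    intro x y hxy
    rcases le_total x y with hle | hle
    · exact key y x hle hxy
    · exact (key x y hle hxy.symm).symm
  choose s hs using hc
  refine ⟨SimplexCategory.Hom.mk ⟨fun z => f (s z), ?_⟩, ?_⟩
  · intro z w hzw
    rcases hzw.eq_or_lt with rfl | hlt
    · exact le_rfl
    · refine hom_mono f (le_of_not_ge fun hge => ?_)
      have h1 : (c (s w) : Fin (k + 1)) ≤ c (s z) := hom_mono c hge
      have hz : (c (s z) : Fin (k + 1)) = z := hs z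
      have hw : (c (s w) : Fin (k + 1)) = w := hs w
      rw [hz, hw] at h1
      exact absurd hlt (not_lt_of_ge h1)
  · ext x : 3
    exact key' _ _ (hs _).symm

lemma Conn.of_comp {n k r : ℕ} {c : ⦋n⦌ ⟶ ⦋k⦌} {f : ⦋k⦌ ⟶ ⦋r⦌}
    (hc : Function.Surjective (fun i : Fin (n + 1) => (c i : Fin (k + 1))))
    (h : Conn (c ≫ f)) : Conn f := by
  intro y h0 h1
  obtain ⟨a, ha⟩ := hc 0
  obtain ⟨b, hb⟩ := hc (Fin.last k)
  have ha0 : (c 0 : Fin (k + 1)) = 0 :=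
    Fin.le_zero_iff.1 ((hom_mono c (Fin.zero_le a)).trans_eq ha)
  have hb1 : (c (Fin.last n) : Fin (k + 1)) = Fin.last k :=
    Fin.last_le_iff.1 ((show (c b : Fin (k + 1)) = Fin.last k from hb) ▸
      hom_mono c (Fin.le_last b))
  obtain ⟨x, hx⟩ := h y
    (by change (f (c 0 : Fin (k + 1)) : Fin (r + 1)) ≤ y; rwa [ha0])
    (by change y ≤ (f (c (Fin.last n) : Fin (k + 1)) : Fin (r + 1)); rwa [hb1])
  exact ⟨(c x : Fin (k + 1)), hx⟩

end Connected

namespace PathPair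

variable {K : Type u} [CommRing K]

/-- A path submodule is closed under all monotone maps with connected image. -/
lemma map_mem (P : PathPair K) {m n : ℕ} (f : ⦋m⦌ ⟶ ⦋n⦌) (hf : Conn f) (x : P.A _⦋n⦌)
    (hx : x ∈ P.B n) : (P.A.map f.op).hom x ∈ P.B m := by
  induction hN : m + n using Nat.strong_induction_on generalizing m n with
  | _ N ih =>
  have face : ∀ (n' : ℕ) (i : Fin (n' + 2)) (f : ⦋m⦌ ⟶ ⦋n' + 1⦌) (_ : Conn f)
      (x : P.A _⦋n' + 1⦌) (_ : (P.A.δ i).hom x ∈ P.B n') (_ : m + (n' + 1) = N)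
      (_ : ∀ z : Fin (m + 1), (f z : Fin (n' + 2)) ≠ i), (P.A.map f.op).hom x ∈ P.B m := by
    intro n' i f hf x hx hN hi
    obtain ⟨g, hg⟩ := SimplexCategory.eq_comp_δ_of_not_surjective' f i hi
    have hconn : Conn g := by
      intro y h0 h1
      have hgz : ∀ z : Fin (m + 1),
          (f z : Fin (n' + 2)) = SimplexCategory.δ i (g z : Fin (n' + 1)) := fun z => by
        rw [hg]; rfl
      obtain ⟨z, hz⟩ := hf (SimplexCategory.δ i y)
        (by rw [hgz]; exact hom_mono (SimplexCategory.δ i) h0)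
        (by rw [hgz]; exact hom_mono (SimplexCategory.δ i) h1)
      refine ⟨z, ?_⟩
      rw [hgz] at hz
      exact Fin.succAbove_right_injective hz
    have := ih (m + n') (by omega) g hconn _ hx rfl
    rw [hg, op_comp, P.A.map_comp]
    exact this
  by_cases hsurj : Function.Surjective (fun i : Fin (m + 1) => (f i : Fin (n + 1)))
  · by_cases hinj : Function.Injective (fun i : Fin (m + 1) => (f i : Fin (n + 1)))
    · have hmn : m = n := by
        have := Fintype.card_of_bijective ⟨hinj, hsurj⟩
        simpa using this
      subst hmn
      have : Mono f := SimplexCategory.mono_iff_injective.2 hinj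
      rw [SimplexCategory.eq_id_of_mono f]
      simpa using hx
    · cases m with
      | zero =>
        exact absurd (fun a b _ => Subsingleton.elim (α := Fin 1) a b) hinj
      | succ m' =>
        obtain ⟨i, g, hg⟩ := SimplexCategory.eq_σ_comp_of_not_injective f hinj
        have hconn : Conn g := Conn.of_surjective _ fun y => by
          obtain ⟨z, hz⟩ := hsurj y
          refine ⟨SimplexCategory.σ i z, ?_⟩
          rw [← hz, hg]; rfl
        have := P.degeneracy_mem m' i _ (ih (m' + n) (by omega) g hconn x hx rfl)
        rw [hg, op_comp, P.A.map_comp]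
        exact this
  · cases n with
    | zero =>
      exact absurd (fun y => ⟨0, Subsingleton.elim (α := Fin 1) _ _⟩) hsurj
    | succ n' =>
      by_cases h0 : ∃ z : Fin (m + 1), (f z : Fin (n' + 2)) = 0
      · by_cases h1 : ∃ z : Fin (m + 1), (f z : Fin (n' + 2)) = Fin.last (n' + 1)
        · exfalso
          apply hsurj
          intro y
          obtain ⟨a, ha⟩ := h0
          obtain ⟨b, hb⟩ := h1
          refine hf y ?_ ?_
          · exact ((hom_mono f (Fin.zero_le a)).trans_eq ha).trans (Fin.zero_le y)
          · exact (Fin.le_last y).trans (hb.symm.le.trans (hom_mono f (Fin.le_last b)))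
        · push Not at h1
          exact face n' _ f hf x (P.head_mem n' x hx) hN h1
      · push Not at h0
        exact face n' _ f hf x (P.tail_mem n' x hx) hN h0

variable (P P' : PathPair K)

/-- `(B ◇ B')_n = ∑_{k + l = n} ∑_{(μ, ν) ∈ Sh(l, k)} s_μ(B_k) ⊗̄ s_ν(B'_l)`, where `M ⊗̄ M'`
is the image of the tensor product of the submodules `M` and `M'` in that of the modules. -/
def boxSub (n : ℕ) : Submodule K ((P.A ⊗ P'.A) _⦋n⦌) :=
  ⨆ (k : ℕ) (l : ℕ) (p : Shuffle n l k),
    LinearMap.range (TensorProduct.mapIncl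
      ((P.B k).map (P.A.map p.sMu.op).hom) ((P'.B l).map (P'.A.map p.sNu.op).hom))

lemma tmul_mem_boxSub {n k l : ℕ} (f : ⦋n⦌ ⟶ ⦋k⦌) (g : ⦋n⦌ ⟶ ⦋l⦌) (hf : Conn f) (hg : Conn g)
    (h : ∀ i : Fin n, (f i.castSucc : Fin (k + 1)) = f i.succ ∨
      (g i.castSucc : Fin (l + 1)) = g i.succ)
    (a : P.A _⦋k⦌) (ha : a ∈ P.B k) (b : P'.A _⦋l⦌) (hb : b ∈ P'.B l) :
    (TensorProduct.tmul K ((P.A.map f.op).hom a) ((P'.A.map g.op).hom b) :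
      TensorProduct K (P.A _⦋n⦌) (P'.A _⦋n⦌)) ∈ boxSub P P' n := by
  classical
  let S : Finset (Fin n) :=
    Finset.univ.filter fun i => (f i.castSucc : Fin (k + 1)) = f i.succ
  let p : Shuffle n S.card Sᶜ.card :=
    ⟨(S, Sᶜ), ⟨disjoint_compl_right, Finset.union_compl S⟩, rfl, rfl⟩
  obtain ⟨f', hf'⟩ := factor_through p.sMu f (countMap_surjective _ _) fun i hi => by
    have : i ∉ Sᶜ := (countMap_eq_iff _ _ i).1 hi
    simpa [S] using this
  obtain ⟨g', hg'⟩ := factor_through p.sNu g (countMap_surjective _ _) fun i hi => by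
    have : i ∉ S := (countMap_eq_iff _ _ i).1 hi
    have h' : ¬ (f i.castSucc : Fin (k + 1)) = f i.succ := by simpa [S] using this
    exact (h i).resolve_left h'
  have hcf : Conn f' := Conn.of_comp (countMap_surjective _ _) (hf' ▸ hf)
  have hcg : Conn g' := Conn.of_comp (countMap_surjective _ _) (hg' ▸ hg)
  have hle : LinearMap.range (TensorProduct.mapIncl
      ((P.B _).map (P.A.map p.sMu.op).hom) ((P'.B _).map (P'.A.map p.sNu.op).hom)) ≤
      boxSub P P' n :=
    le_iSup_of_le _ (le_iSup_of_le _ (le_iSup_of_le p le_rfl))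
  apply hle
  refine ⟨TensorProduct.tmul K
    ⟨_, Submodule.mem_map_of_mem (P.map_mem f' hcf a ha)⟩
    ⟨_, Submodule.mem_map_of_mem (P'.map_mem g' hcg b hb)⟩, ?_⟩
  rw [TensorProduct.mapIncl, TensorProduct.map_tmul]
  conv_rhs => rw [hf', hg', op_comp, op_comp, P.A.map_comp, P'.A.map_comp]
  rfl

lemma boxSub_map_mem {m n : ℕ} (θ : ⦋m⦌ ⟶ ⦋n⦌) (hθ : Conn θ)
    (hstep : ∀ i : Fin m, (θ i.succ : Fin (n + 1)).val ≤ (θ i.castSucc : Fin (n + 1)).val + 1)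
    (x : (P.A ⊗ P'.A) _⦋n⦌) (hx : x ∈ boxSub P P' n) :
    ((P.A ⊗ P'.A).map θ.op).hom x ∈ boxSub P P' m := by
  suffices h : boxSub P P' n ≤ (boxSub P P' m).comap ((P.A ⊗ P'.A).map θ.op).hom from h hx
  refine iSup_le fun k => iSup_le fun l => iSup_le fun p => ?_
  rintro _ ⟨t, rfl⟩
  induction t using TensorProduct.induction_on with
  | zero =>
    erw [map_zero]
    exact Submodule.zero_mem _
  | add s t hs ht =>
    erw [map_add]
    exact Submodule.add_mem _ hs ht
  | tmul a b =>
    obtain ⟨_, a, ha, rfl⟩ := a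
    obtain ⟨_, b, hb, rfl⟩ := b
    have := tmul_mem_boxSub P P' (θ ≫ p.sMu) (θ ≫ p.sNu)
      (hθ.comp (Conn.of_surjective _ (countMap_surjective _ _)))
      (hθ.comp (Conn.of_surjective _ (countMap_surjective _ _))) ?_ a ha b hb
    · rw [op_comp, op_comp, P.A.map_comp, P'.A.map_comp] at this
      exact this
    · intro i
      change (p.sMu (θ i.castSucc : Fin (n + 1)) : Fin (k + 1)) = p.sMu (θ i.succ : Fin (n + 1)) ∨
        (p.sNu (θ i.castSucc : Fin (n + 1)) : Fin (l + 1)) = p.sNu (θ i.succ : Fin (n + 1))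
      have hm : (θ i.castSucc : Fin (n + 1)) ≤ θ i.succ := hom_mono θ (Fin.castSucc_le_succ i)
      have hs := hstep i
      generalize hu : (θ i.castSucc : Fin (n + 1)) = u at hm hs ⊢
      generalize hv : (θ i.succ : Fin (n + 1)) = v at hm hs ⊢
      rcases hm.eq_or_lt with rfl | hlt
      · exact Or.inl rfl
      · have hun : u.val < n := lt_of_lt_of_le hlt (Nat.lt_succ_iff.1 v.isLt)
        obtain ⟨j, rfl⟩ : ∃ j : Fin n, u = j.castSucc := ⟨⟨u, hun⟩, rfl⟩
        obtain rfl : v = j.succ := Fin.ext (by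
          have : j.castSucc.val < v.val := hlt
          simp only [Fin.val_castSucc, Fin.val_succ] at *
          omega)
        by_cases hj : j ∈ p.nu
        · refine Or.inr ((countMap_eq_iff _ _ j).2 fun hj' => ?_)
          exact Finset.disjoint_left.1 p.2.1.1 hj' hj
        · exact Or.inl ((countMap_eq_iff _ _ j).2 hj)

/-- The box product `(A, B) □ (A', B') = (A ⊗ A', B ◇ B')`. -/
def box : PathPair K where
  A := P.A ⊗ P'.A
  B := boxSub P P'
  degeneracy_mem n i x hx := by
    refine boxSub_map_mem P P' (SimplexCategory.σ i) (conn_σ i) (fun j => ?_) x hx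
    change (i.predAbove j.succ).val ≤ (i.predAbove j.castSucc).val + 1
    simp only [Fin.predAbove, Fin.lt_def, Fin.val_castSucc, Fin.val_succ]
    split_ifs <;> simp <;> omega
  tail_mem n x hx := by
    refine boxSub_map_mem P P' (SimplexCategory.δ 0) conn_δ_zero (fun j => ?_) x hx
    exact le_rfl
  head_mem n x hx := by
    refine boxSub_map_mem P P' (SimplexCategory.δ (Fin.last (n + 1))) conn_δ_last
      (fun j => ?_) x hx
    change ((Fin.last (n + 1)).succAbove j.succ).val ≤
      ((Fin.last (n + 1)).succAbove j.castSucc).val + 1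
    rw [Fin.succAbove_last_apply, Fin.succAbove_last_apply]
    exact le_rfl

/-- `B̄_n = ρ(B_n) ⊆ N_n A`. -/
def barB (n : ℕ) : Submodule K ((moore P.A).X n) := (P.B n).map (rho P.A n).hom

/-- `Ω P = ω(N A, B̄)`. -/
def Omega : ChainComplex (ModuleCat.{u} K) ℕ := omega (moore P.A) P.barB

/-- The inclusion `Ω P → N A`. -/
def OmegaIncl : P.Omega ⟶ moore P.A := omegaIncl (moore P.A) P.barB

/-- `H_n P = H_n(Ω P)`. -/
abbrev H (n : ℕ) : ModuleCat.{u} K := P.Omega.homology n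

end PathPair

end

end PathHomology

/-! A shuffle is a lattice path from (0,0) to (k,l) with unit steps: a position in `ν` advances the
first coordinate, a position in `μ` the second. By Dold–Kan, each of the two simplicial modules is
the sum of the images of its Moore complex under degeneracies. Hence elements of N(A ⊗ A') are built
from lattice paths that may also have diagonal steps, with coefficients in NA ⊗ NA'. The normalized
path submodule of the box product consists of the sums over genuine shuffles with coefficients in
B̄_k ⊗ B̄'_l (`barBox_eq`).

The map ε is a chain map (`normalizedEZ_d`), and αε = 1 on NA ⊗ NA' (`normalizedEZ_normalizedAW`),
because only the shuffle without inversions survives α. So ε maps ΩP ⊗ ΩP' injectively into Ω(P □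
P'). Injectivity also uses that Ω_nP is a direct summand of N_nA: it is the kernel of a map into a
projective module, and over a principal ideal domain the range of that map is again projective
(`exists_retraction_omegaSub`).

The heart of the proof is surjectivity. Omitting the vertex at a corner of a shuffle gives a path
with one diagonal step, which is neither degenerate nor a shuffle. Exactly two shuffles have this
face: the given one and the one with the two steps at the corner exchanged. If the boundary of a sum
of shuffles lies in the path submodule, no diagonal path can remain, so the coefficients of these
two shuffles are opposite (`exists_detector`, `add_swap_eq_zero`). Sorting a shuffle by adjacent
exchanges then shows that its coefficient is its sign times that of the shuffle without inversions
(`eq_sgn_smul_of_add_swap_eq_zero`). Hence the element is ε(y), where y has components in B̄ ⊗ B̄'.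
As dy = αε(dy) = α(d(εy)), the boundary dy also has components in B̄ ⊗ B̄', and flatness puts y in
ΩP ⊗ ΩP' (`tensorComp_mem_range_mapIncl_omegaSub`). Since αε = 1, the inverse of the restriction of
ε is the restriction of α.

The exact sequence is the Künneth theorem for the complexes of projective modules ΩP and ΩP'
(`exists_kunneth`), transported along this isomorphism. -/

namespace PathHomology

/-! ### Projective modules over a principal ideal domain -/

section PID

variable {K : Type u} [CommRing K] [IsDomain K] [IsPrincipalIdealRing K]

/-- Over a principal ideal domain, quotients of injective modules are injective. -/
lemma injective_quotient (Q : Type u) [AddCommGroup Q] [Module K Q] [Module.Injective K Q]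
    (L : Submodule K Q) : Module.Injective K (Q ⧸ L) := by
  refine Module.Baer.injective fun I g => ?_
  obtain ⟨m, rfl⟩ := IsPrincipalIdealRing.principal I
  obtain rfl | h0 := eq_or_ne m 0
  · refine ⟨0, fun x hx => ?_⟩
    obtain rfl : x = 0 := by simpa using hx
    exact (map_zero g).symm
  obtain ⟨q, hq⟩ := L.mkQ_surjective (g ⟨m, Submodule.subset_span rfl⟩)
  -- Injectivity of `Q` divides `q` by `m`: multiplication by `m ≠ 0` is injective on `K`, so `a ↦ a
  -- • q` extends along it to some `h` with `h (a * m) = a • q`.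
  obtain ⟨h, hh⟩ := Module.Injective.out (LinearMap.toSpanSingleton K K m)
    (fun a b hab => mul_right_cancel₀ h0 (by simpa using hab)) (LinearMap.toSpanSingleton K Q q)
  refine ⟨L.mkQ ∘ₗ h, fun x hx => ?_⟩
  obtain ⟨r, rfl⟩ := Submodule.mem_span_singleton.1 hx
  have h1 := hh r
  simp only [LinearMap.toSpanSingleton_apply] at h1
  rw [LinearMap.comp_apply, h1, map_smul, hq, ← map_smul]
  rfl

/-- Over a principal ideal domain, a module that embeds into a projective one is projective. -/
lemma projective_of_injective {N M : Type u} [AddCommGroup N] [Module K N] [AddCommGroup M]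
    [Module K M] [Module.Projective K M] (i : N →ₗ[K] M) (hi : Function.Injective i) :
    Module.Projective K N := by
  refine Module.Projective.of_lifting_property'' fun p hp => ?_
  -- To split the free cover `p`, embed its source in an injective module `E` by `j`. This induces
  -- `q : N → E / j (ker p)`. The quotient is injective, so `q` extends to `M`, and the extension
  -- lifts to `E` since `M` is projective. Restricted to `N`, the lift takes values in the image of
  -- `j` and thus gives the section.
  let j : (N →₀ K) →ₗ[K]
      (Injective.under (ModuleCat.of K (N →₀ K)) : ModuleCat.{u} K) :=
    (Injective.ι (ModuleCat.of K (N →₀ K))).hom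
  have hj : Function.Injective j :=
    (ModuleCat.mono_iff_injective (Injective.ι (ModuleCat.of K (N →₀ K)))).1 inferInstance
  have : Module.Injective K (Injective.under (ModuleCat.of K (N →₀ K)) : ModuleCat.{u} K) :=
    Module.injective_module_of_injective_object (inj := Injective.injective_under _)
  let L := (LinearMap.ker p).map j
  have := injective_quotient _ L
  let q : N →ₗ[K] _ ⧸ L := (Submodule.mapQ (LinearMap.ker p) L j (Submodule.le_comap_map j _)) ∘ₗ
    (p.quotKerEquivOfSurjective hp).symm.toLinearMap
  have hq : ∀ y, q (p y) = L.mkQ (j y) := fun y => by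
    have : (p.quotKerEquivOfSurjective hp).symm (p y) = (LinearMap.ker p).mkQ y :=
      (LinearEquiv.symm_apply_eq _).2 rfl
    simp [q, this]
  obtain ⟨q', hq'⟩ := Module.Injective.out i hi q
  obtain ⟨h, hh⟩ := Module.projective_lifting_property L.mkQ q' L.mkQ_surjective
  have key : ∀ y, ∃ l ∈ LinearMap.ker p, j l = h (i (p y)) - j y := fun y => by
    have h1 : L.mkQ (h (i (p y)) - j y) = 0 := by
      rw [map_sub, ← hq, ← hq', ← hh, LinearMap.comp_apply, sub_self]
    exact (Submodule.Quotient.mk_eq_zero _).1 h1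
  have hr : ∀ x, h (i x) ∈ LinearMap.range j := fun x => by
    obtain ⟨y, rfl⟩ := hp x
    obtain ⟨l, -, hl⟩ := key y
    exact ⟨l + y, by rw [map_add, hl, sub_add_cancel]⟩
  refine ⟨(LinearEquiv.ofInjective j hj).symm.toLinearMap ∘ₗ (h ∘ₗ i).codRestrict _ hr,
    LinearMap.ext fun x => ?_⟩
  obtain ⟨y, rfl⟩ := hp x
  obtain ⟨l, hl0, hl⟩ := key y
  have : (LinearEquiv.ofInjective j hj).symm ((h ∘ₗ i).codRestrict _ hr (p y)) = l + y := by
    rw [LinearEquiv.symm_apply_eq]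
    refine Subtype.ext ?_
    simp [hl]
  simp only [LinearMap.comp_apply, LinearEquiv.coe_coe, this, LinearMap.id_apply]
  rw [map_add, LinearMap.mem_ker.1 hl0, zero_add]

end PID

/-! ### Retracts and tensor products -/

section Tensor

variable {K : Type*} [CommRing K] {M N M' N' : Type*} [AddCommGroup M] [AddCommGroup N]
  [AddCommGroup M'] [AddCommGroup N'] [Module K M] [Module K N] [Module K M'] [Module K N']

lemma exists_retraction_of_isComplemented {W : Submodule K M} (h : IsComplemented W) :
    ∃ r : M →ₗ[K] W, r ∘ₗ W.subtype = LinearMap.id := by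
  obtain ⟨q, hq⟩ := h
  exact ⟨W.projectionOnto q hq, LinearMap.ext fun x => by simp⟩

/-- The kernel of a linear map with projective range has a complement, isomorphic to the range. -/
lemma exists_retraction_of_projective_range (f : M →ₗ[K] N)
    [Module.Projective K (LinearMap.range f)] :
    ∃ (r : M →ₗ[K] LinearMap.ker f) (s : LinearMap.range f →ₗ[K] M),
      f.rangeRestrict ∘ₗ s = LinearMap.id ∧
      (LinearMap.ker f).subtype ∘ₗ r + s ∘ₗ f.rangeRestrict = LinearMap.id := by
  obtain ⟨s, hs⟩ := Module.projective_lifting_property f.rangeRestrict LinearMap.id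
    f.surjective_rangeRestrict
  have h : ∀ x, ((LinearMap.id : M →ₗ[K] M) - s ∘ₗ f.rangeRestrict) x ∈ LinearMap.ker f :=
      fun x => by
    have h1 : f (s (f.rangeRestrict x)) = f x :=
      congrArg Subtype.val (LinearMap.congr_fun hs (f.rangeRestrict x))
    simp [h1]
  exact ⟨((LinearMap.id : M →ₗ[K] M) - s ∘ₗ f.rangeRestrict).codRestrict _ h, s, hs,
    LinearMap.ext fun x => by simp⟩

/-- This is the inclusion of (W ⊗ N) ∩ (M ⊗ W') in W ⊗ W'. Applying `r ⊗ 1` to `y` changes nothing,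
since `y` comes from W ⊗ N. Applied to `y` as an element that comes from M ⊗ W', it yields an
element of W ⊗ W'. -/
lemma tensor_range_inf {W : Submodule K M} {W' : Submodule K N} (r : M →ₗ[K] W)
    (hr : r ∘ₗ W.subtype = LinearMap.id) {y : TensorProduct K M N}
    (h : y ∈ LinearMap.range (W.subtype.rTensor N))
    (h' : y ∈ LinearMap.range (W'.subtype.lTensor M)) :
    y ∈ LinearMap.range (TensorProduct.mapIncl W W') := by
  obtain ⟨u, rfl⟩ := h
  obtain ⟨v, hv⟩ := h'
  refine ⟨r.rTensor W' v, ?_⟩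
  have h1 : TensorProduct.mapIncl W W' ∘ₗ r.rTensor W' =
      (W.subtype.rTensor N ∘ₗ r.rTensor N) ∘ₗ W'.subtype.lTensor M := by
    ext; simp [TensorProduct.mapIncl]
  have h2 : r.rTensor N ∘ₗ W.subtype.rTensor N = LinearMap.id := by
    rw [← LinearMap.rTensor_comp, hr, LinearMap.rTensor_id]
  rw [← LinearMap.comp_apply, h1, LinearMap.comp_apply, hv, LinearMap.comp_apply,
    ← LinearMap.comp_apply (r.rTensor N), h2, LinearMap.id_apply]

lemma mapIncl_range_le_rTensor (W : Submodule K M) (W' : Submodule K N) :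
    LinearMap.range (TensorProduct.mapIncl W W') ≤ LinearMap.range (W.subtype.rTensor N) := by
  have : TensorProduct.mapIncl W W' = W.subtype.rTensor N ∘ₗ W'.subtype.lTensor W := by
    ext; simp [TensorProduct.mapIncl]
  rw [this]
  exact LinearMap.range_comp_le_range _ _

lemma mapIncl_range_le_lTensor (W : Submodule K M) (W' : Submodule K N) :
    LinearMap.range (TensorProduct.mapIncl W W') ≤ LinearMap.range (W'.subtype.lTensor M) := by
  have : TensorProduct.mapIncl W W' = W'.subtype.lTensor M ∘ₗ W.subtype.rTensor W' := by
    ext; simp [TensorProduct.mapIncl]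
  rw [this]
  exact LinearMap.range_comp_le_range _ _

lemma mapIncl_injective {W : Submodule K M} {W' : Submodule K N} {r : M →ₗ[K] W}
    {r' : N →ₗ[K] W'} (hr : r ∘ₗ W.subtype = LinearMap.id)
    (hr' : r' ∘ₗ W'.subtype = LinearMap.id) :
    Function.Injective (TensorProduct.mapIncl W W') := by
  refine Function.LeftInverse.injective (g := TensorProduct.map r r') fun x => ?_
  rw [← LinearMap.comp_apply, TensorProduct.mapIncl, ← TensorProduct.map_comp, hr, hr',
    TensorProduct.map_id, LinearMap.id_apply]

/-- The submodule `B ⊓ B'.comap d` is the kernel of B → M'/B', and tensoring with the flat module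
`N` preserves this kernel. The hypotheses say that `y` comes from B ⊗ N and dies in (M'/B') ⊗ N. -/
lemma mem_range_rTensor_inf_comap [Module.Flat K N] (d : M →ₗ[K] M') (B : Submodule K M)
    (B' : Submodule K M') {y : TensorProduct K M N}
    (hy : y ∈ LinearMap.range (B.subtype.rTensor N))
    (hdy : d.rTensor N y ∈ LinearMap.range (B'.subtype.rTensor N)) :
    y ∈ LinearMap.range ((B ⊓ B'.comap d).subtype.rTensor N) := by
  obtain ⟨u, rfl⟩ := hy
  obtain ⟨v, hv⟩ := hdy
  let f : B →ₗ[K] M' ⧸ B' := B'.mkQ ∘ₗ d ∘ₗ B.subtype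
  have hf : Function.Exact (LinearMap.ker f).subtype f := LinearMap.exact_subtype_ker_map f
  obtain ⟨w, rfl⟩ := (Module.Flat.rTensor_exact N hf u).1 (by
    have h0 : B'.mkQ.rTensor N ∘ₗ B'.subtype.rTensor N = 0 := by
      rw [← LinearMap.rTensor_comp, (LinearMap.exact_subtype_mkQ B').linearMap_comp_eq_zero,
        LinearMap.rTensor_zero]
    simp only [f, LinearMap.rTensor_comp, LinearMap.comp_apply]
    rw [← hv, ← LinearMap.comp_apply, h0, LinearMap.zero_apply])
  let g : LinearMap.ker f →ₗ[K] (B ⊓ B'.comap d : Submodule K M) :=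
    (B.subtype ∘ₗ (LinearMap.ker f).subtype).codRestrict _ fun x =>
      ⟨x.1.2, (Submodule.Quotient.mk_eq_zero B').1 (LinearMap.mem_ker.1 x.2)⟩
  refine ⟨g.rTensor N w, ?_⟩
  rw [← LinearMap.comp_apply, ← LinearMap.comp_apply, ← LinearMap.rTensor_comp,
    ← LinearMap.rTensor_comp]
  rfl

lemma mem_range_lTensor_inf_comap [Module.Flat K M] (d : N →ₗ[K] N') (B : Submodule K N)
    (B' : Submodule K N') {y : TensorProduct K M N}
    (hy : y ∈ LinearMap.range (B.subtype.lTensor M))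
    (hdy : d.lTensor M y ∈ LinearMap.range (B'.subtype.lTensor M)) :
    y ∈ LinearMap.range ((B ⊓ B'.comap d).subtype.lTensor M) := by
  obtain ⟨u, rfl⟩ := hy
  obtain ⟨v, hv⟩ := hdy
  let f : B →ₗ[K] N' ⧸ B' := B'.mkQ ∘ₗ d ∘ₗ B.subtype
  have hf : Function.Exact (LinearMap.ker f).subtype f := LinearMap.exact_subtype_ker_map f
  obtain ⟨w, rfl⟩ := (Module.Flat.lTensor_exact M hf u).1 (by
    have h0 : B'.mkQ.lTensor M ∘ₗ B'.subtype.lTensor M = 0 := by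
      rw [← LinearMap.lTensor_comp, (LinearMap.exact_subtype_mkQ B').linearMap_comp_eq_zero,
        LinearMap.lTensor_zero]
    simp only [f, LinearMap.lTensor_comp, LinearMap.comp_apply]
    rw [← hv, ← LinearMap.comp_apply, h0, LinearMap.zero_apply])
  let g : LinearMap.ker f →ₗ[K] (B ⊓ B'.comap d : Submodule K N) :=
    (B.subtype ∘ₗ (LinearMap.ker f).subtype).codRestrict _ fun x =>
      ⟨x.1.2, (Submodule.Quotient.mk_eq_zero B').1 (LinearMap.mem_ker.1 x.2)⟩
  refine ⟨g.lTensor M w, ?_⟩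
  rw [← LinearMap.comp_apply, ← LinearMap.comp_apply, ← LinearMap.lTensor_comp,
    ← LinearMap.lTensor_comp]
  rfl

end Tensor

end PathHomology

namespace PathHomology

section Degenerate

variable {K : Type u} [CommRing K] (A : SimplicialObject (ModuleCat.{u} K))

/-! ### Morphisms that vanish on degenerate elements -/

/-- A morphism `A_n ⟶ Z` that vanishes on degenerate elements. -/
def KillsDegenerate {n : ℕ} {Z : ModuleCat.{u} K} (φ : A _⦋n⦌ ⟶ Z) : Prop :=
  ∀ (k : ℕ) (f : ⦋n⦌ ⟶ ⦋k⦌) (j : Fin n), (f j.castSucc : Fin (k + 1)) = f j.succ →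
    A.map f.op ≫ φ = 0

lemma eq_σ_comp_of_collapse {n k : ℕ} (f : ⦋n + 1⦌ ⟶ ⦋k⦌) (j : Fin (n + 1))
    (h : (f j.castSucc : Fin (k + 1)) = f j.succ) :
    ∃ (i : Fin (n + 1)) (g : ⦋n⦌ ⟶ ⦋k⦌), f = SimplexCategory.σ i ≫ g :=
  SimplexCategory.eq_σ_comp_of_not_injective f fun hf => j.castSucc_lt_succ.ne (hf h)

lemma killsDegenerate_rho (n : ℕ) : KillsDegenerate A (rho A n) := by
  intro k f j hj
  cases n with
  | zero => exact j.elim0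
  | succ n =>
    obtain ⟨i, g, rfl⟩ := eq_σ_comp_of_collapse f j hj
    rw [op_comp, A.map_comp, Category.assoc]
    exact (congrArg (A.map g.op ≫ ·) (degeneracy_rho A n i)).trans Limits.comp_zero

lemma rho_mooreIncl (n : ℕ) : rho A n ≫ mooreIncl A n = DoldKan.PInfty.f n :=
  HomologicalComplex.congr_hom
    (DoldKan.PInftyToNormalizedMooreComplex_comp_inclusionOfMooreComplexMap A) n

-- The composite of `rho` and `mooreIncl` is the Dold–Kan projector `PInfty`. Its complement
-- `QInfty` is a sum of morphisms that end with a degeneracy, and `φ` does not see these.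
variable {A} in
lemma KillsDegenerate.rho_comp {n : ℕ} {Z : ModuleCat.{u} K} {φ : A _⦋n⦌ ⟶ Z}
    (h : KillsDegenerate A φ) : rho A n ≫ mooreIncl A n ≫ φ = φ := by
  rw [← Category.assoc, rho_mooreIncl]
  cases n with
  | zero => rw [DoldKan.PInfty_f_0]; exact Category.id_comp _
  | succ n =>
    have h1 : (DoldKan.PInfty.f (n + 1) : A _⦋n + 1⦌ ⟶ _) + DoldKan.QInfty.f (n + 1) = 𝟙 _ :=
      DoldKan.PInfty_f_add_QInfty_f (n + 1)
    have h2 : (DoldKan.QInfty.f (n + 1) : A _⦋n + 1⦌ ⟶ _) ≫ φ = 0 := by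
      rw [DoldKan.QInfty_f, DoldKan.decomposition_Q, Preadditive.sum_comp]
      refine Finset.sum_eq_zero fun i _ => ?_
      have h3 : A.σ i.rev ≫ φ = 0 :=
        h n (SimplexCategory.σ i.rev) i.rev (by
          change i.rev.predAbove _ = i.rev.predAbove _
          simp)
      rw [Category.assoc, Category.assoc, h3, Limits.comp_zero, Limits.comp_zero]
    have h3 := congrArg (· ≫ φ) h1
    simp only [Preadditive.add_comp, h2, add_zero] at h3
    exact h3.trans (Category.id_comp _)

/-- A monotone map that misses `r` factors through the coface `δ r`, and all faces but `d_0` vanish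
on the Moore complex. -/
lemma mooreIncl_map_eq_zero {m k : ℕ} (f : ⦋m⦌ ⟶ ⦋k⦌) (r : Fin (k + 1)) (hr : r ≠ 0)
    (h : ∀ x : Fin (m + 1), (f x : Fin (k + 1)) ≠ r) : mooreIncl A k ≫ A.map f.op = 0 := by
  cases k with
  | zero => exact absurd (Subsingleton.elim (α := Fin 1) r 0) hr
  | succ k =>
    obtain ⟨g, rfl⟩ := SimplexCategory.eq_comp_δ_of_not_surjective' f r h
    obtain ⟨s, rfl⟩ := Fin.exists_succ_eq.2 hr
    have h0 : mooreIncl A (k + 1) ≫ A.δ s.succ = 0 :=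
      DoldKan.HigherFacesVanish.inclusionOfMooreComplexMap k s (by lia)
    rw [op_comp, A.map_comp, ← Category.assoc]
    exact (congrArg (· ≫ A.map g.op) h0).trans Limits.zero_comp

lemma rho_d (m : ℕ) : rho A (m + 1) ≫ (moore A).d (m + 1) m =
    (∑ i : Fin (m + 2), (-1 : ℤ) ^ (i : ℕ) • A.δ i) ≫ rho A m := by
  rw [← AlternatingFaceMapComplex.obj_d_eq]
  exact (DoldKan.PInftyToNormalizedMooreComplex A).comm (m + 1) m

/-! ### The coefficient of a degeneracy -/

-- On the summand of a surjection `B.e`, the operator of `f` lands in the summand of the epi part of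
-- `f ≫ B.e`. That epi part collapses the step `j` and so differs from `θ`.
open SimplicialObject Splitting in
lemma Γ₀_map_πSummand_eq_zero (X : ChainComplex (ModuleCat.{u} K) ℕ) {m k k' : ℕ}
    (θ : ⦋m⦌ ⟶ ⦋k⦌) [Epi θ] (f : ⦋m⦌ ⟶ ⦋k'⦌) (j : Fin m)
    (hf : (f j.castSucc : Fin (k' + 1)) = f j.succ)
    (hθ : (θ j.castSucc : Fin (k + 1)) ≠ θ j.succ) :
    (DoldKan.Γ₀.obj X).map f.op ≫ (DoldKan.Γ₀.splitting X).πSummand (IndexSet.mk θ) = 0 := by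
  refine (DoldKan.Γ₀.splitting X).hom_ext' _ _ fun B => ?_
  have fac : Limits.factorThruImage (f ≫ B.e) ≫ Limits.image.ι (f ≫ B.e) = f.op.unop ≫ B.e :=
    Limits.image.fac _
  rw [Limits.comp_zero, ← Category.assoc]
  refine (congrArg (· ≫ _) (DoldKan.Γ₀.Obj.map_on_summand X B f.op fac)).trans ?_
  refine (Category.assoc _ _ _).trans ((congrArg (_ ≫ ·)
    ((DoldKan.Γ₀.splitting X).cofan_inj_πSummand_eq_zero _ (IndexSet.mk θ) fun h => ?_)).trans
      Limits.comp_zero)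
  have h1 : (IndexSet.mk (Limits.factorThruImage (f ≫ B.e))).e.toOrderHom j.castSucc =
      (IndexSet.mk (Limits.factorThruImage (f ≫ B.e))).e.toOrderHom j.succ := by
    refine (SimplexCategory.mono_iff_injective (f := Limits.image.ι (f ≫ B.e))).1 inferInstance ?_
    have h2 := fun x => congrArg (fun g => g.toOrderHom x) fac
    refine (h2 j.castSucc).trans (Eq.trans ?_ (h2 j.succ).symm)
    exact congrArg B.e.toOrderHom hf
  rw [← h] at h1
  exact hθ h1

-- The degeneracy of `θ` carries the summand of `B` to that of `θ ≫ B.e`. This is the summand of `θ`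
-- only if `B` is the identity.
open SimplicialObject Splitting in
lemma Γ₀_map_πSummand_self (X : ChainComplex (ModuleCat.{u} K) ℕ) {m k : ℕ}
    (θ : ⦋m⦌ ⟶ ⦋k⦌) [Epi θ] :
    (DoldKan.Γ₀.obj X).map θ.op ≫ (DoldKan.Γ₀.splitting X).πSummand (IndexSet.mk θ) =
      (DoldKan.Γ₀.splitting X).πSummand (IndexSet.id (Opposite.op ⦋k⦌)) := by
  refine (DoldKan.Γ₀.splitting X).hom_ext' _ _ fun B => ?_
  have : Epi θ.op.unop := ‹Epi θ›
  refine (Category.assoc _ _ _).symm.trans ((congrArg (· ≫ _)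
    ((DoldKan.Γ₀.splitting X).cofan_inj_epi_naturality B θ.op)).trans ?_)
  by_cases h : B = IndexSet.id (Opposite.op ⦋k⦌)
  · subst h
    exact ((DoldKan.Γ₀.splitting X).cofan_inj_πSummand_eq_id (IndexSet.mk θ)).trans
      ((DoldKan.Γ₀.splitting X).cofan_inj_πSummand_eq_id (IndexSet.id (Opposite.op ⦋k⦌))).symm
  · refine ((DoldKan.Γ₀.splitting X).cofan_inj_πSummand_eq_zero _ (IndexSet.mk θ)
      fun h' => ?_).trans
      ((DoldKan.Γ₀.splitting X).cofan_inj_πSummand_eq_zero _ _ fun h' => h h'.symm).symm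
    refine h ((IndexSet.eqId_iff_len_eq B).2 ?_)
    have := congrArg (fun I => I.1.unop.len) h'
    exact this.symm

variable {A} in
lemma KillsDegenerate.of_not_injective {n k : ℕ} {Z : ModuleCat.{u} K} {φ : A _⦋n⦌ ⟶ Z}
    (h : KillsDegenerate A φ) (f : ⦋n⦌ ⟶ ⦋k⦌) (hf : ¬ Function.Injective f.toOrderHom) :
    A.map f.op ≫ φ = 0 := by
  cases n with
  | zero => exact absurd (Function.injective_of_subsingleton (α := Fin 1) _) hf
  | succ n =>
    obtain ⟨i, g, rfl⟩ := SimplexCategory.eq_σ_comp_of_not_injective f hf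
    refine h k _ i ?_
    change g (i.predAbove _) = g (i.predAbove _)
    simp

-- Here `c` and `c₀` are the projections to the summands of `θ` and of the identity, and `ι`
-- includes the latter. A morphism that kills degenerate elements vanishes on all other summands, so
-- it factors through `c₀`.
open SimplicialObject Splitting in
lemma Γ₀_exists_coefficient (X : ChainComplex (ModuleCat.{u} K) ℕ) {m k : ℕ}
    (θ : ⦋m⦌ ⟶ ⦋k⦌) [Epi θ] :
    ∃ (c : (DoldKan.Γ₀.obj X) _⦋m⦌ ⟶ X.X k) (c₀ : (DoldKan.Γ₀.obj X) _⦋k⦌ ⟶ X.X k)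
      (ι : X.X k ⟶ (DoldKan.Γ₀.obj X) _⦋k⦌),
      (∀ (k' : ℕ) (f : ⦋m⦌ ⟶ ⦋k'⦌) (j : Fin m), (f j.castSucc : Fin (k' + 1)) = f j.succ →
        (θ j.castSucc : Fin (k + 1)) ≠ θ j.succ → (DoldKan.Γ₀.obj X).map f.op ≫ c = 0) ∧
      (DoldKan.Γ₀.obj X).map θ.op ≫ c = c₀ ∧
      ∀ (Z : ModuleCat.{u} K) (ψ : (DoldKan.Γ₀.obj X) _⦋k⦌ ⟶ Z), KillsDegenerate _ ψ →
        c₀ ≫ ι ≫ ψ = ψ := by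
  let s := DoldKan.Γ₀.splitting X
  let Δ := Opposite.op ⦋k⦌
  refine ⟨s.πSummand (IndexSet.mk θ), s.πSummand (IndexSet.id Δ), (s.cofan Δ).inj (IndexSet.id Δ),
    fun k' f j hf hθ => Γ₀_map_πSummand_eq_zero X θ f j hf hθ, Γ₀_map_πSummand_self X θ,
    fun Z ψ hψ => s.hom_ext' _ _ fun B => ?_⟩
  by_cases h : B = IndexSet.id Δ
  · subst h
    exact (Category.assoc _ _ _).symm.trans ((congrArg (· ≫ _)
      (s.cofan_inj_πSummand_eq_id (IndexSet.id Δ))).trans (Category.id_comp _))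
  · refine (Category.assoc _ _ _).symm.trans ((congrArg (· ≫ _)
      (s.cofan_inj_πSummand_eq_zero B (IndexSet.id Δ) fun h' => h h'.symm)).trans
      (Limits.zero_comp.trans ?_))
    have h1 : ((DoldKan.Γ₀.obj X).map B.e.op) ≫ ψ = 0 := by
      refine hψ.of_not_injective (k := B.1.unop.len) B.e fun hinj => h ?_
      exact (IndexSet.eqId_iff_mono B).2 (SimplexCategory.mono_iff_injective.2 hinj)
    exact (Limits.comp_zero.symm.trans ((congrArg (s.ι _ ≫ ·) h1).symm.trans
      (Category.assoc _ _ _).symm))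

/-- The coefficient of `s_θ` in the decomposition of `A_m` into images of the Moore complex under
degeneracies. -/
lemma exists_coefficient {m k : ℕ} (θ : ⦋m⦌ ⟶ ⦋k⦌) [Epi θ] :
    ∃ c : A _⦋m⦌ ⟶ (moore A).X k,
      (∀ (k' : ℕ) (f : ⦋m⦌ ⟶ ⦋k'⦌) (j : Fin m), (f j.castSucc : Fin (k' + 1)) = f j.succ →
        (θ j.castSucc : Fin (k + 1)) ≠ θ j.succ → A.map f.op ≫ c = 0) ∧
      mooreIncl A k ≫ A.map θ.op ≫ c = 𝟙 _ := by
  -- The coefficient in `Γ₀` is transported along `φ` and brought back by `φ.inv` and `rho`. Only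
  -- naturality of `φ` is used, so its effect on Moore complexes need not be computed: in the last
  -- condition `φ` cancels against `φ.inv`.
  let φ : A ≅ DoldKan.Γ₀.obj (moore A) := Abelian.DoldKan.equivalence.unitIso.app A
  obtain ⟨c, c₀, ι, h1, h2, h5⟩ := Γ₀_exists_coefficient (moore A) θ
  have hnat : ∀ {n k' : ℕ} (f : ⦋n⦌ ⟶ ⦋k'⦌) {Z : ModuleCat.{u} K} (ψ : _ ⟶ Z),
      A.map f.op ≫ φ.hom.app (Opposite.op ⦋n⦌) ≫ ψ =
        φ.hom.app (Opposite.op ⦋k'⦌) ≫ (DoldKan.Γ₀.obj (moore A)).map f.op ≫ ψ := fun f Z ψ =>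
    NatTrans.naturality_assoc φ.hom f.op ψ
  have h6 : c₀ ≫ ι ≫ φ.inv.app (Opposite.op ⦋k⦌) ≫ rho A k =
      φ.inv.app (Opposite.op ⦋k⦌) ≫ rho A k := by
    refine h5 _ _ fun k' f j hj => ?_
    rw [NatTrans.naturality_assoc φ.inv f.op, killsDegenerate_rho A k k' f j hj, Limits.comp_zero]
  refine ⟨φ.hom.app (Opposite.op ⦋m⦌) ≫ c ≫ ι ≫ φ.inv.app (Opposite.op ⦋k⦌) ≫ rho A k,
    fun k' f j hf hθ => ?_, ?_⟩
  · rw [hnat, reassoc_of% (h1 k' f j hf hθ), Limits.zero_comp, Limits.comp_zero]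
  · rw [hnat, reassoc_of% h2, h6, Iso.hom_inv_id_app_assoc, mooreIncl_rho]

end Degenerate

end PathHomology

namespace PathHomology

/-! ### Combinatorics of shuffles -/

lemma simplex_hom_ext {m n : ℕ} {f g : ⦋m⦌ ⟶ ⦋n⦌}
    (h : ∀ x : Fin (m + 1), ((f x : Fin (n + 1)) : ℕ) = (g x : Fin (n + 1))) : f = g := by
  ext x : 3
  exact Fin.ext (h x)

/-- If `θ` is a monotone surjection and `f` is strict wherever `θ` is, then the target of `f` is at
least as large as that of `θ`, and if the targets agree, so do `f` and `θ`. -/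
lemma le_and_eq_of_strict {m k k' : ℕ} (θ : ⦋m⦌ ⟶ ⦋k⦌) (f : ⦋m⦌ ⟶ ⦋k'⦌)
    (hθ : Function.Surjective (fun i : Fin (m + 1) => (θ i : Fin (k + 1))))
    (h : ∀ j : Fin m, (f j.castSucc : Fin (k' + 1)) = f j.succ →
      (θ j.castSucc : Fin (k + 1)) = θ j.succ) :
    k ≤ k' ∧ (k' = k → ∀ x : Fin (m + 1), ((f x : Fin (k' + 1)) : ℕ) = (θ x : Fin (k + 1))) := by
  have step : ∀ j : Fin m, ((θ j.succ : Fin (k + 1)) : ℕ) ≤ (θ j.castSucc : Fin (k + 1)) + 1 := by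
    intro j
    by_contra! hj
    obtain ⟨x, hx⟩ := hθ ⟨(θ j.castSucc : Fin (k + 1)) + 1, by
      have := (θ j.succ : Fin (k + 1)).isLt; omega⟩
    have hx' : ((θ x : Fin (k + 1)) : ℕ) = (θ j.castSucc : Fin (k + 1)) + 1 := congrArg Fin.val hx
    rcases le_or_gt x j.castSucc with hle | hlt
    · have : (θ x : Fin (k + 1)) ≤ θ j.castSucc := hom_mono θ hle
      rw [Fin.le_def] at this; omega
    · have : (θ j.succ : Fin (k + 1)) ≤ θ x := hom_mono θ (Fin.castSucc_lt_iff_succ_le.1 hlt)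
      rw [Fin.le_def] at this; omega
  -- The difference `f - θ` is nondecreasing (written without subtraction), since `θ` climbs by at
  -- most one per step and only where `f` climbs. So it lies between `f 0 ≥ 0` and `f m - k ≤ k' -
  -- k`, which gives both claims.
  have stepf : ∀ j : Fin m, ((θ j.succ : Fin (k + 1)) : ℕ) + (f j.castSucc : Fin (k' + 1)) ≤
      (θ j.castSucc : Fin (k + 1)) + (f j.succ : Fin (k' + 1)) := by
    intro j
    have h1 : (f j.castSucc : Fin (k' + 1)) ≤ f j.succ := hom_mono f (Fin.castSucc_le_succ j)
    rcases h1.eq_or_lt with h2 | h2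
    · rw [h j h2, h2]
    · have := step j
      rw [Fin.lt_def] at h2; omega
  obtain ⟨a, ha⟩ := hθ 0
  obtain ⟨b, hb⟩ := hθ (Fin.last k)
  have h0 : ((θ 0 : Fin (k + 1)) : ℕ) = 0 := by
    have : (θ 0 : Fin (k + 1)) ≤ 0 := (hom_mono θ (Fin.zero_le a)).trans_eq ha
    rw [Fin.le_zero_iff.1 this]; rfl
  have h1 : ((θ (Fin.last m) : Fin (k + 1)) : ℕ) = k := by
    have : Fin.last k ≤ (θ (Fin.last m) : Fin (k + 1)) := hb.symm.le.trans
      (hom_mono θ (Fin.le_last b))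
    rw [Fin.last_le_iff.1 this]; rfl
  have low : ∀ x : Fin (m + 1), ((θ x : Fin (k + 1)) : ℕ) + (f 0 : Fin (k' + 1)) ≤
      (f x : Fin (k' + 1)) := by
    intro x
    induction x using Fin.induction with
    | zero => omega
    | succ j ih => have := stepf j; omega
  have high : ∀ x : Fin (m + 1), k + ((f x : Fin (k' + 1)) : ℕ) ≤
      (θ x : Fin (k + 1)) + (f (Fin.last m) : Fin (k' + 1)) := by
    intro x
    induction x using Fin.reverseInduction with
    | last => omega
    | cast j ih => have := stepf j; omega
  have hlast : ((f (Fin.last m) : Fin (k' + 1)) : ℕ) < k' + 1 := Fin.isLt _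
  refine ⟨by have := low (Fin.last m); omega, fun hk x => ?_⟩
  have := low x
  have := high x
  omega

namespace Shuffle

variable {n l k : ℕ}

section Basic

variable (p : Shuffle n l k)

lemma mem_mu_iff (i : Fin n) : i ∈ p.mu ↔ i ∉ p.nu := by
  have h1 : i ∈ p.1.1 → i ∉ p.1.2 := fun h => Finset.disjoint_left.1 p.2.1.1 h
  have h2 : i ∈ p.1.1 ∪ p.1.2 := by rw [p.2.1.2]; exact Finset.mem_univ i
  rw [Finset.mem_union] at h2
  exact ⟨h1, fun h => h2.resolve_right h⟩

lemma mem_nu_iff (i : Fin n) : i ∈ p.nu ↔ i ∉ p.mu := by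
  rw [mem_mu_iff, not_not]

lemma ext_nu {p q : Shuffle n l k} (h : ∀ i, i ∈ p.nu ↔ i ∈ q.nu) : p = q := by
  refine Subtype.ext (Prod.ext (Finset.ext fun i => ?_) (Finset.ext h))
  exact (p.mem_mu_iff i).trans ((not_congr (h i)).trans (q.mem_mu_iff i).symm)

lemma add_eq (p : Shuffle n l k) : k + l = n := by
  have h := Finset.card_union_of_disjoint p.2.1.1
  rw [p.2.1.2, p.2.2.1, p.2.2.2, Finset.card_univ, Fintype.card_fin] at h
  omega

lemma sMu_succ (i : Fin n) : ((p.sMu i.succ : Fin (k + 1)) : ℕ) =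
    (p.sMu i.castSucc : Fin (k + 1)) + if i ∈ p.nu then 1 else 0 := countMap_succ _ _ i

lemma sNu_succ (i : Fin n) : ((p.sNu i.succ : Fin (l + 1)) : ℕ) =
    (p.sNu i.castSucc : Fin (l + 1)) + if i ∈ p.nu then 0 else 1 := by
  refine (countMap_succ _ _ i).trans ?_
  by_cases h : i ∈ p.nu
  · rw [if_pos h, if_neg ((p.mem_nu_iff i).1 h)]; rfl
  · rw [if_neg h, if_pos ((p.mem_mu_iff i).2 h)]; rfl

lemma sMu_zero : ((p.sMu 0 : Fin (k + 1)) : ℕ) = 0 := by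
  refine (countMap_apply _ _ 0).trans ?_
  simp

lemma sNu_zero : ((p.sNu 0 : Fin (l + 1)) : ℕ) = 0 := by
  refine (countMap_apply _ _ 0).trans ?_
  simp

/-- The two surjections are the coordinates of a lattice path with unit steps, so the vertex `x` has
coordinate sum `x`. This lets one coordinate determine the other. -/
lemma sMu_add_sNu (x : Fin (n + 1)) :
    ((p.sMu x : Fin (k + 1)) : ℕ) + (p.sNu x : Fin (l + 1)) = x := by
  induction x using Fin.induction with
  | zero => rw [sMu_zero, sNu_zero]; rfl
  | succ i ih =>
    rw [sMu_succ, sNu_succ, Fin.val_succ]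
    rw [Fin.val_castSucc] at ih
    split_ifs <;> omega

lemma sMu_surjective : Function.Surjective (fun i : Fin (n + 1) => (p.sMu i : Fin (k + 1))) :=
  countMap_surjective _ _

lemma sNu_surjective : Function.Surjective (fun i : Fin (n + 1) => (p.sNu i : Fin (l + 1))) :=
  countMap_surjective _ _

lemma conn_sMu : Conn p.sMu := Conn.of_surjective _ p.sMu_surjective

lemma conn_sNu : Conn p.sNu := Conn.of_surjective _ p.sNu_surjective

lemma sMu_collapse_iff (i : Fin n) :
    (p.sMu i.castSucc : Fin (k + 1)) = p.sMu i.succ ↔ i ∉ p.nu := countMap_eq_iff _ _ i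

lemma sNu_collapse_iff (i : Fin n) :
    (p.sNu i.castSucc : Fin (l + 1)) = p.sNu i.succ ↔ i ∈ p.nu :=
  (countMap_eq_iff _ _ i).trans (p.mem_nu_iff i).symm

/-- The number of inversions. -/
def inversions : ℕ := ((p.nu ×ˢ p.mu).filter fun q => q.2 < q.1).card

lemma sgn_eq : p.sgn = (-1) ^ p.inversions := rfl

/-- At `i`, the value of `sNu` counts the elements of `μ` below `i`, so the number of inversions is
an area cut off by the lattice path. -/
lemma inversions_eq_sum :
    p.inversions = ∑ i ∈ p.nu, ((p.sNu i.castSucc : Fin (l + 1)) : ℕ) := by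
  rw [inversions, Finset.card_filter, Finset.sum_product]
  refine Finset.sum_congr rfl fun i _ => ?_
  rw [← Finset.card_filter]
  rfl

end Basic

/-! #### Exchanging two adjacent positions -/

/-- The shuffle with the positions `j` and `j + 1` exchanged. -/
def swap {m : ℕ} (p : Shuffle (m + 1) l k) (j : Fin m) : Shuffle (m + 1) l k :=
  ⟨(p.mu.map (Equiv.swap j.castSucc j.succ).toEmbedding,
    p.nu.map (Equiv.swap j.castSucc j.succ).toEmbedding),
    ⟨(Finset.disjoint_map _).2 p.2.1.1, by
      rw [← Finset.map_union]
      exact (congrArg _ p.2.1.2).trans (Finset.map_univ_equiv _)⟩,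
    (Finset.card_map _).trans p.2.2.1, (Finset.card_map _).trans p.2.2.2⟩

section Swap

variable {m : ℕ} (p : Shuffle (m + 1) l k) (j : Fin m)

lemma mem_swap_nu (x : Fin (m + 1)) :
    x ∈ (p.swap j).nu ↔ Equiv.swap j.castSucc j.succ x ∈ p.nu := by
  change x ∈ p.nu.map _ ↔ _
  rw [Finset.mem_map_equiv, Equiv.symm_swap]

lemma castSucc_mem_swap_nu : j.castSucc ∈ (p.swap j).nu ↔ j.succ ∈ p.nu := by
  rw [mem_swap_nu, Equiv.swap_apply_left]

lemma succ_mem_swap_nu : j.succ ∈ (p.swap j).nu ↔ j.castSucc ∈ p.nu := by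
  rw [mem_swap_nu, Equiv.swap_apply_right]

lemma mem_swap_nu_of_ne {x : Fin (m + 1)} (h1 : x ≠ j.castSucc) (h2 : x ≠ j.succ) :
    x ∈ (p.swap j).nu ↔ x ∈ p.nu := by
  rw [mem_swap_nu, Equiv.swap_apply_of_ne_of_ne h1 h2]

lemma swap_swap : (p.swap j).swap j = p :=
  ext_nu fun i => by rw [mem_swap_nu, mem_swap_nu, Equiv.swap_apply_self]

/-- Exchanging two adjacent steps moves only the vertex between them, which is `j + 1`. -/
lemma swap_sMu (x : Fin (m + 2)) (hx : x ≠ j.succ.castSucc) :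
    ((p.swap j).sMu x : Fin (k + 1)) = p.sMu x := by
  refine Fin.ext ((countMap_apply _ _ x).trans (Eq.trans ?_ (countMap_apply _ _ x).symm))
  change ((p.nu.map _).filter _).card = _
  rw [Finset.filter_map, Finset.card_map]
  refine congrArg Finset.card (Finset.filter_congr fun i _ => ?_)
  have hx' : (x : ℕ) ≠ j + 1 := fun h => hx (Fin.ext (by simpa using h))
  simp only [Function.comp_apply, Equiv.coe_toEmbedding, Fin.lt_def, Fin.val_castSucc]
  by_cases h1 : i = j.castSucc
  · subst h1; rw [Equiv.swap_apply_left]; simp; omega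
  by_cases h2 : i = j.succ
  · subst h2; rw [Equiv.swap_apply_right]; simp; omega
  · rw [Equiv.swap_apply_of_ne_of_ne h1 h2]

lemma swap_sNu (x : Fin (m + 2)) (hx : x ≠ j.succ.castSucc) :
    ((p.swap j).sNu x : Fin (l + 1)) = p.sNu x := by
  have h1 := (p.swap j).sMu_add_sNu x
  have h2 := p.sMu_add_sNu x
  rw [swap_sMu p j x hx] at h1
  exact Fin.ext (by omega)

lemma δ_comp_swap_sMu :
    SimplexCategory.δ j.succ.castSucc ≫ (p.swap j).sMu =
      SimplexCategory.δ j.succ.castSucc ≫ p.sMu :=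
  simplex_hom_ext fun x => congrArg Fin.val (swap_sMu p j _ (Fin.succAbove_ne _ x))

lemma δ_comp_swap_sNu :
    SimplexCategory.δ j.succ.castSucc ≫ (p.swap j).sNu =
      SimplexCategory.δ j.succ.castSucc ≫ p.sNu :=
  simplex_hom_ext fun x => congrArg Fin.val (swap_sNu p j _ (Fin.succAbove_ne _ x))

lemma swap_lt_swap {a b : Fin (m + 1)} (h : a < b) (hab : ¬ (a = j.castSucc ∧ b = j.succ)) :
    Equiv.swap j.castSucc j.succ a < Equiv.swap j.castSucc j.succ b := by
  rw [Equiv.swap_apply_def, Equiv.swap_apply_def]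
  simp only [Fin.lt_def, Fin.ext_iff, Fin.val_castSucc, Fin.val_succ] at h hab ⊢
  split_ifs <;> simp <;> omega

/-- An adjacent transposition preserves the order of every pair except `(j, j + 1)`. It therefore
matches the inversions of the two shuffles, apart from the one that `j` and `j + 1` form in `p`. -/
lemma inversions_swap (h0 : j.castSucc ∉ p.nu) (h1 : j.succ ∈ p.nu) :
    p.inversions = (p.swap j).inversions + 1 := by
  have hmem : (j.succ, j.castSucc) ∈ (p.nu ×ˢ p.mu).filter fun q => q.2 < q.1 := by
    simp [h1, (p.mem_mu_iff _).2 h0]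
  rw [inversions, ← Finset.card_erase_add_one hmem, inversions]
  congr 1
  have hmu : ∀ x, x ∈ (p.swap j).mu ↔ Equiv.swap j.castSucc j.succ x ∈ p.mu := fun x => by
    rw [mem_mu_iff, mem_mu_iff, mem_swap_nu]
  refine Finset.card_nbij'
    (fun q => (Equiv.swap j.castSucc j.succ q.1, Equiv.swap j.castSucc j.succ q.2))
    (fun q => (Equiv.swap j.castSucc j.succ q.1, Equiv.swap j.castSucc j.succ q.2))
    ?_ ?_ (fun q _ => by simp) (fun q _ => by simp)
  · rintro ⟨a, b⟩ h
    simp only [Finset.coe_erase, Finset.coe_filter, Finset.mem_product, Set.mem_sdiff,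
      Set.mem_ofPred_eq, Set.mem_singleton_iff, Prod.mk.injEq] at h ⊢
    refine ⟨⟨?_, ?_⟩, swap_lt_swap j h.1.2 fun h' => h.2 ⟨h'.2, h'.1⟩⟩
    · rw [mem_swap_nu, Equiv.swap_apply_self]; exact h.1.1.1
    · rw [hmu, Equiv.swap_apply_self]; exact h.1.1.2
  · rintro ⟨a, b⟩ h
    simp only [Finset.coe_erase, Finset.coe_filter, Finset.mem_product, Set.mem_sdiff,
      Set.mem_ofPred_eq, Set.mem_singleton_iff, Prod.mk.injEq] at h ⊢
    refine ⟨⟨⟨(mem_swap_nu ..).1 h.1.1, (hmu _).1 h.1.2⟩, swap_lt_swap j h.2 fun h' => ?_⟩,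
      fun h' => ?_⟩
    · rw [h'.1, hmu, Equiv.swap_apply_left, mem_mu_iff] at h
      exact h.1.2 h1
    · rw [Equiv.swap_apply_eq_iff, Equiv.swap_apply_eq_iff, Equiv.swap_apply_left,
        Equiv.swap_apply_right] at h'
      rw [h'.1, h'.2] at h
      exact absurd h.2 (by simp [Fin.lt_def, -Fin.val_fin_lt])

lemma sgn_swap (h : ¬ (j.castSucc ∈ p.nu ↔ j.succ ∈ p.nu)) : (p.swap j).sgn = -p.sgn := by
  by_cases h0 : j.castSucc ∈ p.nu
  · have h1 : j.succ ∉ p.nu := fun h1 => h ⟨fun _ => h1, fun _ => h0⟩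
    have := inversions_swap (p.swap j) j (by rwa [castSucc_mem_swap_nu])
      (by rwa [succ_mem_swap_nu])
    rw [sgn_eq, sgn_eq, this, swap_swap, pow_succ, mul_neg_one]
  · have h1 : j.succ ∈ p.nu := by
      by_contra h1; exact h ⟨fun h' => absurd h' h0, fun h' => absurd h' h1⟩
    have := inversions_swap p j h0 h1
    rw [sgn_eq, sgn_eq, this, pow_succ, mul_neg_one, neg_neg]

/-- The path of a shuffle without one interior vertex determines the vertex, and determines the
shuffle up to an exchange. -/
lemma eq_or_eq_swap (q : Shuffle (m + 1) l k) (i : Fin (m + 2))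
    (hMu : SimplexCategory.δ i ≫ q.sMu = SimplexCategory.δ j.succ.castSucc ≫ p.sMu)
    (hNu : SimplexCategory.δ i ≫ q.sNu = SimplexCategory.δ j.succ.castSucc ≫ p.sNu)
    (hp : ¬ (j.castSucc ∈ p.nu ↔ j.succ ∈ p.nu)) :
    i = j.succ.castSucc ∧ (q = p ∨ q = p.swap j) := by
  have hMu' : ∀ x : Fin (m + 1), (q.sMu (i.succAbove x) : Fin (k + 1)) =
      p.sMu (j.succ.castSucc.succAbove x) := fun x => congrArg (fun f => f.toOrderHom x) hMu
  have hNu' : ∀ x : Fin (m + 1), (q.sNu (i.succAbove x) : Fin (l + 1)) =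
      p.sNu (j.succ.castSucc.succAbove x) := fun x => congrArg (fun f => f.toOrderHom x) hNu
  -- A vertex is recovered as the sum of its coordinates, so equal faces have equal sets of vertices
  -- and omit the same vertex.
  obtain rfl : i = j.succ.castSucc := by
    refine Fin.succAbove_left_injective (funext fun x => Fin.ext ?_)
    rw [← q.sMu_add_sNu, ← p.sMu_add_sNu, hMu', hNu']
  refine ⟨rfl, ?_⟩
  have hq : ∀ x : Fin (m + 2), x ≠ j.succ.castSucc → (q.sMu x : Fin (k + 1)) = p.sMu x := by
    intro x hx
    obtain ⟨y, rfl⟩ := Fin.exists_succAbove_eq hx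
    exact hMu' y
  have hne : ∀ x : Fin (m + 1), x ≠ j.castSucc → x ≠ j.succ → (x ∈ q.nu ↔ x ∈ p.nu) := by
    intro x h1 h2
    rw [← not_iff_not, ← sMu_collapse_iff, ← sMu_collapse_iff, hq, hq]
    · intro h; exact h1 (Fin.ext (by simpa [Fin.ext_iff] using h))
    · intro h; exact h2 (Fin.ext (by simpa [Fin.ext_iff] using h))
  -- The paths agree at the vertices `j` and `j + 2`, so `q` and `p` have equally many of the
  -- positions `j`, `j + 1` in `ν`. For `p` this number is one, which leaves two possibilities for
  -- `q`.
  have hcount : ∀ r : Shuffle (m + 1) l k, ((r.sMu j.succ.succ : Fin (k + 1)) : ℕ) =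
      (r.sMu j.castSucc.castSucc : Fin (k + 1)) + (if j.castSucc ∈ r.nu then 1 else 0) +
        (if j.succ ∈ r.nu then 1 else 0) := by
    intro r
    rw [sMu_succ, ← Fin.succ_castSucc, sMu_succ]
  have h1 := hcount p
  have h2 := hcount q
  rw [hq j.succ.succ (by simp [Fin.ext_iff]), hq j.castSucc.castSucc (by simp [Fin.ext_iff])] at h2
  have key : (j.castSucc ∈ q.nu ↔ j.castSucc ∈ p.nu) ∧ (j.succ ∈ q.nu ↔ j.succ ∈ p.nu) ∨
      (j.castSucc ∈ q.nu ↔ j.succ ∈ p.nu) ∧ (j.succ ∈ q.nu ↔ j.castSucc ∈ p.nu) := by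
    by_cases a : j.castSucc ∈ p.nu <;> by_cases b : j.succ ∈ p.nu <;>
      by_cases c : j.castSucc ∈ q.nu <;> by_cases d : j.succ ∈ q.nu <;>
      simp only [a, b, c, d, if_true, if_false] at h1 h2 hp ⊢ <;> first | omega | simp at *
  refine key.imp (fun h => ext_nu fun x => ?_) (fun h => ext_nu fun x => ?_)
  · by_cases h3 : x = j.castSucc
    · rw [h3, h.1]
    by_cases h4 : x = j.succ
    · rw [h4, h.2]
    exact hne x h3 h4
  · by_cases h3 : x = j.castSucc
    · rw [h3, h.1, castSucc_mem_swap_nu]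
    by_cases h4 : x = j.succ
    · rw [h4, h.2, succ_mem_swap_nu]
    rw [hne x h3 h4, mem_swap_nu_of_ne p j h3 h4]

/-- The omitted vertex `j + 1` has the same first coordinate as the vertex `j`, so no value is lost.
For `sNu` below, the vertex `j + 2` takes this role. -/
lemma δ_comp_sMu_surjective (h : j.castSucc ∉ p.nu) :
    Function.Surjective (fun x : Fin (m + 1) =>
      ((SimplexCategory.δ j.succ.castSucc ≫ p.sMu) x : Fin (k + 1))) := by
  intro y
  obtain ⟨x, hx⟩ := p.sMu_surjective y
  by_cases hj : x = j.succ.castSucc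
  · obtain ⟨z, hz⟩ := Fin.exists_succAbove_eq
      (show j.castSucc.castSucc ≠ j.succ.castSucc by simp [Fin.ext_iff])
    refine ⟨z, ?_⟩
    change (p.sMu (j.succ.castSucc.succAbove z) : Fin (k + 1)) = y
    rw [hz, ← hx, hj, ← Fin.succ_castSucc]
    exact (p.sMu_collapse_iff _).2 h
  · obtain ⟨z, hz⟩ := Fin.exists_succAbove_eq hj
    exact ⟨z, (congrArg (fun a => (p.sMu a : Fin (k + 1))) hz).trans hx⟩

lemma δ_comp_sNu_surjective (h : j.succ ∈ p.nu) :
    Function.Surjective (fun x : Fin (m + 1) =>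
      ((SimplexCategory.δ j.succ.castSucc ≫ p.sNu) x : Fin (l + 1))) := by
  intro y
  obtain ⟨x, hx⟩ := p.sNu_surjective y
  by_cases hj : x = j.succ.castSucc
  · obtain ⟨z, hz⟩ := Fin.exists_succAbove_eq
      (show j.succ.succ ≠ j.succ.castSucc by simp [Fin.ext_iff])
    refine ⟨z, ?_⟩
    change (p.sNu (j.succ.castSucc.succAbove z) : Fin (l + 1)) = y
    rw [hz, ← hx, hj]
    exact ((p.sNu_collapse_iff _).2 h).symm
  · obtain ⟨z, hz⟩ := Fin.exists_succAbove_eq hj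
    exact ⟨z, (congrArg (fun a => (p.sNu a : Fin (l + 1))) hz).trans hx⟩

end Swap

/-! #### The shuffle without inversions -/

/-- The shuffle `({k, …, n - 1}, {0, …, k - 1})`. -/
def base (h : k + l = n) : Shuffle n l k :=
  ⟨(Finset.univ.filter fun i => k ≤ (i : ℕ), Finset.univ.filter fun i => (i : ℕ) < k), by
    refine ⟨⟨?_, ?_⟩, ?_, ?_⟩
    · exact Finset.disjoint_left.2 fun i hi hi' => by simp at hi hi'; omega
    · ext i; simp; omega
    · have h1 := Finset.card_filter_add_card_filter_not (s := (Finset.univ : Finset (Fin n)))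
        (fun i => (i : ℕ) < k)
      simp only [not_lt, Fin.card_filter_val_lt, Finset.card_univ, Fintype.card_fin] at h1
      simp only
      omega
    · simp only [Fin.card_filter_val_lt]; omega⟩

lemma mem_base_nu (h : k + l = n) (i : Fin n) : i ∈ (base h).nu ↔ (i : ℕ) < k := by
  change i ∈ Finset.univ.filter _ ↔ _
  simp

lemma sgn_base (h : k + l = n) : (base h).sgn = 1 := by
  have : (base h).inversions = 0 := by
    rw [inversions, Finset.card_eq_zero, Finset.filter_eq_empty_iff]
    rintro ⟨a, b⟩ hab
    rw [Finset.mem_product, mem_mu_iff, mem_base_nu, mem_base_nu] at hab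
    simp only [Fin.lt_def]
    simp only at hab
    omega
  rw [sgn_eq, this, pow_zero]

lemma eq_base_of_forall (p : Shuffle n l k) (hp : ∀ a ∈ p.nu, ∀ b ∉ p.nu, a < b) :
    p = base p.add_eq := by
  refine ext_nu fun i => ?_
  have hcard : p.nu.card = k := p.2.2.2
  rw [mem_base_nu]
  constructor
  · intro hi
    have h1 : Finset.Iic i ⊆ p.nu := fun j hj => by
      by_contra h
      exact absurd (hp i hi j h) (not_lt.2 (Finset.mem_Iic.1 hj))
    have := Finset.card_le_card h1
    rw [Fin.card_Iic] at this
    omega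
  · intro hi
    by_contra h
    have h1 : p.nu ⊆ Finset.Iio i := fun j hj => Finset.mem_Iio.2 (hp j hj i h)
    have := Finset.card_le_card h1
    rw [Fin.card_Iio] at this
    omega

/-- Without such a `j`, the complement of `ν` is closed under passing to larger positions. Then `ν`
is an initial segment, which its cardinality determines. -/
lemma exists_descent {m : ℕ} (p : Shuffle (m + 1) l k) (hp : p ≠ base p.add_eq) :
    ∃ j : Fin m, j.castSucc ∉ p.nu ∧ j.succ ∈ p.nu := by
  by_contra! h
  refine hp (p.eq_base_of_forall ?_)
  have key : ∀ a b : Fin (m + 1), b ≤ a → b ∉ p.nu → a ∉ p.nu := by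
    intro a b
    induction a using Fin.induction with
    | zero => intro hb; rw [Fin.le_zero_iff.1 hb]; exact id
    | succ j ih =>
      intro hb hbn
      rcases hb.eq_or_lt with rfl | hlt
      · exact hbn
      · exact h j (ih (Fin.le_castSucc_iff.2 hlt) hbn)
  intro a ha b hb
  by_contra hab
  exact key a b (not_lt.1 hab) hb ha

/-! #### Adding a first position -/

section Cons

variable {m : ℕ} (p : Shuffle m l k)

/-- The shuffle obtained by adding a first position, in `ν`. -/
def consNu : Shuffle (m + 1) l (k + 1) :=
  ⟨(p.mu.map (Fin.succEmb m), Finset.cons 0 (p.nu.map (Fin.succEmb m)) (by simp)), by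
    have h : ∀ i, i ∈ p.mu ↔ i ∉ p.nu := p.mem_mu_iff
    refine ⟨⟨?_, ?_⟩, (Finset.card_map _).trans p.2.2.1, ?_⟩
    · refine Finset.disjoint_left.2 fun i => ?_
      induction i using Fin.cases <;> simp [h]
    · ext i
      induction i using Fin.cases <;> simp [h, em']
    · rw [Finset.card_cons, Finset.card_map]
      exact congrArg (· + 1) p.2.2.2⟩

/-- The shuffle obtained by adding a first position, in `μ`. -/
def consMu : Shuffle (m + 1) (l + 1) k :=
  ⟨(Finset.cons 0 (p.mu.map (Fin.succEmb m)) (by simp), p.nu.map (Fin.succEmb m)), by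
    have h : ∀ i, i ∈ p.mu ↔ i ∉ p.nu := p.mem_mu_iff
    refine ⟨⟨?_, ?_⟩, ?_, (Finset.card_map _).trans p.2.2.2⟩
    · refine Finset.disjoint_left.2 fun i => ?_
      induction i using Fin.cases <;> simp [h]
    · ext i
      induction i using Fin.cases <;> simp [h, em']
    · rw [Finset.card_cons, Finset.card_map]
      exact congrArg (· + 1) p.2.2.1⟩

lemma zero_mem_consNu_nu : (0 : Fin (m + 1)) ∈ p.consNu.nu := by
  change 0 ∈ Finset.cons 0 (p.nu.map (Fin.succEmb m)) (by simp)
  simp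

lemma zero_notMem_consMu_nu : (0 : Fin (m + 1)) ∉ p.consMu.nu := by
  change _ ∉ p.nu.map _
  simp

lemma succ_mem_consNu_nu (i : Fin m) : i.succ ∈ p.consNu.nu ↔ i ∈ p.nu := by
  change _ ∈ Finset.cons 0 (p.nu.map (Fin.succEmb m)) (by simp) ↔ _
  simp

lemma succ_mem_consMu_nu (i : Fin m) : i.succ ∈ p.consMu.nu ↔ i ∈ p.nu := by
  change _ ∈ p.nu.map _ ↔ _
  simp

lemma consNu_sMu_succ (x : Fin (m + 1)) :
    ((p.consNu.sMu x.succ : Fin (k + 1 + 1)) : ℕ) = (p.sMu x : Fin (k + 1)) + 1 := by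
  induction x using Fin.induction with
  | zero =>
    rw [sMu_succ, if_pos p.zero_mem_consNu_nu, sMu_zero]
    exact congrArg (· + 1) p.consNu.sMu_zero
  | succ i ih =>
    rw [sMu_succ, ← Fin.succ_castSucc, ih, sMu_succ]
    simp only [succ_mem_consNu_nu]
    omega

lemma consMu_sMu_succ (x : Fin (m + 1)) :
    ((p.consMu.sMu x.succ : Fin (k + 1)) : ℕ) = (p.sMu x : Fin (k + 1)) := by
  induction x using Fin.induction with
  | zero =>
    rw [sMu_succ, if_neg p.zero_notMem_consMu_nu, sMu_zero]
    exact p.consMu.sMu_zero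
  | succ i ih =>
    rw [sMu_succ, ← Fin.succ_castSucc, ih, sMu_succ]
    simp only [succ_mem_consMu_nu]

lemma consNu_sNu_succ (x : Fin (m + 1)) :
    ((p.consNu.sNu x.succ : Fin (l + 1)) : ℕ) = (p.sNu x : Fin (l + 1)) := by
  have h1 := p.consNu.sMu_add_sNu x.succ
  have h2 := p.sMu_add_sNu x
  rw [consNu_sMu_succ, Fin.val_succ] at h1
  omega

lemma consMu_sNu_succ (x : Fin (m + 1)) :
    ((p.consMu.sNu x.succ : Fin (l + 1 + 1)) : ℕ) = (p.sNu x : Fin (l + 1)) + 1 := by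
  have h1 := p.consMu.sMu_add_sNu x.succ
  have h2 := p.sMu_add_sNu x
  rw [consMu_sMu_succ, Fin.val_succ] at h1
  omega

lemma δ_zero_comp_consNu_sMu :
    SimplexCategory.δ 0 ≫ p.consNu.sMu = p.sMu ≫ SimplexCategory.δ 0 :=
  simplex_hom_ext p.consNu_sMu_succ

lemma δ_zero_comp_consNu_sNu : SimplexCategory.δ 0 ≫ p.consNu.sNu = p.sNu :=
  simplex_hom_ext p.consNu_sNu_succ

lemma δ_zero_comp_consMu_sMu : SimplexCategory.δ 0 ≫ p.consMu.sMu = p.sMu :=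
  simplex_hom_ext p.consMu_sMu_succ

lemma δ_zero_comp_consMu_sNu :
    SimplexCategory.δ 0 ≫ p.consMu.sNu = p.sNu ≫ SimplexCategory.δ 0 :=
  simplex_hom_ext p.consMu_sNu_succ

lemma sgn_consNu : p.consNu.sgn = p.sgn := by
  have : p.consNu.inversions = p.inversions := by
    rw [inversions_eq_sum, inversions_eq_sum]
    refine (Finset.sum_cons (a := 0) (s := p.nu.map (Fin.succEmb m)) (by simp)).trans ?_
    rw [Finset.sum_map]
    refine (congrArg (· + _) p.consNu.sNu_zero).trans ((zero_add _).trans ?_)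
    exact Finset.sum_congr rfl fun i _ => p.consNu_sNu_succ i.castSucc
  rw [sgn_eq, sgn_eq, this]

/-- A first position in `μ` forms an inversion with each of the `k` elements of `ν`. The resulting
sign is the Koszul sign of the tensor product differential. -/
lemma sgn_consMu : p.consMu.sgn = (-1) ^ k * p.sgn := by
  have : p.consMu.inversions = k + p.inversions := by
    rw [inversions_eq_sum, inversions_eq_sum]
    refine (Finset.sum_map _ _ _).trans ?_
    refine (Finset.sum_congr rfl fun i _ => p.consMu_sNu_succ i.castSucc).trans ?_
    rw [Finset.sum_add_distrib, Finset.sum_const, smul_eq_mul, mul_one, add_comm]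
    exact congrArg (· + _) p.2.2.2
  rw [sgn_eq, sgn_eq, this, pow_add]

lemma exists_consNu_eq (q : Shuffle (m + 1) l (k + 1)) (h : (0 : Fin (m + 1)) ∈ q.nu) :
    ∃ p : Shuffle m l k, p.consNu = q := by
  have hmu : (0 : Fin (m + 1)) ∉ q.mu := (q.mem_nu_iff 0).1 h
  have e1 : (Finset.univ.filter fun i => i.succ ∈ q.mu).map (Fin.succEmb m) = q.mu := by
    ext i; induction i using Fin.cases <;> simp [hmu]
  have e2 : Finset.cons 0 ((Finset.univ.filter fun i => i.succ ∈ q.nu).map (Fin.succEmb m))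
      (by simp) = q.nu := by
    ext i; induction i using Fin.cases <;> simp [h]
  refine ⟨⟨(Finset.univ.filter fun i => i.succ ∈ q.mu, Finset.univ.filter fun i => i.succ ∈ q.nu),
    ⟨?_, ?_⟩, ?_, ?_⟩, Subtype.ext (Prod.ext e1 e2)⟩
  · exact Finset.disjoint_left.2 fun i => by simp [q.mem_mu_iff]
  · ext i; simp [q.mem_mu_iff, em']
  · exact (Finset.card_map _).symm.trans ((congrArg _ e1).trans q.2.2.1)
  · have := (congrArg Finset.card e2).trans q.2.2.2
    rw [Finset.card_cons, Finset.card_map] at this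
    exact Nat.succ_injective this

lemma exists_consMu_eq (q : Shuffle (m + 1) (l + 1) k) (h : (0 : Fin (m + 1)) ∉ q.nu) :
    ∃ p : Shuffle m l k, p.consMu = q := by
  have hmu : (0 : Fin (m + 1)) ∈ q.mu := (q.mem_mu_iff 0).2 h
  have e1 : (Finset.univ.filter fun i => i.succ ∈ q.nu).map (Fin.succEmb m) = q.nu := by
    ext i; induction i using Fin.cases <;> simp [h]
  have e2 : Finset.cons 0 ((Finset.univ.filter fun i => i.succ ∈ q.mu).map (Fin.succEmb m))
      (by simp) = q.mu := by
    ext i; induction i using Fin.cases <;> simp [hmu]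
  refine ⟨⟨(Finset.univ.filter fun i => i.succ ∈ q.mu, Finset.univ.filter fun i => i.succ ∈ q.nu),
    ⟨?_, ?_⟩, ?_, ?_⟩, Subtype.ext (Prod.ext e2 e1)⟩
  · exact Finset.disjoint_left.2 fun i => by simp [q.mem_mu_iff]
  · ext i; simp [q.mem_mu_iff, em']
  · have := (congrArg Finset.card e2).trans q.2.2.1
    rw [Finset.card_cons, Finset.card_map] at this
    exact Nat.succ_injective this
  · exact (Finset.card_map _).symm.trans ((congrArg _ e1).trans q.2.2.2)

variable {M : Type*} [AddCommMonoid M]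

/-- Splitting shuffles by their first step separates the two parts of the Leibniz rule when the face
`d_0` is applied. -/
lemma sum_filter_zero_mem (F : Shuffle (m + 1) l (k + 1) → M) :
    ∑ q : Shuffle (m + 1) l (k + 1) with (0 : Fin (m + 1)) ∈ q.nu, F q =
      ∑ p : Shuffle m l k, F p.consNu := by
  symm
  refine Finset.sum_nbij consNu (fun p _ => ?_) (fun p _ q _ h => ?_) (fun q hq => ?_)
    fun _ _ => rfl
  · simpa using p.zero_mem_consNu_nu
  · refine ext_nu fun i => ?_
    have h : p.consNu = q.consNu := h
    rw [← succ_mem_consNu_nu, h, succ_mem_consNu_nu]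
  · obtain ⟨p, rfl⟩ := exists_consNu_eq q (by simpa using hq)
    exact ⟨p, by simp, rfl⟩

lemma sum_filter_zero_notMem (F : Shuffle (m + 1) (l + 1) k → M) :
    ∑ q : Shuffle (m + 1) (l + 1) k with (0 : Fin (m + 1)) ∉ q.nu, F q =
      ∑ p : Shuffle m l k, F p.consMu := by
  symm
  refine Finset.sum_nbij consMu (fun p _ => ?_) (fun p _ q _ h => ?_) (fun q hq => ?_)
    fun _ _ => rfl
  · simpa using p.zero_notMem_consMu_nu
  · refine ext_nu fun i => ?_
    have h : p.consMu = q.consMu := h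
    rw [← succ_mem_consMu_nu, h, succ_mem_consMu_nu]
  · obtain ⟨p, rfl⟩ := exists_consMu_eq q (by simpa using hq)
    exact ⟨p, by simp, rfl⟩

end Cons

end Shuffle

end PathHomology

namespace PathHomology

noncomputable section

variable {K : Type u} [CommRing K] (A A' : SimplicialObject (ModuleCat.{u} K))

/-! ### The Eilenberg–Zilber and Alexander–Whitney maps -/

/-- The morphism `A_k ⊗ A'_l ⟶ (A ⊗ A')_n` given by monotone maps `[n] → [k]`, `[n] → [l]`. -/
def tensorMap {n k l : ℕ} (f : ⦋n⦌ ⟶ ⦋k⦌) (g : ⦋n⦌ ⟶ ⦋l⦌) :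
    A _⦋k⦌ ⊗ A' _⦋l⦌ ⟶ (A ⊗ A') _⦋n⦌ :=
  A.map f.op ⊗ₘ A'.map g.op

lemma tensorMap_map {m n k l : ℕ} (f : ⦋n⦌ ⟶ ⦋k⦌) (g : ⦋n⦌ ⟶ ⦋l⦌) (θ : ⦋m⦌ ⟶ ⦋n⦌) :
    tensorMap A A' f g ≫ (A ⊗ A').map θ.op = tensorMap A A' (θ ≫ f) (θ ≫ g) := by
  rw [tensorMap, tensorMap, op_comp, op_comp, A.map_comp, A'.map_comp, ← tensorHom_comp_tensorHom]
  rfl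

lemma map_tensorMap {n k l k' l' : ℕ} (f : ⦋n⦌ ⟶ ⦋k⦌) (g : ⦋n⦌ ⟶ ⦋l⦌) (f' : ⦋k⦌ ⟶ ⦋k'⦌)
    (g' : ⦋l⦌ ⟶ ⦋l'⦌) : (A.map f'.op ⊗ₘ A'.map g'.op) ≫ tensorMap A A' f g =
      tensorMap A A' (f ≫ f') (g ≫ g') := by
  rw [tensorMap, tensorMap, op_comp, op_comp, A.map_comp, A'.map_comp, ← tensorHom_comp_tensorHom]
  rfl

lemma eilenbergZilber_eq (k l n : ℕ) : eilenbergZilber A A' k l n =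
    ∑ p : Shuffle n l k, p.sgn • tensorMap A A' p.sMu p.sNu := rfl

-- Both maps collapse the step `j`, hence both factor through `σ j`, and the tensor product of their
-- operators ends with the degeneracy `s_j` of A ⊗ A'.
variable {A A'} in
lemma KillsDegenerate.tensorMap_comp {n k l : ℕ} {Z : ModuleCat.{u} K} {φ : (A ⊗ A') _⦋n⦌ ⟶ Z}
    (h : KillsDegenerate (A ⊗ A') φ) (f : ⦋n⦌ ⟶ ⦋k⦌) (g : ⦋n⦌ ⟶ ⦋l⦌) (j : Fin n)
    (hf : (f j.castSucc : Fin (k + 1)) = f j.succ)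
    (hg : (g j.castSucc : Fin (l + 1)) = g j.succ) : tensorMap A A' f g ≫ φ = 0 := by
  cases n with
  | zero => exact j.elim0
  | succ n =>
    have hσ : ∀ i : Fin (n + 1), (SimplexCategory.σ j i.castSucc : Fin (n + 1)) =
        SimplexCategory.σ j i.succ → i = j := by
      intro i hi
      have hi : j.predAbove i.castSucc = j.predAbove i.succ := hi
      simp only [Fin.predAbove, Fin.lt_def, Fin.val_castSucc, Fin.val_succ] at hi
      split_ifs at hi <;> simp [Fin.ext_iff] at hi ⊢ <;> omega
    obtain ⟨f', rfl⟩ := factor_through (SimplexCategory.σ j) f (Fin.predAbove_surjective j)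
      fun i hi => hσ i hi ▸ hf
    obtain ⟨g', rfl⟩ := factor_through (SimplexCategory.σ j) g (Fin.predAbove_surjective j)
      fun i hi => hσ i hi ▸ hg
    rw [← tensorMap_map, Category.assoc, h n (SimplexCategory.σ j) j (by
      change j.predAbove _ = j.predAbove _
      simp), Limits.comp_zero]

lemma whiskerRight_rho_comp {k : ℕ} {Y Z : ModuleCat.{u} K} (ψ : A _⦋k⦌ ⊗ Y ⟶ Z)
    (h : ∀ (k' : ℕ) (f : ⦋k⦌ ⟶ ⦋k'⦌) (j : Fin k), (f j.castSucc : Fin (k' + 1)) = f j.succ →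
      A.map f.op ▷ Y ≫ ψ = 0) :
    (rho A k ≫ mooreIncl A k) ▷ Y ≫ ψ = ψ := by
  refine ModuleCat.hom_ext (TensorProduct.ext' fun a y => ?_)
  let φ : A _⦋k⦌ ⟶ Z := ModuleCat.ofHom (ψ.hom ∘ₗ (TensorProduct.mk K _ _).flip y)
  have hφ : KillsDegenerate A φ := fun k' f j hj =>
    ModuleCat.hom_ext (LinearMap.ext fun a =>
      LinearMap.congr_fun (congrArg ModuleCat.Hom.hom (h k' f j hj)) (a ⊗ₜ y))
  exact LinearMap.congr_fun (congrArg ModuleCat.Hom.hom hφ.rho_comp) a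

lemma whiskerLeft_rho_comp {l : ℕ} {Y Z : ModuleCat.{u} K} (ψ : Y ⊗ A _⦋l⦌ ⟶ Z)
    (h : ∀ (l' : ℕ) (f : ⦋l⦌ ⟶ ⦋l'⦌) (j : Fin l), (f j.castSucc : Fin (l' + 1)) = f j.succ →
      Y ◁ A.map f.op ≫ ψ = 0) :
    Y ◁ (rho A l ≫ mooreIncl A l) ≫ ψ = ψ := by
  refine ModuleCat.hom_ext (TensorProduct.ext' fun y a => ?_)
  let φ : A _⦋l⦌ ⟶ Z := ModuleCat.ofHom (ψ.hom ∘ₗ TensorProduct.mk K _ _ y)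
  have hφ : KillsDegenerate A φ := fun k' f j hj =>
    ModuleCat.hom_ext (LinearMap.ext fun a =>
      LinearMap.congr_fun (congrArg ModuleCat.Hom.hom (h k' f j hj)) (y ⊗ₜ a))
  exact LinearMap.congr_fun (congrArg ModuleCat.Hom.hom hφ.rho_comp) a

/-- A degeneracy followed by a surjection is not strict on all the steps of the surjection. -/
lemma exists_step_collapse {n k k' : ℕ} (c : ⦋n⦌ ⟶ ⦋k⦌)
    (hc : Function.Surjective (fun i : Fin (n + 1) => (c i : Fin (k + 1)))) (f : ⦋k⦌ ⟶ ⦋k'⦌)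
    (i : Fin k) (hf : (f i.castSucc : Fin (k' + 1)) = f i.succ) :
    ∃ j : Fin n, ((c ≫ f) j.castSucc : Fin (k' + 1)) = (c ≫ f) j.succ ∧
      (c j.castSucc : Fin (k + 1)) ≠ c j.succ := by
  cases k with
  | zero => exact i.elim0
  | succ k =>
    -- Otherwise `c ≫ σ r` would be strict wherever `c` is, although its target is smaller by one.
    obtain ⟨r, g, rfl⟩ := eq_σ_comp_of_collapse f i hf
    by_contra! h
    have := (le_and_eq_of_strict c (c ≫ SimplexCategory.σ r) hc fun j hj => h j (by
      change g _ = g _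
      exact congrArg _ hj)).1
    omega

/-- Up to degenerate elements, the terms of the Eilenberg–Zilber map do not change when the
arguments are replaced by their normalizations. -/
lemma KillsDegenerate.rho_tensorMap {n l k : ℕ} {Z : ModuleCat.{u} K} {φ : (A ⊗ A') _⦋n⦌ ⟶ Z}
    (h : KillsDegenerate (A ⊗ A') φ) (p : Shuffle n l k) :
    (rho A k ⊗ₘ rho A' l) ≫ (mooreIncl A k ⊗ₘ mooreIncl A' l) ≫ tensorMap A A' p.sMu p.sNu ≫ φ =
      tensorMap A A' p.sMu p.sNu ≫ φ := by
  rw [← Category.assoc, tensorHom_comp_tensorHom, MonoidalCategory.tensorHom_def, Category.assoc,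
    whiskerLeft_rho_comp, whiskerRight_rho_comp]
  -- Some step `i` is collapsed by `p.sMu ≫ f` but not by `p.sMu`. Hence `i ∈ ν`, so `p.sNu`
  -- collapses it too, and the term is degenerate.
  · intro k' f j hj
    obtain ⟨i, h1, h2⟩ := exists_step_collapse p.sMu p.sMu_surjective f j hj
    rw [← tensorHom_id, ← A'.map_id, ← Category.assoc]
    refine (congrArg (· ≫ φ) (map_tensorMap A A' p.sMu p.sNu f (𝟙 _))).trans ?_
    refine h.tensorMap_comp _ _ i h1 ?_
    rw [Category.comp_id]
    exact (p.sNu_collapse_iff i).2 (not_not.1 fun h3 => h2 ((p.sMu_collapse_iff i).2 h3))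
  · intro l' f j hj
    obtain ⟨i, h1, h2⟩ := exists_step_collapse p.sNu p.sNu_surjective f j hj
    rw [← id_tensorHom, ← A.map_id, ← Category.assoc]
    refine (congrArg (· ≫ φ) (map_tensorMap A A' p.sMu p.sNu (𝟙 _) f)).trans ?_
    refine h.tensorMap_comp _ _ i ?_ h1
    rw [Category.comp_id]
    exact (p.sMu_collapse_iff i).2 fun h3 => h2 ((p.sNu_collapse_iff i).2 h3)

/-! #### Faces of shuffles -/

lemma δ_comp_ne_of_strict {m k : ℕ} (f : ⦋m + 1⦌ ⟶ ⦋k⦌) (i : Fin (m + 2))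
    (h1 : ∀ x : Fin (m + 2), x < i → (f x : Fin (k + 1)) < f i)
    (h2 : ∀ x : Fin (m + 2), i < x → (f i : Fin (k + 1)) < f x) (x : Fin (m + 1)) :
    ((SimplexCategory.δ i ≫ f) x : Fin (k + 1)) ≠ f i := by
  change (f (i.succAbove x) : Fin (k + 1)) ≠ f i
  rcases lt_or_gt_of_ne (Fin.succAbove_ne i x) with h | h
  · exact (h1 _ h).ne
  · exact (h2 _ h).ne'

lemma lt_of_step {m k : ℕ} (f : ⦋m + 1⦌ ⟶ ⦋k⦌) (j : Fin (m + 1))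
    (h : (f j.castSucc : Fin (k + 1)) ≠ f j.succ) :
    (∀ x : Fin (m + 2), x < j.succ → (f x : Fin (k + 1)) < f j.succ) ∧
      ∀ x : Fin (m + 2), j.castSucc < x → (f j.castSucc : Fin (k + 1)) < f x := by
  have h1 : (f j.castSucc : Fin (k + 1)) < f j.succ :=
    lt_of_le_of_ne (hom_mono f (Fin.castSucc_le_succ j)) h
  exact ⟨fun x hx => (hom_mono f (Fin.le_castSucc_iff.2 hx)).trans_lt h1,
    fun x hx => h1.trans_le (hom_mono f (Fin.castSucc_lt_iff_succ_le.1 hx))⟩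

/-- If `f` climbs both before and after the vertex `j + 1`, its value there is attained nowhere else
and is nonzero. The face omits this value, so it vanishes on the Moore complex. -/
lemma mooreIncl_δ_comp_eq_zero {m k : ℕ} (f : ⦋m + 1⦌ ⟶ ⦋k⦌) (j : Fin m)
    (h1 : (f j.castSucc.castSucc : Fin (k + 1)) ≠ f j.castSucc.succ)
    (h2 : (f j.succ.castSucc : Fin (k + 1)) ≠ f j.succ.succ) :
    mooreIncl A k ≫ A.map (SimplexCategory.δ j.succ.castSucc ≫ f).op = 0 := by
  have h3 := (lt_of_step f _ h1).1
  rw [Fin.succ_castSucc] at h3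
  refine mooreIncl_map_eq_zero A _ (f j.succ.castSucc) ?_
    (δ_comp_ne_of_strict f _ h3 (lt_of_step f _ h2).2)
  exact ((Fin.zero_le _).trans_lt (h3 0 (by simp [Fin.lt_def]))).ne'

lemma mooreIncl_δ_last_comp_eq_zero {m k : ℕ} (f : ⦋m + 1⦌ ⟶ ⦋k⦌)
    (h : (f (Fin.last m).castSucc : Fin (k + 1)) ≠ f (Fin.last m).succ) :
    mooreIncl A k ≫ A.map (SimplexCategory.δ (Fin.last (m + 1)) ≫ f).op = 0 := by
  have h3 := (lt_of_step f _ h).1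
  rw [Fin.succ_last] at h3
  refine mooreIncl_map_eq_zero A _ (f (Fin.last (m + 1))) ?_
    (δ_comp_ne_of_strict f _ h3 fun x hx => absurd hx (not_lt.2 (Fin.le_last x)))
  exact ((Fin.zero_le _).trans_lt (h3 0 (by simp [Fin.lt_def]))).ne'

/-- The face `d_i` of the shuffle `p`, restricted to the Moore complexes. -/
def shuffleFace {m l k : ℕ} (p : Shuffle (m + 1) l k) (i : Fin (m + 2)) :
    (moore A).X k ⊗ (moore A').X l ⟶ (A ⊗ A') _⦋m⦌ :=
  (mooreIncl A k ⊗ₘ mooreIncl A' l) ≫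
    tensorMap A A' (SimplexCategory.δ i ≫ p.sMu) (SimplexCategory.δ i ≫ p.sNu)

lemma shuffleFace_eq {m l k : ℕ} (p : Shuffle (m + 1) l k) (i : Fin (m + 2)) :
    shuffleFace A A' p i = (mooreIncl A k ≫ A.map (SimplexCategory.δ i ≫ p.sMu).op) ⊗ₘ
      (mooreIncl A' l ≫ A'.map (SimplexCategory.δ i ≫ p.sNu).op) :=
  tensorHom_comp_tensorHom _ _ _ _

/-- The last step advances one coordinate, whose final value is then attained only at the last
vertex. The corresponding tensor factor vanishes. -/
lemma shuffleFace_last {m l k : ℕ} (p : Shuffle (m + 1) l k) :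
    shuffleFace A A' p (Fin.last (m + 1)) = 0 := by
  rw [shuffleFace_eq]
  by_cases h : Fin.last m ∈ p.nu
  · rw [mooreIncl_δ_last_comp_eq_zero A _ fun h' => (p.sMu_collapse_iff _).1 h' h]
    exact ModuleCat.hom_ext (TensorProduct.ext' fun x y => TensorProduct.zero_tmul _ _)
  · rw [mooreIncl_δ_last_comp_eq_zero A' _ fun h' => h ((p.sNu_collapse_iff _).1 h')]
    exact ModuleCat.hom_ext (TensorProduct.ext' fun x y => TensorProduct.tmul_zero _ _)

lemma shuffleFace_eq_zero {m l k : ℕ} (p : Shuffle (m + 1) l k) (j : Fin m)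
    (h : j.castSucc ∈ p.nu ↔ j.succ ∈ p.nu) : shuffleFace A A' p j.succ.castSucc = 0 := by
  rw [shuffleFace_eq]
  by_cases h0 : j.castSucc ∈ p.nu
  · rw [mooreIncl_δ_comp_eq_zero A p.sMu j (fun h' => (p.sMu_collapse_iff _).1 h' h0)
      fun h' => (p.sMu_collapse_iff _).1 h' (h.1 h0)]
    exact ModuleCat.hom_ext (TensorProduct.ext' fun x y => TensorProduct.zero_tmul _ _)
  · rw [mooreIncl_δ_comp_eq_zero A' p.sNu j (fun h' => h0 ((p.sNu_collapse_iff _).1 h'))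
      fun h' => h0 (h.2 ((p.sNu_collapse_iff _).1 h'))]
    exact ModuleCat.hom_ext (TensorProduct.ext' fun x y => TensorProduct.tmul_zero _ _)

lemma shuffleFace_swap {m l k : ℕ} (p : Shuffle (m + 1) l k) (j : Fin m) :
    shuffleFace A A' (p.swap j) j.succ.castSucc = shuffleFace A A' p j.succ.castSucc := by
  rw [shuffleFace, p.δ_comp_swap_sMu, p.δ_comp_swap_sNu, shuffleFace]

/-- At an interior vertex, either the path goes straight and the face is zero, or it turns. In the
second case, exchanging the two steps gives a shuffle with the same face and the opposite sign, and
the two terms cancel. -/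
lemma sum_shuffleFace_eq_zero {m : ℕ} (l k : ℕ) (i : Fin (m + 2)) (hi : i ≠ 0) :
    ∑ p : Shuffle (m + 1) l k, p.sgn • shuffleFace A A' p i = 0 := by
  obtain ⟨j, rfl⟩ := Fin.exists_succ_eq.2 hi
  induction j using Fin.lastCases with
  | last =>
    rw [Fin.succ_last]
    exact Finset.sum_eq_zero fun p _ => by rw [shuffleFace_last, smul_zero]
  | cast j =>
    rw [Fin.succ_castSucc]
    refine Finset.sum_involution (fun p _ => p.swap j) (fun p _ => ?_) (fun p _ hp => ?_)
      (fun _ _ => Finset.mem_univ _) fun p _ => p.swap_swap j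
    · by_cases h : j.castSucc ∈ p.nu ↔ j.succ ∈ p.nu
      · rw [shuffleFace_swap, shuffleFace_eq_zero A A' p j h, smul_zero, smul_zero, add_zero]
      · rw [shuffleFace_swap, p.sgn_swap j h, neg_smul, add_neg_cancel]
    -- A shuffle fixed by the exchange has both positions in the same part, so its path is straight
    -- there and its term is zero.
    · intro h
      have h1 : j.castSucc ∈ p.nu ↔ j.succ ∈ p.nu := by
        conv_lhs => rw [← h]
        exact p.castSucc_mem_swap_nu j
      exact hp (by rw [shuffleFace_eq_zero A A' p j h1, smul_zero])

lemma mooreIncl_tensorMap_rho_d {m l k : ℕ} (p : Shuffle (m + 1) l k) :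
    (mooreIncl A k ⊗ₘ mooreIncl A' l) ≫ tensorMap A A' p.sMu p.sNu ≫ rho (A ⊗ A') (m + 1) ≫
      (moore (A ⊗ A')).d (m + 1) m =
      ∑ i : Fin (m + 2), (-1 : ℤ) ^ (i : ℕ) • shuffleFace A A' p i ≫ rho (A ⊗ A') m := by
  rw [rho_d, Preadditive.sum_comp, Preadditive.comp_sum, Preadditive.comp_sum]
  refine Finset.sum_congr rfl fun i _ => ?_
  have := tensorMap_map A A' p.sMu p.sNu (SimplexCategory.δ i)
  rw [Preadditive.zsmul_comp, Preadditive.comp_zsmul, Preadditive.comp_zsmul, shuffleFace, ← this]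
  simp only [Category.assoc]
  rfl

/-- All faces other than `d_0` cancel in the sum over shuffles. -/
lemma mooreIncl_eilenbergZilber_rho_d (m k l : ℕ) :
    (mooreIncl A k ⊗ₘ mooreIncl A' l) ≫ eilenbergZilber A A' k l (m + 1) ≫
      rho (A ⊗ A') (m + 1) ≫ (moore (A ⊗ A')).d (m + 1) m =
      ∑ p : Shuffle (m + 1) l k, p.sgn • shuffleFace A A' p 0 ≫ rho (A ⊗ A') m := by
  rw [eilenbergZilber_eq, Preadditive.sum_comp, Preadditive.comp_sum]
  simp only [Preadditive.zsmul_comp, Preadditive.comp_zsmul, mooreIncl_tensorMap_rho_d,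
    Finset.smul_sum]
  rw [Finset.sum_comm, Finset.sum_eq_single 0]
  · simp
  · intro i _ hi
    simp only [smul_comm _ ((-1 : ℤ) ^ (i : ℕ))]
    rw [← Finset.smul_sum]
    have := congrArg (· ≫ rho (A ⊗ A') m) (sum_shuffleFace_eq_zero A A' l k i hi)
    simp only [Preadditive.sum_comp, Preadditive.zsmul_comp, Limits.zero_comp] at this
    rw [this, smul_zero]
  · exact fun h => absurd (Finset.mem_univ _) h

end

end PathHomology

namespace PathHomology

noncomputable section

open HomologicalComplex

variable {K : Type u} [CommRing K]

/-! ### The differential of a tensor product of chain complexes -/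

section TensorComplex

variable (C D : ChainComplex (ModuleCat.{u} K) ℕ)

/-- The part of the differential that comes from the first factor. -/
def tensorD₁ (i j m : ℕ) : C.X i ⊗ D.X j ⟶ (C ⊗ D).X m :=
  mapBifunctor.d₁ C D (curriedTensor _) (ComplexShape.down ℕ) i j m

/-- The part of the differential that comes from the second factor. -/
def tensorD₂ (i j m : ℕ) : C.X i ⊗ D.X j ⟶ (C ⊗ D).X m :=
  mapBifunctor.d₂ C D (curriedTensor _) (ComplexShape.down ℕ) i j m

lemma ιTensorObj_d (i j n m : ℕ) (h : i + j = n) :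
    ιTensorObj C D i j n h ≫ (C ⊗ D).d n m = tensorD₁ C D i j m + tensorD₂ C D i j m := by
  refine (congrArg (_ ≫ ·) (mapBifunctor.d_eq C D (curriedTensor _) _ n m)).trans ?_
  rw [Preadditive.comp_add]
  exact congrArg₂ (· + ·) (mapBifunctor.ι_D₁ ..) (mapBifunctor.ι_D₂ ..)

lemma tensorD₁_zero (j m : ℕ) : tensorD₁ C D 0 j m = 0 :=
  mapBifunctor.d₁_eq_zero _ _ _ _ _ _ _ (by simp)

lemma tensorD₂_zero (i m : ℕ) : tensorD₂ C D i 0 m = 0 :=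
  mapBifunctor.d₂_eq_zero _ _ _ _ _ _ _ (by simp)

lemma tensorD₁_succ (i j m : ℕ) (h : i + j = m) :
    tensorD₁ C D (i + 1) j m = (C.d (i + 1) i ▷ D.X j) ≫ ιTensorObj C D i j m h := by
  refine (mapBifunctor.d₁_eq C D (curriedTensor _) (ComplexShape.down ℕ)
    (show (ComplexShape.down ℕ).Rel (i + 1) i from rfl) j m h).trans ?_
  exact one_smul _ _

lemma tensorD₂_succ (i j m : ℕ) (h : i + j = m) :
    tensorD₂ C D i (j + 1) m =
      (-1 : ℤ) ^ i • ((C.X i ◁ D.d (j + 1) j) ≫ ιTensorObj C D i j m h) := by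
  refine (mapBifunctor.d₂_eq C D (curriedTensor _) (ComplexShape.down ℕ) i
    (show (ComplexShape.down ℕ).Rel (j + 1) j from rfl) m h).trans ?_
  rw [Units.smul_def]
  congr 1

end TensorComplex

/-! ### The normalized maps -/

section Normalized

variable (A A' : SimplicialObject (ModuleCat.{u} K))

lemma ι_normalizedEZ (k l n : ℕ) (h : k + l = n) :
    ιTensorObj (moore A) (moore A') k l n h ≫ normalizedEZ A A' n =
      (mooreIncl A k ⊗ₘ mooreIncl A' l) ≫ eilenbergZilber A A' k l n ≫ rho (A ⊗ A') n :=
  ι_mapBifunctorDesc ..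

lemma mooreIncl_δ_zero (k : ℕ) :
    mooreIncl A (k + 1) ≫ A.map (SimplexCategory.δ 0).op =
      (moore A).d (k + 1) k ≫ mooreIncl A k := by
  refine Eq.trans ?_ ((inclusionOfMooreComplexMap A).comm (k + 1) k)
  have h : mooreIncl A (k + 1) ≫ ((alternatingFaceMapComplex (ModuleCat.{u} K)).obj A).d (k + 1) k =
      mooreIncl A (k + 1) ≫ ∑ i : Fin (k + 2), (-1 : ℤ) ^ (i : ℕ) • A.δ i :=
    congrArg (_ ≫ ·) (AlternatingFaceMapComplex.obj_d_eq A k)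
  refine Eq.trans ?_ h.symm
  rw [Preadditive.comp_sum, Fin.sum_univ_succ, Finset.sum_eq_zero, add_zero]
  · simp only [Fin.val_zero, pow_zero, one_smul]
    rfl
  · intro i _
    rw [Preadditive.comp_zsmul]
    have h0 : mooreIncl A (k + 1) ≫ A.δ i.succ = 0 :=
      DoldKan.HigherFacesVanish.inclusionOfMooreComplexMap k i (by lia)
    rw [h0, smul_zero]

lemma d_mooreIncl_tensorMap {m : ℕ} (k l : ℕ) (f : ⦋m⦌ ⟶ ⦋k⦌) (g : ⦋m⦌ ⟶ ⦋l⦌) :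
    ((moore A).d (k + 1) k ≫ mooreIncl A k ≫ A.map f.op) ⊗ₘ (mooreIncl A' l ≫ A'.map g.op) =
      ((moore A).d (k + 1) k ▷ (moore A').X l) ≫ (mooreIncl A k ⊗ₘ mooreIncl A' l) ≫
        tensorMap A A' f g := by
  refine Eq.trans ?_ (congrArg (_ ≫ ·) (tensorHom_comp_tensorHom _ _ _ _)).symm
  rw [← tensorHom_id, tensorHom_comp_tensorHom, Category.id_comp]

lemma d_mooreIncl_tensorMap' {m : ℕ} (k l : ℕ) (f : ⦋m⦌ ⟶ ⦋k⦌) (g : ⦋m⦌ ⟶ ⦋l⦌) :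
    (mooreIncl A k ≫ A.map f.op) ⊗ₘ ((moore A').d (l + 1) l ≫ mooreIncl A' l ≫ A'.map g.op) =
      ((moore A).X k ◁ (moore A').d (l + 1) l) ≫ (mooreIncl A k ⊗ₘ mooreIncl A' l) ≫
        tensorMap A A' f g := by
  refine Eq.trans ?_ (congrArg (_ ≫ ·) (tensorHom_comp_tensorHom _ _ _ _)).symm
  rw [← id_tensorHom, tensorHom_comp_tensorHom, Category.id_comp]

/-- Removing a first step in `ν` leaves a shorter shuffle and applies `d_0`, the Moore differential,
to the first factor alone. These terms make up ε(da ⊗ a'). -/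
lemma sum_shuffleFace_zero_mem (m k l : ℕ) (h : k + l = m + 1) :
    ∑ p : Shuffle (m + 1) l k with (0 : Fin (m + 1)) ∈ p.nu,
      p.sgn • shuffleFace A A' p 0 ≫ rho (A ⊗ A') m =
      tensorD₁ (moore A) (moore A') k l m ≫ normalizedEZ A A' m := by
  cases k with
  | zero =>
    rw [tensorD₁_zero, Limits.zero_comp]
    refine Finset.sum_eq_zero fun p hp => ?_
    have hc : p.nu.card = 0 := p.2.2.2
    simp [Finset.card_eq_zero.1 hc] at hp
  | succ k =>
    rw [Shuffle.sum_filter_zero_mem (l := l) fun p => p.sgn • shuffleFace A A' p 0 ≫ rho (A ⊗ A') m,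
      tensorD₁_succ _ _ k l m (by omega), Category.assoc, ι_normalizedEZ, eilenbergZilber_eq,
      Preadditive.sum_comp, Preadditive.comp_sum, Preadditive.comp_sum]
    refine Finset.sum_congr rfl fun p _ => ?_
    rw [p.sgn_consNu, shuffleFace_eq, p.δ_zero_comp_consNu_sMu, p.δ_zero_comp_consNu_sNu,
      Preadditive.zsmul_comp, Preadditive.comp_zsmul, Preadditive.comp_zsmul, op_comp, A.map_comp,
      reassoc_of% (mooreIncl_δ_zero A k)]
    refine congrArg (p.sgn • ·) ((congrArg (· ≫ rho (A ⊗ A') m)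
      (d_mooreIncl_tensorMap A A' k l p.sMu p.sNu)).trans ?_)
    simp only [Category.assoc]

/-- A first step in `μ` applies `d_0` to the second factor alone, and `sgn_consMu` supplies the sign
of (-1)^k ε(a ⊗ da'). -/
lemma sum_shuffleFace_zero_notMem (m k l : ℕ) (h : k + l = m + 1) :
    ∑ p : Shuffle (m + 1) l k with (0 : Fin (m + 1)) ∉ p.nu,
      p.sgn • shuffleFace A A' p 0 ≫ rho (A ⊗ A') m =
      tensorD₂ (moore A) (moore A') k l m ≫ normalizedEZ A A' m := by
  cases l with
  | zero =>
    rw [tensorD₂_zero, Limits.zero_comp]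
    refine Finset.sum_eq_zero fun p hp => ?_
    have hc : p.mu.card = 0 := p.2.2.1
    simp [← p.mem_mu_iff, Finset.card_eq_zero.1 hc] at hp
  | succ l =>
    rw [Shuffle.sum_filter_zero_notMem (k := k)
        fun p => p.sgn • shuffleFace A A' p 0 ≫ rho (A ⊗ A') m,
      tensorD₂_succ _ _ k l m (by omega), Preadditive.zsmul_comp, Category.assoc, ι_normalizedEZ,
      eilenbergZilber_eq, Preadditive.sum_comp, Preadditive.comp_sum, Preadditive.comp_sum,
      Finset.smul_sum]
    refine Finset.sum_congr rfl fun p _ => ?_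
    rw [p.sgn_consMu, shuffleFace_eq, p.δ_zero_comp_consMu_sMu, p.δ_zero_comp_consMu_sNu,
      Preadditive.zsmul_comp, Preadditive.comp_zsmul, Preadditive.comp_zsmul, op_comp, A'.map_comp,
      reassoc_of% (mooreIncl_δ_zero A' l), mul_smul]
    refine congrArg (_ • p.sgn • ·) ((congrArg (· ≫ rho (A ⊗ A') m)
      (d_mooreIncl_tensorMap' A A' k l p.sMu p.sNu)).trans ?_)
    simp only [Category.assoc]

/-- The normalized Eilenberg–Zilber map is a morphism of chain complexes. -/
lemma normalizedEZ_d (n m : ℕ) : normalizedEZ A A' n ≫ (moore (A ⊗ A')).d n m =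
    (moore A ⊗ moore A').d n m ≫ normalizedEZ A A' m := by
  by_cases hnm : (ComplexShape.down ℕ).Rel n m
  · obtain rfl : m + 1 = n := hnm
    refine mapBifunctor.hom_ext fun k l h => ?_
    have h1 := reassoc_of% (ι_normalizedEZ A A' k l (m + 1) h)
    have h2 := reassoc_of% (ιTensorObj_d (moore A) (moore A') k l (m + 1) m h)
    refine (h1 _).trans (Eq.trans ?_ (h2 _).symm)
    rw [mooreIncl_eilenbergZilber_rho_d, Preadditive.add_comp,
      ← sum_shuffleFace_zero_mem A A' m k l h, ← sum_shuffleFace_zero_notMem A A' m k l h]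
    exact (Finset.sum_filter_add_sum_filter_not _ _ _).symm
  · rw [(moore (A ⊗ A')).shape _ _ hnm, (moore A ⊗ moore A').shape _ _ hnm, Limits.comp_zero,
      Limits.zero_comp]

/-- The Alexander–Whitney map followed by the normalizations. -/
def awBar (k l n : ℕ) (h : k + l = n) : (A ⊗ A') _⦋n⦌ ⟶ (moore A).X k ⊗ (moore A').X l :=
  alexanderWhitney A A' k l n h ≫ (rho A k ⊗ₘ rho A' l)

lemma tensorMap_awBar {k l n k' l' : ℕ} (h : k + l = n) (f : ⦋n⦌ ⟶ ⦋k'⦌) (g : ⦋n⦌ ⟶ ⦋l'⦌) :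
    tensorMap A A' f g ≫ awBar A A' k l n h =
      (A.map (SimplexCategory.subinterval 0 k (by omega) ≫ f).op ≫ rho A k) ⊗ₘ
        (A'.map (SimplexCategory.subinterval k l h.le ≫ g).op ≫ rho A' l) := by
  rw [op_comp, op_comp, A.map_comp, A'.map_comp, ← tensorHom_comp_tensorHom,
    ← tensorHom_comp_tensorHom]
  exact (Category.assoc _ _ _).symm

lemma subinterval_comp_collapse {n r : ℕ} (f : ⦋n⦌ ⟶ ⦋r⦌) (k l : ℕ) (h : k + l ≤ n) (j : Fin n)
    (hf : (f j.castSucc : Fin (r + 1)) = f j.succ) (i : Fin l) (hi : (i : ℕ) + k = j) :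
    ((SimplexCategory.subinterval k l h ≫ f) i.castSucc : Fin (r + 1)) =
      (SimplexCategory.subinterval k l h ≫ f) i.succ := by
  have h1 : (SimplexCategory.subinterval k l h i.castSucc : Fin (n + 1)) = j.castSucc :=
    Fin.ext hi
  have h2 : (SimplexCategory.subinterval k l h i.succ : Fin (n + 1)) = j.succ :=
    Fin.ext (show (i : ℕ) + 1 + k = j + 1 by omega)
  change (f (SimplexCategory.subinterval k l h i.castSucc : Fin (n + 1)) : Fin (r + 1)) =
    f (SimplexCategory.subinterval k l h i.succ : Fin (n + 1))
  rw [h1, h2, hf]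

/-- A collapsed step lies in the front interval `0, …, k` or in the back interval `k, …, n`.
Accordingly, one of the two factors is degenerate and is killed by `rho`. -/
lemma killsDegenerate_awBar (k l n : ℕ) (h : k + l = n) :
    KillsDegenerate (A ⊗ A') (awBar A A' k l n h) := by
  intro k' f j hj
  refine (tensorMap_awBar A A' h f f).trans ?_
  by_cases hjk : (j : ℕ) < k
  · rw [killsDegenerate_rho A k k' _ ⟨j, hjk⟩
      (subinterval_comp_collapse f 0 k _ j hj ⟨j, hjk⟩ rfl)]
    exact ModuleCat.hom_ext (TensorProduct.ext' fun x y => TensorProduct.zero_tmul _ _)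
  · rw [killsDegenerate_rho A' l k' _ ⟨j - k, by omega⟩
      (subinterval_comp_collapse f k l h.le j hj _ (Nat.sub_add_cancel (not_lt.1 hjk)))]
    exact ModuleCat.hom_ext (TensorProduct.ext' fun x y => TensorProduct.tmul_zero _ _)

/-- If `i < k` is not in `ν`, the front face of `sMu` collapses the step `i`; if `i ≥ k` is in `ν`,
the back face of `sNu` does. So only the path that first makes all its steps in `ν` survives. -/
lemma tensorMap_awBar_eq_zero {k l n k' l' : ℕ} (h : k + l = n) (p : Shuffle n l' k')
    (hp : ∃ i : Fin n, ¬ (i ∈ p.nu ↔ (i : ℕ) < k)) :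
    tensorMap A A' p.sMu p.sNu ≫ awBar A A' k l n h = 0 := by
  obtain ⟨i, hi⟩ := hp
  rw [tensorMap_awBar]
  by_cases hik : (i : ℕ) < k
  · have hi' : i ∉ p.nu := fun h' => hi ⟨fun _ => hik, fun _ => h'⟩
    rw [killsDegenerate_rho A k k' _ ⟨i, hik⟩
      (subinterval_comp_collapse p.sMu 0 k _ i ((p.sMu_collapse_iff i).2 hi') ⟨i, hik⟩ rfl)]
    exact ModuleCat.hom_ext (TensorProduct.ext' fun x y => TensorProduct.zero_tmul _ _)
  · have hi' : i ∈ p.nu := by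
      by_contra h'
      exact hi ⟨fun h'' => absurd h'' h', fun h'' => absurd h'' hik⟩
    rw [killsDegenerate_rho A' l l' _ ⟨i - k, by omega⟩
      (subinterval_comp_collapse p.sNu k l h.le i ((p.sNu_collapse_iff i).2 hi') _
        (Nat.sub_add_cancel (not_lt.1 hik)))]
    exact ModuleCat.hom_ext (TensorProduct.ext' fun x y => TensorProduct.tmul_zero _ _)

lemma Shuffle.base_sMu {k l n : ℕ} (h : k + l = n) (x : Fin (n + 1)) :
    (((Shuffle.base h).sMu x : Fin (k + 1)) : ℕ) = min (x : ℕ) k := by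
  induction x using Fin.induction with
  | zero => rw [Shuffle.sMu_zero]; simp
  | succ i ih =>
    rw [Shuffle.sMu_succ, ih, Fin.val_succ, Fin.val_castSucc]
    simp only [Shuffle.mem_base_nu]
    split_ifs <;> omega

lemma tensorMap_base_awBar {k l n : ℕ} (h : k + l = n) :
    tensorMap A A' (Shuffle.base h).sMu (Shuffle.base h).sNu ≫ awBar A A' k l n h =
      rho A k ⊗ₘ rho A' l := by
  have h1 : SimplexCategory.subinterval 0 k (by omega) ≫ (Shuffle.base h).sMu = 𝟙 ⦋k⦌ := by
    refine simplex_hom_ext fun x => ?_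
    refine (Shuffle.base_sMu h _).trans ?_
    change min ((x : ℕ) + 0) k = x
    omega
  have h2 : SimplexCategory.subinterval k l h.le ≫ (Shuffle.base h).sNu = 𝟙 ⦋l⦌ := by
    refine simplex_hom_ext fun x => ?_
    have h3 := (Shuffle.base h).sMu_add_sNu (SimplexCategory.subinterval k l h.le x)
    rw [Shuffle.base_sMu] at h3
    change min ((x : ℕ) + k) k + _ = (x : ℕ) + k at h3
    rw [min_eq_right (by omega), add_comm] at h3
    exact Nat.add_right_cancel h3
  have h3 : A.map (𝟙 ⦋k⦌).op ≫ rho A k = rho A k :=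
    (congrArg (· ≫ rho A k) (A.map_id _)).trans (Category.id_comp _)
  have h4 : A'.map (𝟙 ⦋l⦌).op ≫ rho A' l = rho A' l :=
    (congrArg (· ≫ rho A' l) (A'.map_id _)).trans (Category.id_comp _)
  rw [tensorMap_awBar, h1, h2, h3, h4]

lemma eilenbergZilber_awBar_eq_zero {k l k' l' n : ℕ} (h : k + l = n)
    (hk : k' ≠ k) : eilenbergZilber A A' k' l' n ≫ awBar A A' k l n h = 0 := by
  rw [eilenbergZilber_eq, Preadditive.sum_comp]
  refine Finset.sum_eq_zero fun p _ => ?_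
  rw [Preadditive.zsmul_comp, tensorMap_awBar_eq_zero, smul_zero]
  by_contra! hp
  refine hk ?_
  have h1 : p.nu = (Shuffle.base h).nu := Finset.ext fun i => by rw [hp, Shuffle.mem_base_nu]
  exact p.2.2.2.symm.trans ((congrArg Finset.card h1).trans (Shuffle.base h).2.2.2)

lemma eilenbergZilber_awBar {k l n : ℕ} (h : k + l = n) :
    eilenbergZilber A A' k l n ≫ awBar A A' k l n h = rho A k ⊗ₘ rho A' l := by
  rw [eilenbergZilber_eq, Preadditive.sum_comp, Finset.sum_eq_single (Shuffle.base h)]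
  · rw [Preadditive.zsmul_comp, Shuffle.sgn_base, one_smul, tensorMap_base_awBar]
  · intro p _ hp
    rw [Preadditive.zsmul_comp, tensorMap_awBar_eq_zero, smul_zero]
    by_contra! hp'
    exact hp (Shuffle.ext_nu fun i => by rw [hp', Shuffle.mem_base_nu])
  · exact fun h' => absurd (Finset.mem_univ _) h'

lemma rho_normalizedAW (n : ℕ) : rho (A ⊗ A') n ≫ normalizedAW A A' n =
    ∑ q : Finset.HasAntidiagonal.antidiagonal n,
      awBar A A' q.1.1 q.1.2 n (Finset.HasAntidiagonal.mem_antidiagonal.1 q.2) ≫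
        ιTensorObj (moore A) (moore A') q.1.1 q.1.2 n
          (Finset.HasAntidiagonal.mem_antidiagonal.1 q.2) := by
  rw [normalizedAW, Preadditive.comp_sum]
  refine Finset.sum_congr rfl fun q _ => ?_
  have := (killsDegenerate_awBar A A' q.1.1 q.1.2 n
    (Finset.HasAntidiagonal.mem_antidiagonal.1 q.2)).rho_comp
  conv_rhs => rw [← this]
  simp only [awBar, Category.assoc]

/-- The normalized Alexander–Whitney map is a left inverse of the Eilenberg–Zilber map. -/
lemma normalizedEZ_normalizedAW (n : ℕ) : normalizedEZ A A' n ≫ normalizedAW A A' n = 𝟙 _ := by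
  refine mapBifunctor.hom_ext fun k l h => ?_
  have h1 := reassoc_of% (ι_normalizedEZ A A' k l n h)
  refine (h1 _).trans (Eq.trans ?_ (Category.comp_id _).symm)
  rw [rho_normalizedAW, Preadditive.comp_sum, Preadditive.comp_sum,
    Finset.sum_eq_single ⟨(k, l), Finset.HasAntidiagonal.mem_antidiagonal.2 h⟩]
  · rw [← Category.assoc (eilenbergZilber A A' k l n), eilenbergZilber_awBar, ← Category.assoc,
      tensorHom_comp_tensorHom, mooreIncl_rho, mooreIncl_rho, id_tensorHom_id, Category.id_comp]
  · rintro ⟨⟨k', l'⟩, hq⟩ _ hne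
    have hq' : k' + l' = n := Finset.HasAntidiagonal.mem_antidiagonal.1 hq
    rw [← Category.assoc (eilenbergZilber A A' k l n), eilenbergZilber_awBar_eq_zero A A' hq',
      Limits.zero_comp, Limits.comp_zero]
    have h' : k + l = n := h
    rintro rfl
    exact hne (Subtype.ext (Prod.ext rfl (by simp only; omega)))
  · exact fun h' => absurd (Finset.mem_univ _) h'

end Normalized

end

end PathHomology

namespace PathHomology

noncomputable section

variable {K : Type u} [CommRing K] (A A' : SimplicialObject (ModuleCat.{u} K))

/-! ### Detecting shuffles by their faces -/

lemma zero_tensorHom' {X Y X' Y' : ModuleCat.{u} K} (f : X' ⟶ Y') :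
    ((0 : X ⟶ Y) ⊗ₘ f) = 0 :=
  ModuleCat.hom_ext (TensorProduct.ext' fun _ _ => TensorProduct.zero_tmul _ _)

lemma tensorHom_zero' {X Y X' Y' : ModuleCat.{u} K} (f : X ⟶ Y) :
    (f ⊗ₘ (0 : X' ⟶ Y')) = 0 :=
  ModuleCat.hom_ext (TensorProduct.ext' fun _ _ => TensorProduct.tmul_zero _ _)

/-- For a shuffle `p` with `j ∈ μ` and `j + 1 ∈ ν`, there is a morphism that detects the face
`d_{j+1}` of `p`, and vanishes on all faces of shuffles other than this one, on degenerate elements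
and on shuffles. -/
lemma exists_detector {m k l : ℕ} (p : Shuffle (m + 1) l k) (j : Fin m)
    (h0 : j.castSucc ∉ p.nu) (h1 : j.succ ∈ p.nu) :
    ∃ D : (A ⊗ A') _⦋m⦌ ⟶ (moore A).X k ⊗ (moore A').X l,
      KillsDegenerate (A ⊗ A') D ∧
      (∀ (k' l' : ℕ) (p' : Shuffle m l' k'), tensorMap A A' p'.sMu p'.sNu ≫ D = 0) ∧
      (∀ (k' l' : ℕ) (p' : Shuffle (m + 1) l' k') (i : Fin (m + 2)), k' ≠ k →
        shuffleFace A A' p' i ≫ D = 0) ∧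
      ∀ (p' : Shuffle (m + 1) l k) (i : Fin (m + 2)), shuffleFace A A' p' i ≫ D =
        if i = j.succ.castSucc ∧ (p' = p ∨ p' = p.swap j) then 𝟙 _ else 0 := by
  -- The maps `θ` and `θ'` are the coordinates of the path of `p` without its corner `j + 1`; at its
  -- step `j` both advance. The detector is the tensor product of the coefficients of `s_θ` and
  -- `s_θ'`.
  let θ : ⦋m⦌ ⟶ ⦋k⦌ := SimplexCategory.δ j.succ.castSucc ≫ p.sMu
  let θ' : ⦋m⦌ ⟶ ⦋l⦌ := SimplexCategory.δ j.succ.castSucc ≫ p.sNu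
  have hθ := p.δ_comp_sMu_surjective j h0
  have hθ' := p.δ_comp_sNu_surjective j h1
  have : Epi θ := SimplexCategory.epi_iff_surjective.2 hθ
  have : Epi θ' := SimplexCategory.epi_iff_surjective.2 hθ'
  have hsum : ∀ x : Fin (m + 1), ((θ x : Fin (k + 1)) : ℕ) + (θ' x : Fin (l + 1)) =
      j.succ.castSucc.succAbove x := fun x => p.sMu_add_sNu _
  have hstrict : ∀ a : Fin m, (θ a.castSucc : Fin (k + 1)) = θ a.succ →
      (θ' a.castSucc : Fin (l + 1)) ≠ θ' a.succ := by
    intro a ha ha'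
    have h2 := hsum a.castSucc
    rw [ha, ha', hsum] at h2
    exact a.castSucc_lt_succ.ne' (Fin.succAbove_right_injective (Fin.ext h2))
  have hj : (j.succ.castSucc.succAbove j.castSucc : Fin (m + 2)) = j.castSucc.castSucc :=
    Fin.succAbove_of_castSucc_lt _ _ (by simp [Fin.lt_def])
  have hj' : (j.succ.castSucc.succAbove j.succ : Fin (m + 2)) = j.succ.succ :=
    Fin.succAbove_of_le_castSucc _ _ le_rfl
  have hθj : (θ j.castSucc : Fin (k + 1)) ≠ θ j.succ := by
    change (p.sMu (j.succ.castSucc.succAbove j.castSucc) : Fin (k + 1)) ≠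
      p.sMu (j.succ.castSucc.succAbove j.succ)
    rw [hj, hj']
    have h2 := p.sMu_succ j.succ
    have h3 := p.sMu_succ j.castSucc
    rw [if_pos h1, ← Fin.succ_castSucc] at h2
    rw [if_neg h0] at h3
    intro h4
    rw [← h4] at h2
    omega
  have hθj' : (θ' j.castSucc : Fin (l + 1)) ≠ θ' j.succ := by
    change (p.sNu (j.succ.castSucc.succAbove j.castSucc) : Fin (l + 1)) ≠
      p.sNu (j.succ.castSucc.succAbove j.succ)
    rw [hj, hj']
    have h2 := p.sNu_succ j.succ
    have h3 := p.sNu_succ j.castSucc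
    rw [if_pos h1, ← Fin.succ_castSucc] at h2
    rw [if_neg h0] at h3
    intro h4
    rw [← h4] at h2
    omega
  obtain ⟨c, hc, hc1⟩ := exists_coefficient A θ
  obtain ⟨c', hc', hc1'⟩ := exists_coefficient A' θ'
  have htensor : ∀ {k' l' : ℕ} (f : ⦋m⦌ ⟶ ⦋k'⦌) (g : ⦋m⦌ ⟶ ⦋l'⦌),
      tensorMap A A' f g ≫ (c ⊗ₘ c') = (A.map f.op ≫ c) ⊗ₘ (A'.map g.op ≫ c') := fun f g =>
    tensorHom_comp_tensorHom _ _ _ _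
  have hface : ∀ {k' l' : ℕ} (p' : Shuffle (m + 1) l' k') (i : Fin (m + 2)),
      shuffleFace A A' p' i ≫ (c ⊗ₘ c') =
        (mooreIncl A k' ≫ A.map (SimplexCategory.δ i ≫ p'.sMu).op ≫ c) ⊗ₘ
          (mooreIncl A' l' ≫ A'.map (SimplexCategory.δ i ≫ p'.sNu).op ≫ c') := fun p' i => by
    refine (Category.assoc _ _ _).trans ((congrArg (_ ≫ ·) (htensor _ _)).trans ?_)
    exact tensorHom_comp_tensorHom _ _ _ _
  -- A face that is not killed is strict wherever `θ` and `θ'` are. Then `k ≤ k'` and `l ≤ l'`, and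
  -- as `k + l = k' + l'` both are equalities; so both coordinates agree with `θ` and `θ'`.
  have hcases : ∀ {k' l' : ℕ} (p' : Shuffle (m + 1) l' k') (i : Fin (m + 2)),
      shuffleFace A A' p' i ≫ (c ⊗ₘ c') = 0 ∨
      (∀ a : Fin m, ((SimplexCategory.δ i ≫ p'.sMu) a.castSucc : Fin (k' + 1)) =
        (SimplexCategory.δ i ≫ p'.sMu) a.succ → (θ a.castSucc : Fin (k + 1)) = θ a.succ) ∧
      (∀ a : Fin m, ((SimplexCategory.δ i ≫ p'.sNu) a.castSucc : Fin (l' + 1)) =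
        (SimplexCategory.δ i ≫ p'.sNu) a.succ → (θ' a.castSucc : Fin (l + 1)) = θ' a.succ) := by
    intro k' l' p' i
    by_cases hA : ∀ a : Fin m, ((SimplexCategory.δ i ≫ p'.sMu) a.castSucc : Fin (k' + 1)) =
        (SimplexCategory.δ i ≫ p'.sMu) a.succ → (θ a.castSucc : Fin (k + 1)) = θ a.succ
    · by_cases hB : ∀ a : Fin m, ((SimplexCategory.δ i ≫ p'.sNu) a.castSucc : Fin (l' + 1)) =
          (SimplexCategory.δ i ≫ p'.sNu) a.succ → (θ' a.castSucc : Fin (l + 1)) = θ' a.succ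
      · exact Or.inr ⟨hA, hB⟩
      · push Not at hB
        obtain ⟨a, ha, ha'⟩ := hB
        left
        rw [hface, hc' _ _ a ha ha', Limits.comp_zero, tensorHom_zero']
    · push Not at hA
      obtain ⟨a, ha, ha'⟩ := hA
      left
      rw [hface, hc _ _ a ha ha', Limits.comp_zero, zero_tensorHom']
  refine ⟨c ⊗ₘ c', fun k' f a ha => ?_, fun k' l' p' => ?_, fun k' l' p' i hk => ?_,
    fun p' i => ?_⟩
  -- The coordinate sum of the path `(θ, θ')` increases at every step, so the step that `f`
  -- collapses is not collapsed by both `θ` and `θ'`.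
  · refine (htensor f f).trans ?_
    by_cases h2 : (θ a.castSucc : Fin (k + 1)) = θ a.succ
    · rw [hc' _ _ a ha (hstrict a h2), tensorHom_zero']
      rfl
    · rw [hc _ _ a ha h2, zero_tensorHom']
      rfl
  -- A genuine shuffle advances only one coordinate at step `j`, whereas both `θ` and `θ'` advance
  -- there.
  · rw [htensor]
    by_cases h2 : j ∈ p'.nu
    · rw [hc' _ _ j ((p'.sNu_collapse_iff j).2 h2) hθj', tensorHom_zero']
    · rw [hc _ _ j ((p'.sMu_collapse_iff j).2 h2) hθj, zero_tensorHom']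
  · rcases hcases p' i with h2 | ⟨h2, h3⟩
    · exact h2
    · have h4 := (le_and_eq_of_strict θ _ hθ h2).1
      have h5 := (le_and_eq_of_strict θ' _ hθ' h3).1
      have h6 := p.add_eq
      have h7 := p'.add_eq
      omega
  · split_ifs with h2
    · obtain ⟨rfl, h2⟩ := h2
      have h3 : shuffleFace A A' p' j.succ.castSucc = shuffleFace A A' p j.succ.castSucc := by
        rcases h2 with rfl | rfl
        · rfl
        · rw [shuffleFace_swap]
      rw [h3, hface]
      exact (congrArg₂ (· ⊗ₘ ·) hc1 hc1').trans (id_tensorHom_id _ _)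
    · rcases hcases p' i with h3 | ⟨h3, h4⟩
      · exact h3
      · refine absurd (p.eq_or_eq_swap j p' i (simplex_hom_ext ?_) (simplex_hom_ext ?_) ?_) h2
        · exact (le_and_eq_of_strict θ _ hθ h3).2 rfl
        · exact (le_and_eq_of_strict θ' _ hθ' h4).2 rfl
        · exact fun h => h0 (h.2 h1)

end

end PathHomology

namespace PathHomology

noncomputable section

open HomologicalComplex

variable {K : Type u} [CommRing K]

/-! ### The components of a tensor product of chain complexes -/

section Components

variable (C D : ChainComplex (ModuleCat.{u} K) ℕ)

/-- The projection of a tensor product of chain complexes to a component, as a morphism. -/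
def tensorProj (i j n : ℕ) : (C ⊗ D).X n ⟶ C.X i ⊗ D.X j :=
  mapBifunctorDesc fun k l _ =>
    if h : k = i ∧ l = j then
      eqToHom (X := C.X k ⊗ D.X l) (Y := C.X i ⊗ D.X j) (by rw [h.1, h.2]) else 0

lemma ι_tensorProj (i j n : ℕ) (h : i + j = n) :
    ιTensorObj C D i j n h ≫ tensorProj C D i j n = 𝟙 _ := by
  refine (ι_mapBifunctorDesc ..).trans ?_
  rw [dif_pos ⟨rfl, rfl⟩]
  rfl

lemma ι_tensorProj_of_ne (i j k l n : ℕ) (h : k + l = n) (hne : ¬ (k = i ∧ l = j)) :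
    ιTensorObj C D k l n h ≫ tensorProj C D i j n = 0 := by
  refine (ι_mapBifunctorDesc ..).trans ?_
  rw [dif_neg hne]

lemma tensorD₁_tensorProj (i j k l m : ℕ) (h : k + l = m + 1) (hij : i + j = m) :
    tensorD₁ C D k l m ≫ tensorProj C D i j m =
      ιTensorObj C D k l (m + 1) h ≫ tensorProj C D (i + 1) j (m + 1) ≫ C.d (i + 1) i ▷ D.X j := by
  cases k with
  | zero =>
    rw [tensorD₁_zero, Limits.zero_comp, ← Category.assoc, ι_tensorProj_of_ne, Limits.zero_comp]
    omega
  | succ k =>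
    rw [tensorD₁_succ C D k l m (by omega), Category.assoc]
    by_cases hk : k = i
    · obtain rfl := hk
      obtain rfl : l = j := by omega
      rw [ι_tensorProj, Category.comp_id, ← Category.assoc, ι_tensorProj, Category.id_comp]
    · rw [ι_tensorProj_of_ne _ _ _ _ _ _ _ _ (by omega), Limits.comp_zero, ← Category.assoc,
        ι_tensorProj_of_ne _ _ _ _ _ _ _ _ (by omega), Limits.zero_comp]

lemma tensorD₂_tensorProj (i j k l m : ℕ) (h : k + l = m + 1) (hij : i + j = m) :
    tensorD₂ C D k l m ≫ tensorProj C D i j m =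
      ιTensorObj C D k l (m + 1) h ≫
        ((-1 : ℤ) ^ i • tensorProj C D i (j + 1) (m + 1) ≫ C.X i ◁ D.d (j + 1) j) := by
  cases l with
  | zero =>
    rw [tensorD₂_zero, Limits.zero_comp, Preadditive.comp_zsmul, ← Category.assoc,
      ι_tensorProj_of_ne _ _ _ _ _ _ _ _ (by omega), Limits.zero_comp, smul_zero]
  | succ l =>
    rw [tensorD₂_succ C D k l m (by omega), Preadditive.comp_zsmul, Preadditive.zsmul_comp,
      Category.assoc]
    by_cases hk : k = i
    · obtain rfl := hk
      obtain rfl : l = j := by omega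
      rw [ι_tensorProj, Category.comp_id, ← Category.assoc, ι_tensorProj, Category.id_comp]
    · rw [ι_tensorProj_of_ne _ _ _ _ _ _ _ _ (by omega), Limits.comp_zero, ← Category.assoc,
        ι_tensorProj_of_ne _ _ _ _ _ _ _ _ (by omega), Limits.zero_comp, smul_zero, smul_zero]

lemma d_tensorProj (i j m : ℕ) (hij : i + j = m) :
    (C ⊗ D).d (m + 1) m ≫ tensorProj C D i j m =
      tensorProj C D (i + 1) j (m + 1) ≫ C.d (i + 1) i ▷ D.X j +
        (-1 : ℤ) ^ i • tensorProj C D i (j + 1) (m + 1) ≫ C.X i ◁ D.d (j + 1) j := by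
  refine mapBifunctor.hom_ext fun k l h => ?_
  have h1 := reassoc_of% (ιTensorObj_d C D k l (m + 1) m h)
  refine (h1 _).trans ?_
  rw [Preadditive.add_comp, tensorD₁_tensorProj C D i j k l m h hij,
    tensorD₂_tensorProj C D i j k l m h hij]
  exact (Preadditive.comp_add ..).symm

lemma sum_tensorProj_ι (n : ℕ) :
    ∑ q : Finset.HasAntidiagonal.antidiagonal n, tensorProj C D q.1.1 q.1.2 n ≫
      ιTensorObj C D q.1.1 q.1.2 n (Finset.HasAntidiagonal.mem_antidiagonal.1 q.2) = 𝟙 _ := by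
  refine mapBifunctor.hom_ext fun k l h => ?_
  refine Eq.trans ?_ (Category.comp_id _).symm
  refine (Preadditive.comp_sum ..).trans ?_
  rw [Finset.sum_eq_single ⟨(k, l), Finset.HasAntidiagonal.mem_antidiagonal.2 h⟩]
  · exact (reassoc_of% (ι_tensorProj C D k l n h)) _
  · rintro ⟨⟨k', l'⟩, hq⟩ _ hne
    refine ((reassoc_of% (ι_tensorProj_of_ne C D k' l' k l n h ?_)) _).trans Limits.zero_comp
    rintro ⟨rfl, rfl⟩
    exact hne rfl
  · exact fun h' => absurd (Finset.mem_univ _) h'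

/-- The inclusion of a component into a tensor product of chain complexes, as a linear map. -/
def tensorInc (i j n : ℕ) (h : i + j = n) :
    TensorProduct K (C.X i) (D.X j) →ₗ[K] (C ⊗ D).X n :=
  (ιTensorObj C D i j n h).hom

/-- The component of an element of a tensor product of chain complexes. -/
def tensorComp (i j n : ℕ) : (C ⊗ D).X n →ₗ[K] TensorProduct K (C.X i) (D.X j) :=
  (tensorProj C D i j n).hom

variable {C D}

lemma tensorComp_tensorInc {i j n : ℕ} (h : i + j = n) (t : TensorProduct K (C.X i) (D.X j)) :
    tensorComp C D i j n (tensorInc C D i j n h t) = t :=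
  ConcreteCategory.congr_hom (ι_tensorProj C D i j n h) t

lemma tensorComp_tensorInc_of_ne {i j k l n : ℕ} (h : k + l = n) (hne : ¬ (k = i ∧ l = j))
    (t : TensorProduct K (C.X k) (D.X l)) :
    tensorComp C D i j n (tensorInc C D k l n h t) = 0 :=
  ConcreteCategory.congr_hom (ι_tensorProj_of_ne C D i j k l n h hne) t

lemma sum_tensorInc_tensorComp {n : ℕ} (z : (C ⊗ D).X n) :
    ∑ q : Finset.HasAntidiagonal.antidiagonal n, tensorInc C D q.1.1 q.1.2 n
      (Finset.HasAntidiagonal.mem_antidiagonal.1 q.2) (tensorComp C D q.1.1 q.1.2 n z) = z := by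
  have h := ConcreteCategory.congr_hom (sum_tensorProj_ι C D n) z
  refine Eq.trans ?_ h
  exact ((LinearMap.congr_fun (ModuleCat.hom_sum
    (fun q : Finset.HasAntidiagonal.antidiagonal n => tensorProj C D q.1.1 q.1.2 n ≫
      ιTensorObj C D q.1.1 q.1.2 n (Finset.HasAntidiagonal.mem_antidiagonal.1 q.2))
    Finset.univ) z).trans (LinearMap.sum_apply ..)).symm

lemma tensorComp_ext {n : ℕ} {z z' : (C ⊗ D).X n}
    (h : ∀ i j, i + j = n → tensorComp C D i j n z = tensorComp C D i j n z') : z = z' := by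
  rw [← sum_tensorInc_tensorComp z, ← sum_tensorInc_tensorComp z']
  refine Finset.sum_congr rfl fun q _ => ?_
  rw [h _ _ (Finset.HasAntidiagonal.mem_antidiagonal.1 q.2)]

lemma tensorComp_d {i j m : ℕ} (h : i + j = m) (z : (C ⊗ D).X (m + 1)) :
    tensorComp C D i j m (((C ⊗ D).d (m + 1) m).hom z) =
      (C.d (i + 1) i).hom.rTensor _ (tensorComp C D (i + 1) j (m + 1) z) +
        (-1 : ℤ) ^ i • (D.d (j + 1) j).hom.lTensor _ (tensorComp C D i (j + 1) (m + 1) z) :=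
  ConcreteCategory.congr_hom (d_tensorProj C D i j m h) z

variable {C' D' : ChainComplex (ModuleCat.{u} K) ℕ}

lemma tensorHom_f_tensorProj (f : C ⟶ C') (g : D ⟶ D') (i j n : ℕ) :
    (f ⊗ₘ g).f n ≫ tensorProj C' D' i j n = tensorProj C D i j n ≫ (f.f i ⊗ₘ g.f j) := by
  refine mapBifunctor.hom_ext fun k l h => ?_
  have h1 : ιTensorObj C D k l n h ≫ (f ⊗ₘ g).f n =
      (f.f k ⊗ₘ g.f l) ≫ ιTensorObj C' D' k l n h := by
    refine (ι_mapBifunctorMap ..).trans ?_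
    refine Eq.trans ?_ (congrArg (· ≫ _) (MonoidalCategory.tensorHom_def _ _).symm)
    exact (Category.assoc _ _ _).symm
  refine ((reassoc_of% h1) _).trans ?_
  by_cases hk : k = i ∧ l = j
  · obtain ⟨rfl, rfl⟩ := hk
    rw [ι_tensorProj, Category.comp_id]
    exact ((reassoc_of% (ι_tensorProj C D k l n h)) _).symm
  · rw [ι_tensorProj_of_ne _ _ _ _ _ _ _ _ hk, Limits.comp_zero]
    exact (((reassoc_of% (ι_tensorProj_of_ne C D i j k l n h hk)) _).trans Limits.zero_comp).symm

lemma tensorComp_tensorHom (f : C ⟶ C') (g : D ⟶ D') (i j n : ℕ) (z : (C ⊗ D).X n) :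
    tensorComp C' D' i j n (((f ⊗ₘ g).f n).hom z) =
      TensorProduct.map (f.f i).hom (g.f j).hom (tensorComp C D i j n z) :=
  ConcreteCategory.congr_hom (tensorHom_f_tensorProj f g i j n) z

lemma tensorHom_tensorInc (f : C ⟶ C') (g : D ⟶ D') {i j n : ℕ} (h : i + j = n)
    (t : TensorProduct K (C.X i) (D.X j)) :
    ((f ⊗ₘ g).f n).hom (tensorInc C D i j n h t) =
      tensorInc C' D' i j n h (TensorProduct.map (f.f i).hom (g.f j).hom t) := by
  refine tensorComp_ext fun k l hkl => ?_
  rw [tensorComp_tensorHom]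
  by_cases hk : i = k ∧ j = l
  · obtain ⟨rfl, rfl⟩ := hk
    rw [tensorComp_tensorInc, tensorComp_tensorInc]
  · rw [tensorComp_tensorInc_of_ne h hk, tensorComp_tensorInc_of_ne h hk, map_zero]

end Components

/-! ### Largest subcomplexes of tensor products -/

section OmegaTensor

lemma projective_quotient_of_isComplemented {M : Type*} [AddCommGroup M] [Module K M]
    [Module.Projective K M] {W : Submodule K M} (h : IsComplemented W) :
    Module.Projective K (M ⧸ W) := by
  obtain ⟨r, hr⟩ := exists_retraction_of_isComplemented h
  refine Module.Projective.of_split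
    (W.liftQ (LinearMap.id - W.subtype ∘ₗ r) fun x hx => ?_) W.mkQ ?_
  · have h1 : r x = ⟨x, hx⟩ := LinearMap.congr_fun hr ⟨x, hx⟩
    simp [h1]
  · ext x
    simp

variable (C D : ChainComplex (ModuleCat.{u} K) ℕ) (B : ∀ n, Submodule K (C.X n))
  (B' : ∀ n, Submodule K (D.X n))

/-- For `n = 0` the truncated `n - 1` is `0`. The differential `d 0 0` is zero, so the second
condition is void, as it should be. -/
lemma omegaSub_eq (n : ℕ) :
    omegaSub C B n = B n ⊓ (B (n - 1)).comap (C.d n (n - 1)).hom := by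
  refine le_antisymm (inf_le_inf_left _ (iInf_le _ _)) (inf_le_inf_left _ (le_iInf fun m => ?_))
  by_cases hm : m + 1 = n
  · obtain rfl : m = n - 1 := by omega
    exact le_rfl
  · intro x _
    rw [Submodule.mem_comap, C.shape n m hm]
    exact (B m).zero_mem

variable {C D B B'}

/-- The submodule is the kernel of C_n → C_n/B_n × C_{n-1}/B_{n-1}. The target is projective because
the `B n` are direct summands. Over a principal ideal domain the range is then projective, and the
kernel splits off. -/
lemma exists_retraction_omegaSub [IsDomain K] [IsPrincipalIdealRing K]
    [∀ n, Module.Projective K (C.X n)] (hB : ∀ n, IsComplemented (B n)) (n : ℕ) :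
    ∃ r : C.X n →ₗ[K] omegaSub C B n, r ∘ₗ (omegaSub C B n).subtype = LinearMap.id := by
  let f : C.X n →ₗ[K] (C.X n ⧸ B n) × (C.X (n - 1) ⧸ B (n - 1)) :=
    (B n).mkQ.prod ((B (n - 1)).mkQ ∘ₗ (C.d n (n - 1)).hom)
  have hf : LinearMap.ker f = omegaSub C B n := by
    rw [omegaSub_eq, LinearMap.ker_prod, LinearMap.ker_comp, Submodule.ker_mkQ, Submodule.ker_mkQ]
  have := projective_quotient_of_isComplemented (hB n)
  have := projective_quotient_of_isComplemented (hB (n - 1))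
  have : Module.Projective K (LinearMap.range f) :=
    projective_of_injective (LinearMap.range f).subtype Subtype.val_injective
  rw [← hf]
  obtain ⟨r, s, -, h⟩ := exists_retraction_of_projective_range f
  refine ⟨r, LinearMap.ext fun x => Subtype.ext ?_⟩
  have h1 := LinearMap.congr_fun h x.1
  have h2 : f.rangeRestrict x.1 = 0 := Subtype.ext x.2
  simpa [h2] using h1

/-- Each component of dy combines d ⊗ 1 of one component of `y` with 1 ⊗ d of a neighbouring one.
Tested only for membership in B ⊗ D, it isolates the first summand, and tested in C ⊗ B' the second.
Flatness turns this into membership in ω(C, B) ⊗ D and C ⊗ ω(D, B'), and the two are intersected by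
a retraction. -/
lemma tensorComp_mem_range_mapIncl_omegaSub [IsDomain K] [IsPrincipalIdealRing K]
    [∀ n, Module.Projective K (C.X n)] [∀ n, Module.Projective K (D.X n)]
    (hB : ∀ n, IsComplemented (B n)) {n : ℕ} (y : (C ⊗ D).X n)
    (hy : ∀ i j, i + j = n →
      tensorComp C D i j n y ∈ LinearMap.range (TensorProduct.mapIncl (B i) (B' j)))
    (hdy : ∀ i j m, i + j = m → m + 1 = n →
      tensorComp C D i j m (((C ⊗ D).d n m).hom y) ∈
        LinearMap.range (TensorProduct.mapIncl (B i) (B' j)))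
    (i j : ℕ) (h : i + j = n) :
    tensorComp C D i j n y ∈
      LinearMap.range (TensorProduct.mapIncl (omegaSub C B i) (omegaSub D B' j)) := by
  obtain ⟨r, hr⟩ := exists_retraction_omegaSub hB i
  refine tensor_range_inf r hr ?_ ?_
  · rw [omegaSub_eq]
    refine mem_range_rTensor_inf_comap _ _ _ (mapIncl_range_le_rTensor _ _ (hy i j h)) ?_
    cases i with
    | zero =>
      rw [C.shape 0 (0 - 1) (by simp)]
      refine ⟨0, ?_⟩
      rw [map_zero, ModuleCat.hom_zero, LinearMap.rTensor_zero, LinearMap.zero_apply]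
    | succ i =>
      obtain ⟨m, rfl⟩ : ∃ m, n = m + 1 := ⟨i + j, by omega⟩
      have h1 := mapIncl_range_le_rTensor _ _ (hdy i j m (by omega) rfl)
      rw [tensorComp_d (by omega)] at h1
      refine (Submodule.add_mem_iff_left _ ?_).1 h1
      refine Submodule.smul_of_tower_mem _ _ ?_
      -- The neighbouring component comes from `B i ⊗ D`, and 1 ⊗ d does not affect its first
      -- factor.
      obtain ⟨t, ht⟩ := mapIncl_range_le_rTensor _ _ (hy i (j + 1) (by omega))
      rw [← ht]
      refine ⟨(D.d (j + 1) j).hom.lTensor _ t, ?_⟩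
      rw [← LinearMap.comp_apply, ← LinearMap.comp_apply, LinearMap.rTensor_comp_lTensor,
        LinearMap.lTensor_comp_rTensor]
      rfl
  · rw [omegaSub_eq]
    refine mem_range_lTensor_inf_comap _ _ _ (mapIncl_range_le_lTensor _ _ (hy i j h)) ?_
    cases j with
    | zero =>
      rw [D.shape 0 (0 - 1) (by simp)]
      refine ⟨0, ?_⟩
      rw [map_zero, ModuleCat.hom_zero, LinearMap.lTensor_zero, LinearMap.zero_apply]
    | succ j =>
      obtain ⟨m, rfl⟩ : ∃ m, n = m + 1 := ⟨i + j, by omega⟩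
      have h1 := mapIncl_range_le_lTensor _ _ (hdy i j m (by omega) rfl)
      rw [tensorComp_d (by omega)] at h1
      have h2 := (Submodule.add_mem_iff_right _ (?_)).1 h1
      · have h3 := Submodule.smul_of_tower_mem _ ((-1 : ℤ) ^ i) h2
        rwa [smul_smul, ← mul_pow, neg_one_mul, neg_neg, one_pow, one_smul] at h3
      obtain ⟨t, ht⟩ := mapIncl_range_le_lTensor _ _ (hy (i + 1) j (by omega))
      rw [← ht]
      refine ⟨(C.d (i + 1) i).hom.rTensor _ t, ?_⟩
      rw [← LinearMap.comp_apply, ← LinearMap.comp_apply, LinearMap.rTensor_comp_lTensor,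
        LinearMap.lTensor_comp_rTensor]

lemma omegaIncl_tensorHom_injective [IsDomain K] [IsPrincipalIdealRing K]
    [∀ n, Module.Projective K (C.X n)] [∀ n, Module.Projective K (D.X n)]
    (hB : ∀ n, IsComplemented (B n)) (hB' : ∀ n, IsComplemented (B' n)) (n : ℕ) :
    Function.Injective ((omegaIncl C B ⊗ₘ omegaIncl D B').f n).hom := by
  intro y y' h
  refine tensorComp_ext fun i j hij => ?_
  obtain ⟨r, hr⟩ := exists_retraction_omegaSub hB i
  obtain ⟨r', hr'⟩ := exists_retraction_omegaSub hB' j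
  refine mapIncl_injective hr hr' ?_
  have h1 := congrArg (tensorComp C D i j n) h
  rw [tensorComp_tensorHom, tensorComp_tensorHom] at h1
  exact h1

lemma mem_range_omegaIncl_tensorHom {n : ℕ} (y : (C ⊗ D).X n)
    (h : ∀ i j, i + j = n → tensorComp C D i j n y ∈
      LinearMap.range (TensorProduct.mapIncl (omegaSub C B i) (omegaSub D B' j))) :
    ∃ y', ((omegaIncl C B ⊗ₘ omegaIncl D B').f n).hom y' = y := by
  choose t ht using h
  refine ⟨∑ q : Finset.HasAntidiagonal.antidiagonal n,
    tensorInc (omega C B) (omega D B') q.1.1 q.1.2 n (Finset.HasAntidiagonal.mem_antidiagonal.1 q.2)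
      (t _ _ (Finset.HasAntidiagonal.mem_antidiagonal.1 q.2)), ?_⟩
  rw [map_sum, ← sum_tensorInc_tensorComp y]
  refine Finset.sum_congr rfl fun q _ => ?_
  exact (tensorHom_tensorInc (omegaIncl C B) (omegaIncl D B') _ _).trans (congrArg _ (ht _ _ _))

end OmegaTensor

end

end PathHomology

namespace PathHomology

noncomputable section

open HomologicalComplex

/-! ### Box products in terms of shuffles -/

lemma map_range_mapIncl {K : Type*} [CommRing K] {M N M' N' : Type*} [AddCommGroup M]
    [AddCommGroup N] [AddCommGroup M'] [AddCommGroup N'] [Module K M] [Module K N] [Module K M']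
    [Module K N'] (f : M →ₗ[K] M') (g : N →ₗ[K] N') (W : Submodule K M) (W' : Submodule K N) :
    (LinearMap.range (TensorProduct.mapIncl W W')).map (TensorProduct.map f g) =
      LinearMap.range (TensorProduct.mapIncl (W.map f) (W'.map g)) := by
  rw [TensorProduct.range_mapIncl, TensorProduct.range_mapIncl, Submodule.map_map₂]
  refine le_antisymm (Submodule.map₂_le.2 fun m hm n hn => ?_) (Submodule.map₂_le.2 ?_)
  · exact Submodule.apply_mem_map₂ _ (Submodule.mem_map_of_mem hm) (Submodule.mem_map_of_mem hn)
  · rintro _ ⟨m, hm, rfl⟩ _ ⟨n, hn, rfl⟩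
    exact Submodule.apply_mem_map₂ ((TensorProduct.mk K M N).compr₂ (TensorProduct.map f g)) hm hn

variable {K : Type u} [CommRing K]

section Shuffles

variable (A A' : SimplicialObject (ModuleCat.{u} K))

/-- The term of the normalized Eilenberg–Zilber map that belongs to the shuffle `p`. -/
def shuffleMap {n l k : ℕ} (p : Shuffle n l k) :
    (moore A).X k ⊗ (moore A').X l ⟶ (moore (A ⊗ A')).X n :=
  (mooreIncl A k ⊗ₘ mooreIncl A' l) ≫ tensorMap A A' p.sMu p.sNu ≫ rho (A ⊗ A') n

lemma rho_shuffleMap {n l k : ℕ} (p : Shuffle n l k) :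
    (rho A k ⊗ₘ rho A' l) ≫ shuffleMap A A' p =
      tensorMap A A' p.sMu p.sNu ≫ rho (A ⊗ A') n :=
  KillsDegenerate.rho_tensorMap A A' (killsDegenerate_rho (A ⊗ A') n) p

lemma ι_normalizedEZ_eq_sum (k l n : ℕ) (h : k + l = n) :
    ιTensorObj (moore A) (moore A') k l n h ≫ normalizedEZ A A' n =
      ∑ p : Shuffle n l k, p.sgn • shuffleMap A A' p := by
  rw [ι_normalizedEZ, eilenbergZilber_eq, Preadditive.sum_comp, Preadditive.comp_sum]
  refine Finset.sum_congr rfl fun p _ => ?_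
  rw [Preadditive.zsmul_comp, Preadditive.comp_zsmul, shuffleMap]

lemma normalizedEZ_tensorInc {k l n : ℕ} (h : k + l = n)
    (t : TensorProduct K ((moore A).X k) ((moore A').X l)) :
    (normalizedEZ A A' n).hom (tensorInc (moore A) (moore A') k l n h t) =
      ∑ p : Shuffle n l k, p.sgn • (shuffleMap A A' p).hom t := by
  refine (ConcreteCategory.congr_hom (ι_normalizedEZ_eq_sum A A' k l n h) t).trans ?_
  refine (LinearMap.congr_fun (ModuleCat.hom_sum (fun p : Shuffle n l k =>
    p.sgn • shuffleMap A A' p) Finset.univ) t).trans (LinearMap.sum_apply ..)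

lemma normalizedAW_normalizedEZ_apply {n : ℕ} (y : (moore A ⊗ moore A').X n) :
    (normalizedAW A A' n).hom ((normalizedEZ A A' n).hom y) = y :=
  ConcreteCategory.congr_hom (normalizedEZ_normalizedAW A A' n) y

lemma normalizedEZ_d_apply {n : ℕ} (m : ℕ) (y : (moore A ⊗ moore A').X n) :
    ((moore (A ⊗ A')).d n m).hom ((normalizedEZ A A' n).hom y) =
      (normalizedEZ A A' m).hom (((moore A ⊗ moore A').d n m).hom y) :=
  ConcreteCategory.congr_hom (normalizedEZ_d A A' n m) y

lemma rho_normalizedAW_tensorProj (k l n : ℕ) (h : k + l = n) :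
    rho (A ⊗ A') n ≫ normalizedAW A A' n ≫ tensorProj (moore A) (moore A') k l n =
      awBar A A' k l n h := by
  rw [← Category.assoc, rho_normalizedAW, Preadditive.sum_comp,
    Finset.sum_eq_single ⟨(k, l), Finset.HasAntidiagonal.mem_antidiagonal.2 h⟩]
  · rw [Category.assoc, ι_tensorProj, Category.comp_id]
  · rintro ⟨⟨k', l'⟩, hq⟩ _ hne
    rw [Category.assoc, ι_tensorProj_of_ne, Limits.comp_zero]
    rintro ⟨rfl, rfl⟩
    exact hne rfl
  · exact fun h' => absurd (Finset.mem_univ _) h'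

lemma conn_subinterval {n : ℕ} (k l : ℕ) (h : k + l ≤ n) :
    Conn (SimplexCategory.subinterval k l h) := by
  intro y h0 h1
  have h0' : (0 : ℕ) + k ≤ y := h0
  have h1' : (y : ℕ) ≤ l + k := h1
  exact ⟨⟨y - k, by omega⟩, Fin.ext (show (y : ℕ) - k + k = y by omega)⟩

end Shuffles

namespace PathPair

variable (P P' : PathPair K)

lemma boxSub_eq (n : ℕ) : boxSub P P' n = ⨆ (k : ℕ) (l : ℕ) (p : Shuffle n l k),
    (LinearMap.range (TensorProduct.mapIncl (P.B k) (P'.B l))).map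
      (tensorMap P.A P'.A p.sMu p.sNu).hom := by
  refine iSup_congr fun k => iSup_congr fun l => iSup_congr fun p => ?_
  exact (map_range_mapIncl _ _ _ _).symm

/-- The normalization of the path submodule of the box product. -/
def barBox (n : ℕ) : Submodule K ((moore (P.A ⊗ P'.A)).X n) := (P.box P').barB n

/-- Modulo degenerate elements, a shuffle of two elements depends only on their normalizations. The
generators of B ◇ B' may therefore be normalized factor by factor. -/
lemma barBox_eq (n : ℕ) : barBox P P' n = ⨆ (k : ℕ) (l : ℕ) (p : Shuffle n l k),
    (LinearMap.range (TensorProduct.mapIncl (P.barB k) (P'.barB l))).map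
      (shuffleMap P.A P'.A p).hom := by
  refine (congrArg (Submodule.map (rho (P.A ⊗ P'.A) n).hom) (boxSub_eq P P' n)).trans ?_
  rw [Submodule.map_iSup]
  refine iSup_congr fun k => ?_
  rw [Submodule.map_iSup]
  refine iSup_congr fun l => ?_
  rw [Submodule.map_iSup]
  refine iSup_congr fun p => ?_
  rw [barB, barB, ← map_range_mapIncl, ← Submodule.map_comp]
  refine Eq.trans ?_ (Submodule.map_comp _ _ _)
  exact congrArg (fun f => Submodule.map (ModuleCat.Hom.hom f)
    (LinearMap.range (TensorProduct.mapIncl (P.B k) (P'.B l)))) (rho_shuffleMap P.A P'.A p).symm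

lemma shuffleMap_mem_barBox {n l k : ℕ} (p : Shuffle n l k)
    {t : TensorProduct K ((moore P.A).X k) ((moore P'.A).X l)}
    (ht : t ∈ LinearMap.range (TensorProduct.mapIncl (P.barB k) (P'.barB l))) :
    (shuffleMap P.A P'.A p).hom t ∈ barBox P P' n := by
  rw [barBox_eq]
  exact Submodule.mem_iSup_of_mem k (Submodule.mem_iSup_of_mem l
    (Submodule.mem_iSup_of_mem p (Submodule.mem_map_of_mem ht)))

lemma normalizedEZ_mem_barBox {n : ℕ} (y : (moore P.A ⊗ moore P'.A).X n)
    (hy : ∀ i j, i + j = n → tensorComp (moore P.A) (moore P'.A) i j n y ∈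
      LinearMap.range (TensorProduct.mapIncl (P.barB i) (P'.barB j))) :
    (normalizedEZ P.A P'.A n).hom y ∈ barBox P P' n := by
  rw [← sum_tensorInc_tensorComp y, map_sum]
  refine Submodule.sum_mem _ fun q _ => ?_
  rw [normalizedEZ_tensorInc]
  refine Submodule.sum_mem _ fun p _ => zsmul_mem ?_ _
  exact shuffleMap_mem_barBox P P' p (hy _ _ (Finset.HasAntidiagonal.mem_antidiagonal.1 q.2))

/-- On the generators of B ◇ B', the components of α are given by inclusions of subintervals
followed by surjections. These have connected image, and path submodules are closed under all such
operators. -/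
lemma tensorComp_normalizedAW_mem {n : ℕ} {x : (moore (P.A ⊗ P'.A)).X n}
    (hx : x ∈ barBox P P' n) (i j : ℕ) (h : i + j = n) :
    tensorComp (moore P.A) (moore P'.A) i j n ((normalizedAW P.A P'.A n).hom x) ∈
      LinearMap.range (TensorProduct.mapIncl (P.barB i) (P'.barB j)) := by
  obtain ⟨x, hx, rfl⟩ := hx
  have h1 := ConcreteCategory.congr_hom (rho_normalizedAW_tensorProj P.A P'.A i j n h) x
  refine Set.mem_of_eq_of_mem h1 ?_
  suffices h2 : boxSub P P' n ≤ (LinearMap.range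
      (TensorProduct.mapIncl (P.barB i) (P'.barB j))).comap (awBar P.A P'.A i j n h).hom from h2 hx
  rw [boxSub_eq]
  refine iSup_le fun k => iSup_le fun l => iSup_le fun p => ?_
  rw [Submodule.map_le_iff_le_comap, ← Submodule.comap_comp, ← Submodule.map_le_iff_le_comap]
  refine (le_of_eq (congrArg (fun f => Submodule.map (ModuleCat.Hom.hom f)
    (LinearMap.range (TensorProduct.mapIncl (P.B k) (P'.B l))))
      (tensorMap_awBar P.A P'.A h p.sMu p.sNu))).trans ?_
  refine (le_of_eq (map_range_mapIncl _ _ _ _)).trans (TensorProduct.range_mapIncl_mono ?_ ?_)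
  · rintro _ ⟨a, ha, rfl⟩
    exact Submodule.mem_map_of_mem (P.map_mem _ ((conn_subinterval _ _ _).comp p.conn_sMu) a ha)
  · rintro _ ⟨a, ha, rfl⟩
    exact Submodule.mem_map_of_mem (P'.map_mem _ ((conn_subinterval _ _ _).comp p.conn_sNu) a ha)

end PathPair

end

end PathHomology

/-! ### Surjectivity of ε: coefficients of shuffles in Ω(P □ P'). -/

namespace PathHomology

noncomputable section

open HomologicalComplex

lemma exists_sum_of_mem_iSup_map {K : Type*} [CommRing K] {ι : Type*} [Fintype ι] {M : ι → Type*}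
    {N : Type*} [∀ i, AddCommGroup (M i)] [∀ i, Module K (M i)] [AddCommGroup N] [Module K N]
    (f : ∀ i, M i →ₗ[K] N) (W : ∀ i, Submodule K (M i)) {x : N}
    (hx : x ∈ ⨆ i, (W i).map (f i)) : ∃ t : ∀ i, M i, (∀ i, t i ∈ W i) ∧ ∑ i, f i (t i) = x := by
  have h : ⨆ i, (W i).map (f i) = ⨆ i ∈ Finset.univ, (W i).map (f i) := by simp
  rw [h] at hx
  obtain ⟨μ, rfl⟩ := (Submodule.mem_iSup_finset_iff_exists_sum _ _).1 hx
  choose t ht ht' using fun i => (μ i).2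
  exact ⟨t, ht, Finset.sum_congr rfl fun i _ => ht' i⟩

/-- Shuffles exist only for `k + l = n`, so the supremum over all `k` and `l` is a finite one. -/
lemma exists_sum_of_mem_iSup_shuffle {K : Type*} [CommRing K] {n : ℕ} {M : ℕ → ℕ → Type*}
    {N : Type*} [∀ k l, AddCommGroup (M k l)] [∀ k l, Module K (M k l)] [AddCommGroup N]
    [Module K N] (f : ∀ {k l : ℕ}, Shuffle n l k → M k l →ₗ[K] N)
    (W : ∀ k l, Submodule K (M k l)) {x : N}
    (hx : x ∈ ⨆ (k : ℕ) (l : ℕ) (p : Shuffle n l k), (W k l).map (f p)) :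
    ∃ t : ∀ q : Finset.HasAntidiagonal.antidiagonal n, Shuffle n q.1.2 q.1.1 → M q.1.1 q.1.2,
      (∀ q p, t q p ∈ W q.1.1 q.1.2) ∧ ∑ q, ∑ p, f p (t q p) = x := by
  have h : ⨆ (k : ℕ) (l : ℕ) (p : Shuffle n l k), (W k l).map (f p) ≤
      ⨆ s : Σ q : Finset.HasAntidiagonal.antidiagonal n, Shuffle n q.1.2 q.1.1,
        (W s.1.1.1 s.1.1.2).map (f s.2) :=
    iSup_le fun k => iSup_le fun l => iSup_le fun p =>
      le_iSup_of_le ⟨⟨(k, l), Finset.HasAntidiagonal.mem_antidiagonal.2 p.add_eq⟩, p⟩ le_rfl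
  obtain ⟨t, ht, h1⟩ := exists_sum_of_mem_iSup_map
    (ι := Σ q : Finset.HasAntidiagonal.antidiagonal n, Shuffle n q.1.2 q.1.1)
    (M := fun s => M s.1.1.1 s.1.1.2) (fun s => f s.2) (fun s => W s.1.1.1 s.1.1.2) (h hx)
  refine ⟨fun q p => t ⟨q, p⟩, fun q p => ht ⟨q, p⟩, ?_⟩
  rw [← h1, Fintype.sum_sigma]

variable {K : Type u} [CommRing K]

/-! ### Elements of `Ω(P □ P')` -/

namespace PathPair

variable (P P' : PathPair K)

/-- The elements of the path submodule of `N_n(P □ P')` are sums of shuffles. -/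
lemma exists_eq_sum_shuffleMap {n : ℕ} {x : (moore (P.A ⊗ P'.A)).X n}
    (hx : x ∈ barBox P P' n) :
    ∃ t : ∀ q : Finset.HasAntidiagonal.antidiagonal n, Shuffle n q.1.2 q.1.1 →
        TensorProduct K ((moore P.A).X q.1.1) ((moore P'.A).X q.1.2),
      (∀ q p, t q p ∈ LinearMap.range (TensorProduct.mapIncl (P.barB q.1.1) (P'.barB q.1.2))) ∧
        ∑ q, ∑ p, (shuffleMap P.A P'.A p).hom (t q p) = x := by
  rw [barBox_eq] at hx
  exact exists_sum_of_mem_iSup_shuffle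
    (fun {k l} p => (shuffleMap P.A P'.A (k := k) (l := l) p).hom) _ hx

lemma shuffleMap_d {m l k : ℕ} (A A' : SimplicialObject (ModuleCat.{u} K))
    (p : Shuffle (m + 1) l k) : shuffleMap A A' p ≫ (moore (A ⊗ A')).d (m + 1) m =
      ∑ i : Fin (m + 2), (-1 : ℤ) ^ (i : ℕ) • shuffleFace A A' p i ≫ rho (A ⊗ A') m := by
  rw [← mooreIncl_tensorMap_rho_d, shuffleMap, Category.assoc, Category.assoc]

/-- Coefficients of neighbouring shuffles in an element whose boundary lies in the path
submodules are opposite. -/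
lemma add_swap_eq_zero {m : ℕ}
    (t : ∀ q : Finset.HasAntidiagonal.antidiagonal (m + 1), Shuffle (m + 1) q.1.2 q.1.1 →
        TensorProduct K ((moore P.A).X q.1.1) ((moore P'.A).X q.1.2))
    (hd : ((moore (P.A ⊗ P'.A)).d (m + 1) m).hom
      (∑ q, ∑ p, (shuffleMap P.A P'.A p).hom (t q p)) ∈ barBox P P' m)
    (q : Finset.HasAntidiagonal.antidiagonal (m + 1)) (p : Shuffle (m + 1) q.1.2 q.1.1) (j : Fin m)
    (h0 : j.castSucc ∉ p.nu) (h1 : j.succ ∈ p.nu) : t q p + t q (p.swap j) = 0 := by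
  obtain ⟨D, hD, hD0, hD1, hD2⟩ := exists_detector P.A P'.A p j h0 h1
  -- Since `D` kills degenerate elements, it factors as `ψ` through the Moore complex. Then `ψ`
  -- vanishes on `barBox`, hence on the given boundary. Of all faces in that boundary it sees only
  -- the face `d_{j+1}` of `p` and of its exchange, both with sign (-1)^(j+1).
  let ψ := mooreIncl (P.A ⊗ P'.A) m ≫ D
  have hψ : rho (P.A ⊗ P'.A) m ≫ ψ = D := hD.rho_comp
  have hface : ∀ {k' l' : ℕ} (p' : Shuffle (m + 1) l' k'),
      shuffleMap P.A P'.A p' ≫ (moore (P.A ⊗ P'.A)).d (m + 1) m ≫ ψ =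
      ∑ i : Fin (m + 2), (-1 : ℤ) ^ (i : ℕ) • shuffleFace P.A P'.A p' i ≫ D := fun p' => by
    rw [← Category.assoc, shuffleMap_d, Preadditive.sum_comp]
    refine Finset.sum_congr rfl fun i _ => ?_
    rw [Preadditive.zsmul_comp, Category.assoc, hψ]
  have hzero : ∀ x ∈ barBox P P' m, ψ.hom x = 0 := by
    intro x hx
    suffices h : barBox P P' m ≤ LinearMap.ker ψ.hom from h hx
    rw [barBox_eq]
    refine iSup_le fun k => iSup_le fun l => iSup_le fun p' => ?_
    rintro _ ⟨u, -, rfl⟩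
    have h2 : shuffleMap P.A P'.A p' ≫ ψ = 0 := by
      rw [shuffleMap, Category.assoc, Category.assoc, hψ, hD0, Limits.comp_zero]
    exact ConcreteCategory.congr_hom h2 u
  have hsum := hzero _ hd
  simp only [map_sum] at hsum
  have hterm : ∀ {k' l' : ℕ} (p' : Shuffle (m + 1) l' k') (u),
      ψ.hom (((moore (P.A ⊗ P'.A)).d (m + 1) m).hom ((shuffleMap P.A P'.A p').hom u)) =
      (∑ i : Fin (m + 2), (-1 : ℤ) ^ (i : ℕ) • shuffleFace P.A P'.A p' i ≫ D).hom u :=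
    fun p' u => ConcreteCategory.congr_hom (hface p') u
  have hne : p ≠ p.swap j := fun h => by
    have h2 := p.inversions_swap j h0 h1
    rw [← h] at h2
    omega
  have hself : ∀ p' : Shuffle (m + 1) q.1.2 q.1.1,
      ψ.hom (((moore (P.A ⊗ P'.A)).d (m + 1) m).hom ((shuffleMap P.A P'.A p').hom (t q p'))) =
      if p' = p ∨ p' = p.swap j then (-1 : ℤ) ^ (j.succ.castSucc : ℕ) • t q p' else 0 := by
    intro p'
    rw [hterm, Finset.sum_eq_single j.succ.castSucc, hD2]
    · split_ifs with h2 h3 h3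
      · rfl
      · exact absurd h2.2 h3
      · exact absurd ⟨rfl, h3⟩ h2
      · rw [smul_zero]; rfl
    · intro i _ hi
      rw [hD2, if_neg fun h => hi h.1, smul_zero]
    · exact fun h => absurd (Finset.mem_univ _) h
  rw [Finset.sum_eq_single q, Finset.sum_congr rfl fun p' _ => hself p',
    ← Finset.sum_filter, ← Finset.smul_sum] at hsum
  · have h2 : (Finset.univ.filter fun p' => p' = p ∨ p' = p.swap j) = {p, p.swap j} := by
      ext p'; simp
    rw [h2, Finset.sum_pair hne] at hsum
    have h3 := congrArg (((-1 : ℤ) ^ (j.succ.castSucc : ℕ)) • ·) hsum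
    rwa [smul_smul, ← mul_pow, neg_one_mul, neg_neg, one_pow, one_smul, smul_zero] at h3
  · intro q' _ hq'
    refine Finset.sum_eq_zero fun p' _ => ?_
    rw [hterm, Finset.sum_eq_zero]
    · rfl
    · intro i _
      rw [hD1, smul_zero]
      intro h2
      have h3 := Finset.HasAntidiagonal.mem_antidiagonal.1 q.2
      have h4 := Finset.HasAntidiagonal.mem_antidiagonal.1 q'.2
      exact hq' (Subtype.ext (Prod.ext h2 (by omega)))
  · exact fun h => absurd (Finset.mem_univ _) h

/-- Exchanging at a descent lowers the number of inversions by one and reverses both the coefficient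
and the sign. Repeating this leads to the shuffle without inversions. -/
lemma eq_sgn_smul_of_add_swap_eq_zero {M : Type*} [AddCommGroup M] {m l k : ℕ}
    (t : Shuffle (m + 1) l k → M)
    (h : ∀ (p : Shuffle (m + 1) l k) (j : Fin m), j.castSucc ∉ p.nu → j.succ ∈ p.nu →
      t p + t (p.swap j) = 0) (p : Shuffle (m + 1) l k) :
    t p = p.sgn • t (Shuffle.base p.add_eq) := by
  induction hN : p.inversions using Nat.strong_induction_on generalizing p with
  | _ N ih =>
  by_cases hp : p = Shuffle.base p.add_eq
  · have h1 : p.sgn = 1 := (congrArg Shuffle.sgn hp).trans (Shuffle.sgn_base _)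
    rw [h1, one_smul, ← hp]
  · obtain ⟨j, h0, h1⟩ := p.exists_descent hp
    have h2 := p.inversions_swap j h0 h1
    have h3 := ih _ (by omega) (p.swap j) rfl
    rw [p.sgn_swap j fun h4 => h0 (h4.2 h1), neg_smul] at h3
    rw [eq_neg_of_add_eq_zero_left (h p j h0 h1), h3, neg_neg]

/-- The element `x` is a sum of shuffles whose coefficients are, up to sign, those of the shuffles
without inversions. These coefficients, one for each `k + l = n`, are the components of `y`. -/
lemma exists_normalizedEZ_eq {n : ℕ} {x : (moore (P.A ⊗ P'.A)).X n}
    (hx : x ∈ omegaSub (moore (P.A ⊗ P'.A)) (barBox P P') n) :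
    ∃ y : (moore P.A ⊗ moore P'.A).X n, (normalizedEZ P.A P'.A n).hom y = x ∧
      ∀ i j, i + j = n → tensorComp (moore P.A) (moore P'.A) i j n y ∈
        LinearMap.range (TensorProduct.mapIncl (P.barB i) (P'.barB j)) := by
  obtain ⟨t, ht, rfl⟩ := exists_eq_sum_shuffleMap P P' hx.1
  have hbase : ∀ q : Finset.HasAntidiagonal.antidiagonal n, ∀ p, t q p = p.sgn • t q
      (Shuffle.base (Finset.HasAntidiagonal.mem_antidiagonal.1 q.2)) := by
    intro q p
    cases n with
    | zero =>
      obtain rfl := Shuffle.ext_nu (p := p)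
        (q := Shuffle.base (Finset.HasAntidiagonal.mem_antidiagonal.1 q.2)) fun i => i.elim0
      rw [Shuffle.sgn_base, one_smul]
    | succ m =>
      exact eq_sgn_smul_of_add_swap_eq_zero (t q)
        (add_swap_eq_zero P P' t ((Submodule.mem_iInf _).1 hx.2 m) q) p
  refine ⟨∑ q : Finset.HasAntidiagonal.antidiagonal n, tensorInc (moore P.A) (moore P'.A) q.1.1
    q.1.2 n (Finset.HasAntidiagonal.mem_antidiagonal.1 q.2)
      (t q (Shuffle.base (Finset.HasAntidiagonal.mem_antidiagonal.1 q.2))), ?_, fun i j h => ?_⟩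
  · rw [map_sum]
    refine Finset.sum_congr rfl fun q _ => ?_
    rw [normalizedEZ_tensorInc]
    refine Finset.sum_congr rfl fun p _ => ?_
    rw [hbase q p, map_zsmul]
  · rw [map_sum]
    refine Submodule.sum_mem _ fun q _ => ?_
    obtain ⟨⟨k, l⟩, hq⟩ := q
    by_cases hk : k = i ∧ l = j
    · obtain ⟨rfl, rfl⟩ := hk
      rw [tensorComp_tensorInc]
      exact ht ⟨(k, l), hq⟩ _
    · rw [tensorComp_tensorInc_of_ne _ hk]
      exact Submodule.zero_mem _

end PathPair

end

end PathHomology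

namespace PathHomology

noncomputable section

open HomologicalComplex

variable {K : Type u} [CommRing K]

/-! ### The isomorphism `Ω P ⊗ Ω P' ≅ Ω (P □ P')` -/

lemma projective_moore (A : SimplicialObject (ModuleCat.{u} K)) (n : ℕ)
    [Module.Projective K (A _⦋n⦌)] : Module.Projective K ((moore A).X n) :=
  Module.Projective.of_split (mooreIncl A n).hom (rho A n).hom
    (congrArg ModuleCat.Hom.hom (mooreIncl_rho A n))

namespace PathPair

variable (P P' : PathPair K)

lemma normalizedEZ_omegaIncl_mem {n : ℕ} (z : (P.Omega ⊗ P'.Omega).X n) :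
    (normalizedEZ P.A P'.A n).hom (((P.OmegaIncl ⊗ₘ P'.OmegaIncl).f n).hom z) ∈
      barBox P P' n := by
  refine normalizedEZ_mem_barBox P P' _ fun i j _ => ?_
  rw [tensorComp_tensorHom]
  have h : LinearMap.range (TensorProduct.mapIncl (omegaSub (moore P.A) P.barB i)
      (omegaSub (moore P'.A) P'.barB j)) ≤
      LinearMap.range (TensorProduct.mapIncl (P.barB i) (P'.barB j)) :=
    TensorProduct.range_mapIncl_mono inf_le_left inf_le_left
  exact h ⟨_, rfl⟩

lemma normalizedEZ_omegaIncl_mem_omegaSub {n : ℕ} (z : (P.Omega ⊗ P'.Omega).X n) :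
    (normalizedEZ P.A P'.A n).hom (((P.OmegaIncl ⊗ₘ P'.OmegaIncl).f n).hom z) ∈
      omegaSub (moore (P.A ⊗ P'.A)) (barBox P P') n := by
  refine ⟨normalizedEZ_omegaIncl_mem P P' z, (Submodule.mem_iInf _).2 fun m => ?_⟩
  rw [Submodule.mem_comap, normalizedEZ_d_apply]
  have h : ((moore P.A ⊗ moore P'.A).d n m).hom (((P.OmegaIncl ⊗ₘ P'.OmegaIncl).f n).hom z) =
      ((P.OmegaIncl ⊗ₘ P'.OmegaIncl).f m).hom (((P.Omega ⊗ P'.Omega).d n m).hom z) :=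
    ConcreteCategory.congr_hom ((P.OmegaIncl ⊗ₘ P'.OmegaIncl).comm n m) z
  rw [h]
  exact normalizedEZ_omegaIncl_mem P P' _

/-- The restriction of the normalized Eilenberg–Zilber map to `Ω P ⊗ Ω P'`. -/
def omegaEZ : P.Omega ⊗ P'.Omega ⟶ (P.box P').Omega where
  f n := ModuleCat.ofHom (LinearMap.codRestrict (omegaSub (moore (P.A ⊗ P'.A)) (barBox P P') n)
    ((normalizedEZ P.A P'.A n).hom ∘ₗ ((P.OmegaIncl ⊗ₘ P'.OmegaIncl).f n).hom)
    (normalizedEZ_omegaIncl_mem_omegaSub P P'))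
  comm' n m _ := by
    refine ModuleCat.hom_ext (LinearMap.ext fun z => Subtype.ext ?_)
    refine (normalizedEZ_d_apply P.A P'.A m _).trans (congrArg (normalizedEZ P.A P'.A m).hom ?_)
    exact ConcreteCategory.congr_hom ((P.OmegaIncl ⊗ₘ P'.OmegaIncl).comm n m) z

lemma omegaEZ_f_OmegaIncl (n : ℕ) : (omegaEZ P P').f n ≫ (P.box P').OmegaIncl.f n =
    (P.OmegaIncl ⊗ₘ P'.OmegaIncl).f n ≫ normalizedEZ P.A P'.A n := rfl

variable {P P'}

lemma omegaEZ_f_bijective [IsDomain K] [IsPrincipalIdealRing K]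
    (hA : ∀ n, Module.Free K (P.A _⦋n⦌)) (hA' : ∀ n, Module.Free K (P'.A _⦋n⦌))
    (hB : ∀ n, IsComplemented (P.barB n)) (hB' : ∀ n, IsComplemented (P'.barB n)) (n : ℕ) :
    Function.Bijective ((omegaEZ P P').f n).hom := by
  have (n : ℕ) : Module.Projective K ((moore P.A).X n) := projective_moore P.A n
  have (n : ℕ) : Module.Projective K ((moore P'.A).X n) := projective_moore P'.A n
  constructor
  · intro z z' h
    refine omegaIncl_tensorHom_injective hB hB' n ?_
    have h1 := congrArg (normalizedAW P.A P'.A n).hom (congrArg Subtype.val h)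
    exact (normalizedAW_normalizedEZ_apply P.A P'.A _).symm.trans
      (h1.trans (normalizedAW_normalizedEZ_apply P.A P'.A _))
  · intro x
    obtain ⟨y, hy, hy'⟩ := exists_normalizedEZ_eq P P' x.2
    have hd : ∀ i j m, i + j = m → m + 1 = n →
        tensorComp (moore P.A) (moore P'.A) i j m (((moore P.A ⊗ moore P'.A).d n m).hom y) ∈
          LinearMap.range (TensorProduct.mapIncl (P.barB i) (P'.barB j)) := by
      intro i j m hm _
      -- Here dy = αε(dy) = α(dx), and dx lies in the path submodule because `x` lies in Ω.
      rw [← normalizedAW_normalizedEZ_apply P.A P'.A (((moore P.A ⊗ moore P'.A).d n m).hom y),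
        ← normalizedEZ_d_apply, hy]
      exact tensorComp_normalizedAW_mem P P' ((Submodule.mem_iInf _).1 x.2.2 m) i j hm
    obtain ⟨z, hz⟩ := mem_range_omegaIncl_tensorHom y
      (tensorComp_mem_range_mapIncl_omegaSub hB y hy' hd)
    exact ⟨z, Subtype.ext ((congrArg (normalizedEZ P.A P'.A n).hom hz).trans hy)⟩

lemma exists_omegaEZ_iso [IsDomain K] [IsPrincipalIdealRing K]
    (hA : ∀ n, Module.Free K (P.A _⦋n⦌)) (hA' : ∀ n, Module.Free K (P'.A _⦋n⦌))
    (hB : ∀ n, IsComplemented (P.barB n)) (hB' : ∀ n, IsComplemented (P'.barB n)) :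
    ∃ e : P.Omega ⊗ P'.Omega ≅ (P.box P').Omega,
      (∀ n, e.hom.f n ≫ (P.box P').OmegaIncl.f n =
        (P.OmegaIncl ⊗ₘ P'.OmegaIncl).f n ≫ normalizedEZ P.A P'.A n) ∧
      ∀ n, e.inv.f n ≫ (P.OmegaIncl ⊗ₘ P'.OmegaIncl).f n =
        (P.box P').OmegaIncl.f n ≫ normalizedAW P.A P'.A n := by
  have (n : ℕ) : IsIso ((omegaEZ P P').f n) :=
    (ConcreteCategory.isIso_iff_bijective _).2 (omegaEZ_f_bijective hA hA' hB hB' n)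
  have : IsIso (omegaEZ P P') := Hom.isIso_of_components _
  refine ⟨asIso (omegaEZ P P'), omegaEZ_f_OmegaIncl P P', fun n =>
    ModuleCat.hom_ext (LinearMap.ext fun x => ?_)⟩
  -- Writing `x` as ε of its preimage reduces the formula for the inverse to αε = 1.
  have hx : ((omegaEZ P P').f n).hom (((asIso (omegaEZ P P')).inv.f n).hom x) = x :=
    ConcreteCategory.congr_hom (congr_hom (asIso (omegaEZ P P')).inv_hom_id n) x
  exact (normalizedAW_normalizedEZ_apply P.A P'.A _).symm.trans
    (congrArg (fun w => (normalizedAW P.A P'.A n).hom w.1) hx)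

end PathPair

end

end PathHomology

namespace PathHomology

noncomputable section

open HomologicalComplex

variable {K : Type u} [CommRing K]

/-! ### Cycles and homology classes as elements -/

section Cycles

variable (C : ChainComplex (ModuleCat.{u} K) ℕ)

lemma next_down (n : ℕ) : (ComplexShape.down ℕ).next n = n - 1 := by
  cases n <;> simp

lemma iCycles_injective (n : ℕ) : Function.Injective (C.iCycles n).hom :=
  (ModuleCat.mono_iff_injective _).1 inferInstance

lemma homologyπ_surjective (n : ℕ) : Function.Surjective (C.homologyπ n).hom :=
  (ModuleCat.epi_iff_surjective _).1 inferInstance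

lemma exact_iCycles (n : ℕ) :
    Function.Exact (C.iCycles n).hom (C.d n (n - 1)).hom := by
  intro x
  constructor
  · intro hx
    let k : ModuleCat.of K (LinearMap.ker (C.d n (n - 1)).hom) ⟶ C.X n :=
      ModuleCat.ofHom (LinearMap.ker (C.d n (n - 1)).hom).subtype
    have hk : k ≫ C.d n (n - 1) = 0 := ModuleCat.hom_ext (LinearMap.ext fun y => y.2)
    exact ⟨(C.liftCycles k (n - 1) (next_down n) hk).hom ⟨x, hx⟩,
      ConcreteCategory.congr_hom (C.liftCycles_i k (n - 1) (next_down n) hk) (⟨x, hx⟩ :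
        LinearMap.ker (C.d n (n - 1)).hom)⟩
  · rintro ⟨z, rfl⟩
    exact ConcreteCategory.congr_hom (C.iCycles_d n (n - 1)) z

lemma exact_toCycles_homologyπ (n : ℕ) :
    Function.Exact (C.toCycles (n + 1) n).hom (C.homologyπ n).hom := by
  have h := (ShortComplex.mk _ _ (C.toCycles_comp_homologyπ (n + 1) n)).exact_of_g_is_cokernel
    (C.homologyIsCokernel (n + 1) n (by simp))
  exact (ShortComplex.ShortExact.moduleCat_exact_iff_function_exact _).1 h

lemma iCycles_toCycles (n : ℕ) (w : C.X (n + 1)) :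
    (C.iCycles n).hom ((C.toCycles (n + 1) n).hom w) = (C.d (n + 1) n).hom w :=
  ConcreteCategory.congr_hom (C.toCycles_i (n + 1) n) w

/-- There are no boundaries in degree one, so the homology is the module of cycles. This computes
Tor₁ from a resolution of length one. -/
lemma exists_homology_one_equiv (h : C.d 2 1 = 0) :
    Nonempty (C.homology 1 ≃ₗ[K] LinearMap.ker (C.d 1 0).hom) := by
  have h0 : C.toCycles 2 1 = 0 := by
    rw [← cancel_mono (C.iCycles 1), toCycles_i, h, Limits.zero_comp]
  have h1 : Function.Injective (C.homologyπ 1).hom := by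
    rw [injective_iff_map_eq_zero]
    intro z hz
    obtain ⟨w, rfl⟩ := (exact_toCycles_homologyπ C 1 z).1 hz
    rw [h0]
    rfl
  let e₁ := LinearEquiv.ofBijective (C.homologyπ 1).hom ⟨h1, homologyπ_surjective C 1⟩
  let e₂ := LinearEquiv.ofInjective (C.iCycles 1).hom (iCycles_injective C 1)
  have h2 : LinearMap.range (C.iCycles 1).hom = LinearMap.ker (C.d 1 0).hom :=
    (LinearMap.exact_iff.1 (exact_iCycles C 1)).symm
  exact ⟨e₁.symm ≪≫ₗ e₂ ≪≫ₗ LinearEquiv.ofEq _ _ h2⟩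

end Cycles

/-! ### The functor `Tor₁` -/

section Tor

variable {V : Type*} [Category* V] [Abelian V]

open scoped ZeroObject in
/-- The objects of the chain complex `⋯ → 0 → X → Y`. -/
def twoTermX (X Y : V) (n : ℕ) : V :=
  Nat.casesOn (motive := fun _ => V) n Y fun m => Nat.casesOn (motive := fun _ => V) m X fun _ => 0

/-- The differentials of the chain complex `⋯ → 0 → X → Y`. -/
def twoTermD {X Y : V} (f : X ⟶ Y) (n : ℕ) : twoTermX X Y (n + 1) ⟶ twoTermX X Y n :=
  Nat.casesOn (motive := fun n => twoTermX X Y (n + 1) ⟶ twoTermX X Y n) n f fun _ => 0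

/-- The chain complex `⋯ → 0 → X → Y`. -/
def twoTerm {X Y : V} (f : X ⟶ Y) : ChainComplex V ℕ :=
  ChainComplex.of (twoTermX X Y) (twoTermD f) fun _ => Limits.zero_comp

lemma twoTerm_d_one_zero {X Y : V} (f : X ⟶ Y) : (twoTerm f).d 1 0 = f :=
  ChainComplex.of_d (twoTermX X Y) (twoTermD f) 0

lemma twoTerm_d_succ {X Y : V} (f : X ⟶ Y) (n : ℕ) : (twoTerm f).d (n + 2) (n + 1) = 0 :=
  ChainComplex.of_d (twoTermX X Y) (twoTermD f) (n + 1)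

lemma twoTerm_exactAt_one {X Y : V} (f : X ⟶ Y) [Mono f] : (twoTerm f).ExactAt 1 := by
  rw [exactAt_iff' _ 2 1 0 (by simp) (by simp)]
  refine (ShortComplex.exact_iff_mono _ (twoTerm_d_succ f 0)).2 ?_
  change Mono ((twoTerm f).d 1 0)
  rw [twoTerm_d_one_zero]
  assumption

lemma twoTerm_exactAt_succ {X Y : V} (f : X ⟶ Y) (n : ℕ) : (twoTerm f).ExactAt (n + 2) := by
  rw [exactAt_iff' _ (n + 3) (n + 2) (n + 1) (by simp) (by simp)]
  exact ShortComplex.exact_of_isZero_X₂ _ (Limits.isZero_zero V)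

/-- The projective resolution that is given by a short exact sequence of length two. -/
def projectiveResolutionOfShortExact (S : ShortComplex V) (hS : S.ShortExact) [Projective S.X₁]
    [Projective S.X₂] : ProjectiveResolution S.X₃ where
  complex := twoTerm S.f
  projective n := match n with
    | 0 => ‹Projective S.X₂›
    | 1 => ‹Projective S.X₁›
    | _ + 2 => (Limits.isZero_zero V).projective
  π := (ChainComplex.toSingle₀Equiv (twoTerm S.f) S.X₃).symm
    ⟨S.g, (congrArg (· ≫ S.g) (twoTerm_d_one_zero S.f)).trans S.zero⟩
  quasiIso := ⟨fun n => by
    have := hS.mono_f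
    match n with
    | 0 =>
      -- In degree zero the condition is that `S.g` is an epimorphism whose kernel is the image of
      -- `S.f`.
      rw [ChainComplex.quasiIsoAt₀_iff, ShortComplex.quasiIso_iff_of_zeros']
      · refine (ShortComplex.exact_and_epi_g_iff_of_iso ?_).2 ⟨hS.exact, hS.epi_g⟩
        exact ShortComplex.isoMk (Iso.refl _) (Iso.refl _) (Iso.refl _)
          ((Category.id_comp _).trans ((twoTerm_d_one_zero S.f).symm.trans
            (Category.comp_id _).symm))
          ((Category.id_comp _).trans (((ChainComplex.toSingle₀Equiv_symm_apply_f_zero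
            (C := twoTerm S.f) S.g _).symm).trans (Category.comp_id _).symm))
      all_goals rfl
    | 1 =>
      rw [quasiIsoAt_iff_exactAt' _ _ (ChainComplex.exactAt_succ_single_obj _ 0)]
      exact twoTerm_exactAt_one S.f
    | n + 2 =>
      rw [quasiIsoAt_iff_exactAt' _ _ (ChainComplex.exactAt_succ_single_obj _ _)]
      exact twoTerm_exactAt_succ S.f n⟩

/-- `Tor₁(X, Y)` is the kernel of `X ⊗ B → X ⊗ Z` for a projective presentation `B → Z → Y`. -/
lemma exists_tor_one_equiv (X Y : ModuleCat.{u} K) {B Z : Type u} [AddCommGroup B]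
    [AddCommGroup Z] [Module K B] [Module K Z] [Module.Projective K B] [Module.Projective K Z]
    (f : B →ₗ[K] Z) (g : Z →ₗ[K] Y) (hf : Function.Injective f) (hfg : Function.Exact f g)
    (hg : Function.Surjective g) :
    Nonempty (((Tor (ModuleCat.{u} K) 1).obj X).obj Y ≃ₗ[K] LinearMap.ker (f.lTensor X)) := by
  let S : ShortComplex (ModuleCat.{u} K) := ShortComplex.mk (ModuleCat.ofHom f) (ModuleCat.ofHom g)
    (ModuleCat.hom_ext hfg.linearMap_comp_eq_zero)
  have hS : S.ShortExact :=
    { exact := (ShortComplex.ShortExact.moduleCat_exact_iff_function_exact _).2 hfg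
      mono_f := (ModuleCat.mono_iff_injective _).2 hf
      epi_g := (ModuleCat.epi_iff_surjective _).2 hg }
  have : Projective S.X₁ := (IsProjective.iff_projective B).1 ‹_›
  have : Projective S.X₂ := (IsProjective.iff_projective Z).1 ‹_›
  let F := (tensoringLeft (ModuleCat.{u} K)).obj X
  let E := (F.mapHomologicalComplex (ComplexShape.down ℕ)).obj (twoTerm S.f)
  have e₁ : ((Tor (ModuleCat.{u} K) 1).obj X).obj Y ≅ E.homology 1 :=
    (projectiveResolutionOfShortExact S hS).isoLeftDerivedObj F 1
  have h2 : E.d 2 1 = 0 := (congrArg F.map (twoTerm_d_succ S.f 0)).trans (F.map_zero _ _)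
  obtain ⟨e₂⟩ := exists_homology_one_equiv E h2
  have h3 : E.d 1 0 = F.map S.f := congrArg F.map (twoTerm_d_one_zero S.f)
  have h4 : LinearMap.ker (E.d 1 0).hom = LinearMap.ker (f.lTensor X) := by
    rw [h3]
    rfl
  exact ⟨e₁.toLinearEquiv ≪≫ₗ e₂ ≪≫ₗ LinearEquiv.ofEq _ _ h4⟩

end Tor

end

end PathHomology

namespace PathHomology

noncomputable section

open HomologicalComplex

/-! ### Linear algebra for the Künneth theorem -/

section LinearAlgebra

variable {K : Type*} [CommRing K] {X₁ X₀ X Z H N₁ N₀ Z' N : Type*} [AddCommGroup X₁]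
  [AddCommGroup X₀] [AddCommGroup X] [AddCommGroup Z] [AddCommGroup H] [AddCommGroup N₁]
  [AddCommGroup N₀] [AddCommGroup Z'] [AddCommGroup N] [Module K X₁] [Module K X₀] [Module K X]
  [Module K Z] [Module K H] [Module K N₁] [Module K N₀] [Module K Z'] [Module K N]

lemma exists_comp_eq_of_ker_le {p : X →ₗ[K] Z} (hp : Function.Surjective p) (F : X →ₗ[K] N)
    (h : LinearMap.ker p ≤ LinearMap.ker F) : ∃ f : Z →ₗ[K] N, ∀ x, f (p x) = F x := by
  refine ⟨(LinearMap.ker p).liftQ F h ∘ₗ (p.quotKerEquivOfSurjective hp).symm.toLinearMap,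
    fun x => ?_⟩
  have h1 : (p.quotKerEquivOfSurjective hp).symm (p x) = (LinearMap.ker p).mkQ x := by
    rw [LinearEquiv.symm_apply_eq]
    rfl
  rw [LinearMap.comp_apply, LinearEquiv.coe_coe, h1]
  rfl

/-- By flatness the kernel of d ⊗ 1 is the image of i ⊗ 1, where `i ∘ₗ r` acts as the identity. -/
lemma map_retraction_id_apply [Module.Flat K N] {i : Z →ₗ[K] X} {d : X →ₗ[K] X₀} {r : X →ₗ[K] Z}
    (hid : Function.Exact i d) (hr : r ∘ₗ i = LinearMap.id) {t : TensorProduct K X N}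
    (ht : d.rTensor N t = 0) : TensorProduct.map (i ∘ₗ r) LinearMap.id t = t := by
  obtain ⟨u, rfl⟩ := (Module.Flat.rTensor_exact N hid t).1 ht
  rw [LinearMap.rTensor, TensorProduct.map_map, LinearMap.comp_assoc, hr]
  rfl

lemma map_id_retraction_apply [Module.Flat K N] {i : Z →ₗ[K] X} {d : X →ₗ[K] X₀} {r : X →ₗ[K] Z}
    (hid : Function.Exact i d) (hr : r ∘ₗ i = LinearMap.id) {t : TensorProduct K N X}
    (ht : d.lTensor N t = 0) : TensorProduct.map LinearMap.id (i ∘ₗ r) t = t := by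
  obtain ⟨u, rfl⟩ := (Module.Flat.lTensor_exact N hid t).1 ht
  rw [LinearMap.lTensor, TensorProduct.map_map, LinearMap.comp_assoc, hr]
  rfl

/-- In the application `τ` and `τ'` are boundary maps, `i` and `i'` inclusions of cycles, and `r` a
retraction to cycles. The hypothesis says that the image of `t` in Z ⊗ B', with B' the range of
`τ'`, vanishes in H ⊗ B'. By right exactness it comes from X₁ ⊗ B', and a section of N₁ → B' lifts
it to X₁ ⊗ N₁. -/
lemma exists_correction {τ : X₁ →ₗ[K] Z} {π : Z →ₗ[K] H} (hτπ : Function.Exact τ π)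
    (hπ : Function.Surjective π) (i : Z →ₗ[K] X₀) (r : X₀ →ₗ[K] Z) (τ' : N₁ →ₗ[K] Z')
    (i' : Z' →ₗ[K] N₀) [Module.Projective K (LinearMap.range τ')] {t : TensorProduct K X₀ N₁}
    (ht : TensorProduct.map (π ∘ₗ r) τ'.rangeRestrict t = 0) :
    ∃ v : TensorProduct K X₁ N₁,
      (i' ∘ₗ τ').lTensor X₀ ((i ∘ₗ τ).rTensor N₁ v) = TensorProduct.map (i ∘ₗ r) (i' ∘ₗ τ') t := by
  obtain ⟨s, hs⟩ := Module.projective_lifting_property τ'.rangeRestrict LinearMap.id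
    τ'.surjective_rangeRestrict
  obtain ⟨w, hw⟩ := (rTensor_exact (LinearMap.range τ') hτπ hπ
    (TensorProduct.map r τ'.rangeRestrict t)).1 (by
      rw [LinearMap.rTensor, TensorProduct.map_map]
      exact ht)
  refine ⟨s.lTensor X₁ w, ?_⟩
  have h2 : τ' ∘ₗ s = (LinearMap.range τ').subtype :=
    congrArg ((LinearMap.range τ').subtype ∘ₗ ·) hs
  have h3 := congrArg (TensorProduct.map i (i' ∘ₗ (LinearMap.range τ').subtype)) hw
  rw [LinearMap.rTensor, TensorProduct.map_map, TensorProduct.map_map] at h3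
  rw [LinearMap.rTensor, LinearMap.lTensor, LinearMap.lTensor, TensorProduct.map_map,
    TensorProduct.map_map]
  refine Eq.trans ?_ h3
  rw [← h2]
  rfl

/-- A lift `a` of the Tor element `u` to Z ⊗ N₁ becomes zero in H ⊗ Z', so (1 ⊗ τ')a is a boundary
in the first factor. With `b` accounting for it, `a` can be completed to a cycle of the tensor
product. -/
lemma exists_lift_of_mem_ker {τ : X₁ →ₗ[K] Z} {π : Z →ₗ[K] H} (hτπ : Function.Exact τ π)
    (hπ : Function.Surjective π) (τ' : N₁ →ₗ[K] Z') {u : TensorProduct K H (LinearMap.range τ')}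
    (hu : (LinearMap.range τ').subtype.lTensor H u = 0) :
    ∃ (a : TensorProduct K Z N₁) (b : TensorProduct K X₁ Z'),
      TensorProduct.map π τ'.rangeRestrict a = u ∧ τ'.lTensor Z a = τ.rTensor Z' b := by
  obtain ⟨a, rfl⟩ := TensorProduct.map_surjective hπ τ'.surjective_rangeRestrict u
  have h1 : π.rTensor Z' (τ'.lTensor Z a) = 0 := by
    rw [LinearMap.lTensor, TensorProduct.map_map] at hu
    rw [LinearMap.rTensor, LinearMap.lTensor, TensorProduct.map_map]
    exact hu
  obtain ⟨b, hb⟩ := (rTensor_exact Z' hτπ hπ _).1 h1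
  exact ⟨a, b, rfl, hb.symm⟩

end LinearAlgebra

variable {K : Type u} [CommRing K]

/-! ### The cross product and the Tor component -/

section Künneth

variable (C D : ChainComplex (ModuleCat.{u} K) ℕ)

/-- The cycles that are given by a linear map into the kernel of the differential. -/
def cyclesLift {M : Type u} [AddCommGroup M] [Module K M] {n : ℕ} (f : M →ₗ[K] C.X n)
    (hf : (C.d n (n - 1)).hom ∘ₗ f = 0) : M →ₗ[K] C.cycles n :=
  (C.liftCycles (ModuleCat.ofHom f) (n - 1) (next_down n) (ModuleCat.hom_ext hf)).hom

lemma iCycles_cyclesLift {M : Type u} [AddCommGroup M] [Module K M] {n : ℕ} (f : M →ₗ[K] C.X n)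
    (hf : (C.d n (n - 1)).hom ∘ₗ f = 0) (x : M) :
    (C.iCycles n).hom (cyclesLift C f hf x) = f x :=
  ConcreteCategory.congr_hom (C.liftCycles_i (ModuleCat.ofHom f) (n - 1) (next_down n)
    (ModuleCat.hom_ext hf)) x

lemma iCycles_comp_toCycles (n : ℕ) :
    (C.iCycles n).hom ∘ₗ (C.toCycles (n + 1) n).hom = (C.d (n + 1) n).hom :=
  LinearMap.ext (iCycles_toCycles C n)

lemma d_iCycles (n : ℕ) : (C.d n (n - 1)).hom ∘ₗ (C.iCycles n).hom = 0 :=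
  (exact_iCycles C n).linearMap_comp_eq_zero

lemma toCycles_iCycles (n : ℕ) :
    (C.toCycles (n + 1) n).hom ∘ₗ (C.iCycles (n + 1)).hom = 0 := by
  refine LinearMap.ext fun z => iCycles_injective C n ?_
  rw [LinearMap.comp_apply, iCycles_toCycles]
  exact (LinearMap.congr_fun (d_iCycles C (n + 1)) z).trans (map_zero _).symm

lemma homologyπ_eq_zero {n : ℕ} {z : C.cycles n} (w : C.X (n + 1))
    (h : (C.iCycles n).hom z = (C.d (n + 1) n).hom w) : (C.homologyπ n).hom z = 0 := by
  rw [← iCycles_toCycles] at h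
  exact (exact_toCycles_homologyπ C n z).2 ⟨w, (iCycles_injective C n h).symm⟩

variable {C D}

lemma d_tensorInc_left {i j n : ℕ} (h : i + j = n) (t : TensorProduct K (C.X (i + 1)) (D.X j))
    (ht : (D.d j (j - 1)).hom.lTensor _ t = 0) (h' : i + 1 + j = n + 1) :
    ((C ⊗ D).d (n + 1) n).hom (tensorInc C D (i + 1) j (n + 1) h' t) =
      tensorInc C D i j n h ((C.d (i + 1) i).hom.rTensor _ t) := by
  refine tensorComp_ext fun k l hkl => ?_
  rw [tensorComp_d hkl]
  by_cases hk : i = k ∧ j = l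
  · obtain ⟨rfl, rfl⟩ := hk
    rw [tensorComp_tensorInc, tensorComp_tensorInc, tensorComp_tensorInc_of_ne _ (by omega),
      map_zero, smul_zero, add_zero]
  · rw [tensorComp_tensorInc_of_ne _ hk, tensorComp_tensorInc_of_ne _ (by omega), map_zero,
      zero_add]
    by_cases hk' : i + 1 = k ∧ j = l + 1
    · obtain ⟨rfl, rfl⟩ := hk'
      rw [tensorComp_tensorInc]
      exact (congrArg _ ht).trans (smul_zero _)
    · rw [tensorComp_tensorInc_of_ne _ hk', map_zero, smul_zero]

lemma d_tensorInc_right {i j n : ℕ} (h : i + j = n) (t : TensorProduct K (C.X i) (D.X (j + 1)))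
    (ht : (C.d i (i - 1)).hom.rTensor _ t = 0) (h' : i + (j + 1) = n + 1) :
    ((C ⊗ D).d (n + 1) n).hom (tensorInc C D i (j + 1) (n + 1) h' t) =
      (-1 : ℤ) ^ i • tensorInc C D i j n h ((D.d (j + 1) j).hom.lTensor _ t) := by
  refine tensorComp_ext fun k l hkl => ?_
  rw [tensorComp_d hkl, map_zsmul]
  by_cases hk : i = k ∧ j = l
  · obtain ⟨rfl, rfl⟩ := hk
    rw [tensorComp_tensorInc, tensorComp_tensorInc, tensorComp_tensorInc_of_ne _ (by omega),
      map_zero, zero_add]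
  · rw [tensorComp_tensorInc_of_ne _ hk, smul_zero,
      tensorComp_tensorInc_of_ne (i := k) (j := l + 1) _ (by omega), map_zero, smul_zero, add_zero]
    by_cases hk' : i = k + 1 ∧ j + 1 = l
    · obtain ⟨rfl, rfl⟩ := hk'
      rw [tensorComp_tensorInc]
      exact ht
    · rw [tensorComp_tensorInc_of_ne _ hk', map_zero]

lemma d_tensorInc_eq_zero {i j n : ℕ} (h : i + j = n) (t : TensorProduct K (C.X i) (D.X j))
    (ht : (C.d i (i - 1)).hom.rTensor _ t = 0) (ht' : (D.d j (j - 1)).hom.lTensor _ t = 0) :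
    ((C ⊗ D).d n (n - 1)).hom (tensorInc C D i j n h t) = 0 := by
  cases i with
  | zero =>
    cases j with
    | zero =>
      obtain rfl : n = 0 := by omega
      rw [(C ⊗ D).shape 0 (0 - 1) (by simp)]
      rfl
    | succ j =>
      obtain rfl : n = j + 1 := by omega
      refine (d_tensorInc_right (by omega) t ht h).trans ?_
      refine (congrArg _ (congrArg _ ht')).trans ?_
      rw [map_zero, smul_zero]
  | succ i =>
    obtain ⟨m, rfl⟩ : ∃ m, n = m + 1 := ⟨i + j, by omega⟩
    refine (d_tensorInc_left (by omega) t ht' h).trans ?_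
    exact (congrArg _ ht).trans (map_zero _)

variable (C D)

lemma tensorInc_iCycles_d {i j n : ℕ} (h : i + j = n) :
    ((C ⊗ D).d n (n - 1)).hom ∘ₗ tensorInc C D i j n h ∘ₗ
      TensorProduct.map (C.iCycles i).hom (D.iCycles j).hom = 0 := by
  refine LinearMap.ext fun t => d_tensorInc_eq_zero h _ ?_ ?_
  · rw [LinearMap.rTensor, TensorProduct.map_map, d_iCycles, TensorProduct.map_zero_left]
    rfl
  · rw [LinearMap.lTensor, TensorProduct.map_map, d_iCycles, TensorProduct.map_zero_right]
    rfl

/-- The product of cycles. -/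
def crossCycles (i j n : ℕ) (h : i + j = n) :
    TensorProduct K (C.cycles i) (D.cycles j) →ₗ[K] (C ⊗ D).cycles n :=
  cyclesLift (C ⊗ D) (tensorInc C D i j n h ∘ₗ
    TensorProduct.map (C.iCycles i).hom (D.iCycles j).hom) (tensorInc_iCycles_d C D h)

lemma iCycles_crossCycles {i j n : ℕ} (h : i + j = n)
    (t : TensorProduct K (C.cycles i) (D.cycles j)) :
    ((C ⊗ D).iCycles n).hom (crossCycles C D i j n h t) =
      tensorInc C D i j n h (TensorProduct.map (C.iCycles i).hom (D.iCycles j).hom t) :=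
  iCycles_cyclesLift ..

/-- The kernel of Z ⊗ Z' → H ⊗ H' is generated by products in which one factor is a boundary. Such a
product is the boundary of a cycle times a chain, up to the sign (-1)^i when the second factor is
the boundary. -/
lemma exists_crossHomology {i j n : ℕ} (h : i + j = n) :
    ∃ f : TensorProduct K (C.homology i) (D.homology j) →ₗ[K] (C ⊗ D).homology n,
      ∀ t, f (TensorProduct.map (C.homologyπ i).hom (D.homologyπ j).hom t) =
        ((C ⊗ D).homologyπ n).hom (crossCycles C D i j n h t) := by
  refine exists_comp_eq_of_ker_le (TensorProduct.map_surjective (homologyπ_surjective C i)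
    (homologyπ_surjective D j)) (((C ⊗ D).homologyπ n).hom ∘ₗ crossCycles C D i j n h) ?_
  rw [TensorProduct.map_ker (exact_toCycles_homologyπ C i) (homologyπ_surjective C i)
    (exact_toCycles_homologyπ D j) (homologyπ_surjective D j)]
  refine sup_le ?_ ?_
  · rintro _ ⟨t, rfl⟩
    refine homologyπ_eq_zero (C ⊗ D) ((-1 : ℤ) ^ i • tensorInc C D i (j + 1) (n + 1) (by omega)
      (TensorProduct.map (C.iCycles i).hom LinearMap.id t)) ?_
    rw [iCycles_crossCycles, map_zsmul, d_tensorInc_right h, smul_smul, ← mul_pow, neg_one_mul,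
      neg_neg, one_pow, one_smul, LinearMap.lTensor, LinearMap.lTensor, TensorProduct.map_map,
      TensorProduct.map_map, iCycles_comp_toCycles]
    · rfl
    · rw [LinearMap.rTensor, TensorProduct.map_map, d_iCycles, TensorProduct.map_zero_left]
      rfl
  · rintro _ ⟨t, rfl⟩
    refine homologyπ_eq_zero (C ⊗ D) (tensorInc C D (i + 1) j (n + 1) (by omega)
      (TensorProduct.map LinearMap.id (D.iCycles j).hom t)) ?_
    rw [iCycles_crossCycles, d_tensorInc_left h, LinearMap.rTensor, LinearMap.rTensor,
      TensorProduct.map_map, TensorProduct.map_map, iCycles_comp_toCycles]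
    · rfl
    · rw [LinearMap.lTensor, TensorProduct.map_map, d_iCycles, TensorProduct.map_zero_right]
      rfl

variable {C D}

lemma exists_descend_homology {n : ℕ} {M : Type*} [AddCommGroup M] [Module K M]
    (F : C.X n →ₗ[K] M) (hF : F ∘ₗ (C.d (n + 1) n).hom = 0) :
    ∃ f : C.homology n →ₗ[K] M, ∀ z, f ((C.homologyπ n).hom z) = F ((C.iCycles n).hom z) := by
  refine exists_comp_eq_of_ker_le (homologyπ_surjective C n) (F ∘ₗ (C.iCycles n).hom) ?_
  intro z hz
  obtain ⟨w, rfl⟩ := (exact_toCycles_homologyπ C n z).1 hz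
  rw [LinearMap.mem_ker, LinearMap.comp_apply, iCycles_toCycles]
  exact LinearMap.congr_fun hF w

variable {r : ∀ n, C.X n →ₗ[K] C.cycles n} {r' : ∀ n, D.X n →ₗ[K] D.cycles n}

lemma retraction_d (hr : ∀ n, r n ∘ₗ (C.iCycles n).hom = LinearMap.id) (n : ℕ) :
    r n ∘ₗ (C.d (n + 1) n).hom = (C.toCycles (n + 1) n).hom := by
  rw [← iCycles_comp_toCycles, ← LinearMap.comp_assoc, hr, LinearMap.id_comp]

lemma homologyπ_retraction_d (hr : ∀ n, r n ∘ₗ (C.iCycles n).hom = LinearMap.id) (n : ℕ) :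
    ((C.homologyπ n).hom ∘ₗ r n) ∘ₗ (C.d (n + 1) n).hom = 0 := by
  rw [LinearMap.comp_assoc, retraction_d hr]
  exact (exact_toCycles_homologyπ C n).linearMap_comp_eq_zero

/-- Composing the retractions with the projections to homology extends classes of cycles to maps on
all chains that kill boundaries. Their tensor product descends to the homology of C ⊗ D and will be
a left inverse of the cross product. -/
lemma exists_homology_component (hr : ∀ n, r n ∘ₗ (C.iCycles n).hom = LinearMap.id)
    (hr' : ∀ n, r' n ∘ₗ (D.iCycles n).hom = LinearMap.id) {i j n : ℕ} (h : i + j = n) :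
    ∃ φ : (C ⊗ D).homology n →ₗ[K] TensorProduct K (C.homology i) (D.homology j),
      ∀ z, φ (((C ⊗ D).homologyπ n).hom z) =
        TensorProduct.map ((C.homologyπ i).hom ∘ₗ r i) ((D.homologyπ j).hom ∘ₗ r' j)
          (tensorComp C D i j n (((C ⊗ D).iCycles n).hom z)) := by
  refine exists_descend_homology (TensorProduct.map ((C.homologyπ i).hom ∘ₗ r i)
    ((D.homologyπ j).hom ∘ₗ r' j) ∘ₗ tensorComp C D i j n) (LinearMap.ext fun w => ?_)
  rw [LinearMap.comp_apply, LinearMap.comp_apply, tensorComp_d h, map_add, map_zsmul,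
    LinearMap.rTensor, LinearMap.lTensor, TensorProduct.map_map, TensorProduct.map_map,
    homologyπ_retraction_d hr, homologyπ_retraction_d hr', TensorProduct.map_zero_left,
    TensorProduct.map_zero_right]
  simp

end Künneth

end

end PathHomology

namespace PathHomology

noncomputable section

open HomologicalComplex

variable {K : Type u} [CommRing K]

/-! ### The Künneth theorem -/

section Künneth

variable {C D : ChainComplex (ModuleCat.{u} K) ℕ} {r : ∀ n, C.X n →ₗ[K] C.cycles n}
  {r' : ∀ n, D.X n →ₗ[K] D.cycles n}

/-- The linear map `X_{j+1} → B_j` to the boundaries. -/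
abbrev toBoundaries (D : ChainComplex (ModuleCat.{u} K) ℕ) (j : ℕ) :
    D.X (j + 1) →ₗ[K] LinearMap.range (D.toCycles (j + 1) j).hom :=
  (D.toCycles (j + 1) j).hom.rangeRestrict

lemma toBoundaries_d (j : ℕ) : toBoundaries D j ∘ₗ (D.d (j + 2) (j + 1)).hom = 0 := by
  refine LinearMap.ext fun w => Subtype.ext ?_
  have h := LinearMap.congr_fun (toCycles_iCycles D j) ((D.toCycles (j + 2) (j + 1)).hom w)
  rw [LinearMap.comp_apply, iCycles_toCycles] at h
  exact h

lemma toBoundaries_iCycles (j : ℕ) : toBoundaries D j ∘ₗ (D.iCycles (j + 1)).hom = 0 :=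
  LinearMap.ext fun z => Subtype.ext (LinearMap.congr_fun (toCycles_iCycles D j) z)

lemma d_eq_zero_of_iCycles {n : ℕ} (z : C.cycles n) (m : ℕ) :
    (C.d n m).hom ((C.iCycles n).hom z) = 0 :=
  ConcreteCategory.congr_hom (C.iCycles_d n m) z

/-- The components of the map to the Tor terms in the Künneth sequence. -/
lemma exists_torComponent (hr : ∀ n, r n ∘ₗ (C.iCycles n).hom = LinearMap.id)
    (hr' : ∀ n, r' n ∘ₗ (D.iCycles n).hom = LinearMap.id) {i j n : ℕ} (h : i + j + 1 = n) :
    ∃ ψ : (C ⊗ D).homology n →ₗ[K] LinearMap.ker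
        ((LinearMap.range (D.toCycles (j + 1) j).hom).subtype.lTensor (C.homology i)),
      ∀ z, (ψ (((C ⊗ D).homologyπ n).hom z) : TensorProduct K _ _) =
        TensorProduct.map ((C.homologyπ i).hom ∘ₗ r i) (toBoundaries D j)
          (tensorComp C D i (j + 1) n (((C ⊗ D).iCycles n).hom z)) := by
  obtain ⟨f, hf⟩ := exists_descend_homology (C := C ⊗ D) (n := n)
    (TensorProduct.map ((C.homologyπ i).hom ∘ₗ r i) (toBoundaries D j) ∘ₗ
      tensorComp C D i (j + 1) n) (by
    refine LinearMap.ext fun w => ?_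
    rw [LinearMap.comp_apply, LinearMap.comp_apply, tensorComp_d (by omega), map_add, map_zsmul,
      LinearMap.rTensor, LinearMap.lTensor, TensorProduct.map_map, TensorProduct.map_map,
      homologyπ_retraction_d hr, toBoundaries_d, TensorProduct.map_zero_left,
      TensorProduct.map_zero_right]
    simp)
  refine ⟨f.codRestrict _ fun c => ?_, hf⟩
  obtain ⟨z, rfl⟩ := homologyπ_surjective (C ⊗ D) n c
  subst h
  -- The values lie in the kernel by the cycle condition in bidegree (i, j): applying `π r ⊗ r'`
  -- removes its d ⊗ 1 term and leaves, up to sign, the image of the value in H_i ⊗ Z_j.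
  have h1 := tensorComp_d (C := C) (D := D) (rfl : i + j = i + j) (((C ⊗ D).iCycles _).hom z)
  rw [d_eq_zero_of_iCycles, map_zero] at h1
  have h2 := congrArg (TensorProduct.map ((C.homologyπ i).hom ∘ₗ r i) (r' j)) h1
  rw [map_zero, map_add, map_zsmul, LinearMap.rTensor, LinearMap.lTensor, TensorProduct.map_map,
    TensorProduct.map_map, homologyπ_retraction_d hr, retraction_d hr',
    TensorProduct.map_zero_left, LinearMap.zero_apply, zero_add] at h2
  have h3 := congrArg ((-1 : ℤ) ^ i • ·) h2
  simp only [smul_smul, smul_zero, ← mul_pow, neg_one_mul, neg_neg, one_pow, one_smul] at h3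
  rw [LinearMap.mem_ker, hf, LinearMap.comp_apply, LinearMap.lTensor, TensorProduct.map_map]
  exact h3.symm

lemma homology_component_cross (hr : ∀ n, r n ∘ₗ (C.iCycles n).hom = LinearMap.id)
    (hr' : ∀ n, r' n ∘ₗ (D.iCycles n).hom = LinearMap.id) {i j n : ℕ} (h : i + j = n)
    (t : TensorProduct K (C.cycles i) (D.cycles j)) :
    TensorProduct.map ((C.homologyπ i).hom ∘ₗ r i) ((D.homologyπ j).hom ∘ₗ r' j)
      (tensorComp C D i j n (((C ⊗ D).iCycles n).hom (crossCycles C D i j n h t))) =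
      TensorProduct.map (C.homologyπ i).hom (D.homologyπ j).hom t := by
  rw [iCycles_crossCycles, tensorComp_tensorInc, TensorProduct.map_map, LinearMap.comp_assoc,
    LinearMap.comp_assoc, hr, hr', LinearMap.comp_id, LinearMap.comp_id]

lemma tensorComp_crossCycles_of_ne {i j k l n : ℕ} (h : k + l = n) (hne : ¬ (k = i ∧ l = j))
    (t : TensorProduct K (C.cycles k) (D.cycles l)) :
    tensorComp C D i j n (((C ⊗ D).iCycles n).hom (crossCycles C D k l n h t)) = 0 := by
  rw [iCycles_crossCycles, tensorComp_tensorInc_of_ne h hne]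

lemma torComponent_cross {i j k l n : ℕ} (h : k + l = n)
    (t : TensorProduct K (C.cycles k) (D.cycles l)) :
    TensorProduct.map ((C.homologyπ i).hom ∘ₗ r i) (toBoundaries D j)
      (tensorComp C D i (j + 1) n (((C ⊗ D).iCycles n).hom (crossCycles C D k l n h t))) = 0 := by
  by_cases hk : k = i ∧ l = j + 1
  · obtain ⟨rfl, rfl⟩ := hk
    rw [iCycles_crossCycles, tensorComp_tensorInc, TensorProduct.map_map, toBoundaries_iCycles,
      TensorProduct.map_zero_right, LinearMap.zero_apply]
  · rw [tensorComp_crossCycles_of_ne h hk, map_zero]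

lemma projective_cycles [IsDomain K] [IsPrincipalIdealRing K] (n : ℕ)
    [Module.Projective K (C.X n)] : Module.Projective K (C.cycles n) :=
  projective_of_injective _ (iCycles_injective C n)

lemma projective_boundaries [IsDomain K] [IsPrincipalIdealRing K] (n : ℕ)
    [Module.Projective K (C.X n)] :
    Module.Projective K (LinearMap.range (C.toCycles (n + 1) n).hom) :=
  have := projective_cycles (C := C) n
  projective_of_injective (LinearMap.range (C.toCycles (n + 1) n).hom).subtype
    Subtype.val_injective

/-- The boundaries form a submodule of the projective module C_{n-1}, hence a projective module, so
the cycles split off C_n. -/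
lemma exists_cycle_retraction [IsDomain K] [IsPrincipalIdealRing K] (n : ℕ)
    [Module.Projective K (C.X (n - 1))] :
    ∃ r : C.X n →ₗ[K] C.cycles n, r ∘ₗ (C.iCycles n).hom = LinearMap.id := by
  have : Module.Projective K (LinearMap.range (C.d n (n - 1)).hom) :=
    projective_of_injective (LinearMap.range (C.d n (n - 1)).hom).subtype Subtype.val_injective
  obtain ⟨r, s, -, h⟩ := exists_retraction_of_projective_range (C.d n (n - 1)).hom
  let e := LinearEquiv.ofInjective (C.iCycles n).hom (iCycles_injective C n) ≪≫ₗ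
    LinearEquiv.ofEq _ _ (LinearMap.exact_iff.1 (exact_iCycles C n)).symm
  refine ⟨e.symm.toLinearMap ∘ₗ r, LinearMap.ext fun z => ?_⟩
  have h1 := LinearMap.congr_fun h ((C.iCycles n).hom z)
  have h2 : (C.d n (n - 1)).hom.rangeRestrict ((C.iCycles n).hom z) = 0 :=
    Subtype.ext (d_eq_zero_of_iCycles z _)
  rw [LinearMap.add_apply, LinearMap.comp_apply s, h2, map_zero, add_zero] at h1
  change e.symm (r ((C.iCycles n).hom z)) = z
  rw [LinearEquiv.symm_apply_eq]
  exact Subtype.ext h1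

/-- A chain of a tensor product on whose components the differentials of both factors vanish is
a sum of products of cycles. -/
lemma exists_eq_sum_crossCycles [∀ n, Module.Projective K (C.X n)]
    [∀ n, Module.Projective K (D.X n)] (hr : ∀ n, r n ∘ₗ (C.iCycles n).hom = LinearMap.id)
    (hr' : ∀ n, r' n ∘ₗ (D.iCycles n).hom = LinearMap.id) {n : ℕ} (z : (C ⊗ D).X n)
    (hz : ∀ i j, i + j = n → (C.d i (i - 1)).hom.rTensor _ (tensorComp C D i j n z) = 0)
    (hz' : ∀ i j, i + j = n → (D.d j (j - 1)).hom.lTensor _ (tensorComp C D i j n z) = 0) :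
    ∃ y : ∀ q : Finset.HasAntidiagonal.antidiagonal n,
        TensorProduct K (C.cycles q.1.1) (D.cycles q.1.2),
      z = ((C ⊗ D).iCycles n).hom (∑ q, crossCycles C D q.1.1 q.1.2 n
        (Finset.HasAntidiagonal.mem_antidiagonal.1 q.2) (y q)) := by
  refine ⟨fun q => TensorProduct.map (r _) (r' _) (tensorComp C D q.1.1 q.1.2 n z), ?_⟩
  rw [map_sum]
  conv_lhs => rw [← sum_tensorInc_tensorComp z]
  refine Finset.sum_congr rfl fun q _ => ?_
  have hq := Finset.HasAntidiagonal.mem_antidiagonal.1 q.2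
  rw [iCycles_crossCycles, TensorProduct.map_map]
  refine congrArg _ ?_
  have h1 := map_retraction_id_apply (exact_iCycles C q.1.1) (hr _) (hz _ _ hq)
  have h2 := map_id_retraction_apply (exact_iCycles D q.1.2) (hr' _) (hz' _ _ hq)
  conv_lhs => rw [← h1, ← h2]
  rw [TensorProduct.map_map, LinearMap.comp_id, LinearMap.id_comp]

lemma exists_chain_correction [IsDomain K] [IsPrincipalIdealRing K]
    [∀ n, Module.Projective K (D.X n)] {i l n : ℕ}
    (z : (C ⊗ D).X n)
    (hz : ∀ j, l = j + 1 → TensorProduct.map ((C.homologyπ i).hom ∘ₗ r i) (toBoundaries D j)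
      (tensorComp C D i (j + 1) n z) = 0) :
    ∃ v : TensorProduct K (C.X (i + 1)) (D.X l),
      (D.d l (l - 1)).hom.lTensor _ ((C.d (i + 1) i).hom.rTensor _ v) =
        TensorProduct.map ((C.iCycles i).hom ∘ₗ r i) (D.d l (l - 1)).hom
          (tensorComp C D i l n z) := by
  cases l with
  | zero =>
    refine ⟨0, ?_⟩
    rw [D.shape 0 (0 - 1) (by simp), ModuleCat.hom_zero, TensorProduct.map_zero_right]
    simp
  | succ j =>
    have := projective_boundaries (C := D) j
    obtain ⟨v, hv⟩ := exists_correction (exact_toCycles_homologyπ C i) (homologyπ_surjective C i)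
      (C.iCycles i).hom (r i) (D.toCycles (j + 1) j).hom (D.iCycles j).hom (hz j rfl)
    rw [iCycles_comp_toCycles, iCycles_comp_toCycles] at hv
    exact ⟨v, hv⟩

/-- Apply 1 ⊗ d to the cycle condition: its second summand vanishes because d ∘ d = 0. -/
lemma rTensor_d_lTensor_d_tensorComp {n : ℕ} (z : (C ⊗ D).X n)
    (hz : ((C ⊗ D).d n (n - 1)).hom z = 0) {i l : ℕ} (h : i + l = n) :
    (C.d i (i - 1)).hom.rTensor _ ((D.d l (l - 1)).hom.lTensor _ (tensorComp C D i l n z)) = 0 := by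
  cases i with
  | zero =>
    rw [C.shape 0 (0 - 1) (by simp), ModuleCat.hom_zero, LinearMap.rTensor_zero,
      LinearMap.zero_apply]
  | succ i =>
    obtain rfl : n = i + l + 1 := by omega
    have h1 := tensorComp_d (rfl : i + l = i + l) z
    have h2 : ((C ⊗ D).d (i + l + 1) (i + l)).hom z = 0 := hz
    rw [h2, map_zero] at h1
    have h3 := congrArg ((D.d l (l - 1)).hom.lTensor _) h1
    have h4 : (D.d l (l - 1)).hom ∘ₗ (D.d (l + 1) l).hom = 0 :=
      congrArg ModuleCat.Hom.hom (D.d_comp_d (l + 1) l (l - 1))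
    rw [map_zero, map_add, map_zsmul, LinearMap.lTensor, LinearMap.lTensor, LinearMap.rTensor,
      TensorProduct.map_map, TensorProduct.map_map, h4, TensorProduct.map_zero_right,
      LinearMap.zero_apply, smul_zero, add_zero] at h3
    rw [LinearMap.lTensor, LinearMap.rTensor, TensorProduct.map_map]
    exact h3.symm

lemma rTensor_d_tensorComp_eq_zero {n : ℕ} (z : (C ⊗ D).X n)
    (hz : ((C ⊗ D).d n (n - 1)).hom z = 0)
    (hz' : ∀ i j, i + j = n → (D.d j (j - 1)).hom.lTensor _ (tensorComp C D i j n z) = 0)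
    {i l : ℕ} (h : i + l = n) :
    (C.d i (i - 1)).hom.rTensor _ (tensorComp C D i l n z) = 0 := by
  cases i with
  | zero =>
    rw [C.shape 0 (0 - 1) (by simp), ModuleCat.hom_zero, LinearMap.rTensor_zero,
      LinearMap.zero_apply]
  | succ i =>
    obtain rfl : n = i + l + 1 := by omega
    have h1 := tensorComp_d (rfl : i + l = i + l) z
    have h2 : ((C ⊗ D).d (i + l + 1) (i + l)).hom z = 0 := hz
    have h3 : (D.d (l + 1) l).hom.lTensor _ (tensorComp C D i (l + 1) (i + l + 1) z) = 0 :=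
      hz' i (l + 1) (by omega)
    rw [h2, map_zero, h3, smul_zero, add_zero] at h1
    exact h1.symm

/-- The Künneth sequence is exact in the middle. -/
lemma exists_sum_cross_of_torComponent_eq_zero [IsDomain K] [IsPrincipalIdealRing K]
    [∀ n, Module.Projective K (C.X n)] [∀ n, Module.Projective K (D.X n)]
    (hr : ∀ n, r n ∘ₗ (C.iCycles n).hom = LinearMap.id)
    (hr' : ∀ n, r' n ∘ₗ (D.iCycles n).hom = LinearMap.id) {n : ℕ} (z : (C ⊗ D).cycles n)
    (hz : ∀ i j, i + j + 1 = n → TensorProduct.map ((C.homologyπ i).hom ∘ₗ r i) (toBoundaries D j)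
      (tensorComp C D i (j + 1) n (((C ⊗ D).iCycles n).hom z)) = 0) :
    ∃ y : ∀ q : Finset.HasAntidiagonal.antidiagonal n,
        TensorProduct K (C.cycles q.1.1) (D.cycles q.1.2),
      ((C ⊗ D).homologyπ n).hom z = ((C ⊗ D).homologyπ n).hom (∑ q, crossCycles C D q.1.1 q.1.2 n
        (Finset.HasAntidiagonal.mem_antidiagonal.1 q.2) (y q)) := by
  choose v hv using fun q : Finset.HasAntidiagonal.antidiagonal n =>
    exists_chain_correction (r := r) (i := q.1.1) (l := q.1.2) (((C ⊗ D).iCycles n).hom z)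
      fun j hj => hz _ _ (by have := Finset.HasAntidiagonal.mem_antidiagonal.1 q.2; omega)
  -- Subtracting dW makes 1 ⊗ d vanish on every component of the cycle. The cycle condition then
  -- makes d ⊗ 1 vanish as well, and what remains is a sum of products of cycles in the same
  -- homology class.
  let W : (C ⊗ D).X (n + 1) := ∑ q : Finset.HasAntidiagonal.antidiagonal n,
    tensorInc C D (q.1.1 + 1) q.1.2 (n + 1)
      (by have := Finset.HasAntidiagonal.mem_antidiagonal.1 q.2; omega) (v q)
  have hW : ∀ q : Finset.HasAntidiagonal.antidiagonal n,
      tensorComp C D (q.1.1 + 1) q.1.2 (n + 1) W = v q := by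
    intro q
    rw [map_sum, Finset.sum_eq_single q]
    · rw [tensorComp_tensorInc]
    · rintro ⟨⟨a, b⟩, hab⟩ _ hne
      rw [tensorComp_tensorInc_of_ne]
      rintro ⟨h1, h2⟩
      exact hne (Subtype.ext (Prod.ext (Nat.add_right_cancel h1) h2))
    · exact fun h => absurd (Finset.mem_univ _) h
  let x : (C ⊗ D).X n := ((C ⊗ D).iCycles n).hom z
  let x' : (C ⊗ D).X n := x - ((C ⊗ D).d (n + 1) n).hom W
  have hx : ((C ⊗ D).d n (n - 1)).hom x = 0 := d_eq_zero_of_iCycles z _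
  have hx' : ((C ⊗ D).d n (n - 1)).hom x' = 0 := by
    have h1 : ((C ⊗ D).d n (n - 1)).hom (((C ⊗ D).d (n + 1) n).hom W) = 0 :=
      ConcreteCategory.congr_hom ((C ⊗ D).d_comp_d (n + 1) n (n - 1)) W
    rw [map_sub, hx, h1, sub_zero]
  have hx'' : ∀ i l, i + l = n →
      (D.d l (l - 1)).hom.lTensor _ (tensorComp C D i l n x') = 0 := by
    intro i l h
    let q : Finset.HasAntidiagonal.antidiagonal n :=
      ⟨(i, l), Finset.HasAntidiagonal.mem_antidiagonal.2 h⟩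
    have h1 := hv q
    have h2 := hW q
    -- The first factor of (1 ⊗ d)x is already a cycle, so the retraction fixes it, and the
    -- correction `v` cancels all of (1 ⊗ d)x.
    have h3 := map_retraction_id_apply (exact_iCycles C i) (hr i)
      (rTensor_d_lTensor_d_tensorComp x hx h)
    have h4 : (D.d l (l - 1)).hom ∘ₗ (D.d (l + 1) l).hom = 0 :=
      congrArg ModuleCat.Hom.hom (D.d_comp_d (l + 1) l (l - 1))
    have h5 : (D.d l (l - 1)).hom.lTensor _ ((D.d (l + 1) l).hom.lTensor _
        (tensorComp C D i (l + 1) (n + 1) W)) = 0 := by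
      rw [LinearMap.lTensor, LinearMap.lTensor, TensorProduct.map_map, h4,
        TensorProduct.map_zero_right, LinearMap.zero_apply]
    have h6 : tensorComp C D i l n (((C ⊗ D).d (n + 1) n).hom W) =
        (C.d (i + 1) i).hom.rTensor _ (v q) + (-1 : ℤ) ^ i • (D.d (l + 1) l).hom.lTensor _
          (tensorComp C D i (l + 1) (n + 1) W) := by
      rw [← h2]
      exact tensorComp_d h W
    rw [map_sub, map_sub, h6, map_add, map_zsmul, h5, smul_zero, add_zero, sub_eq_zero]
    refine Eq.trans ?_ h1.symm
    refine h3.symm.trans ?_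
    rw [LinearMap.lTensor, TensorProduct.map_map, LinearMap.comp_id, LinearMap.id_comp]
  obtain ⟨y, hy⟩ := exists_eq_sum_crossCycles hr hr' x'
    (fun i l h => rTensor_d_tensorComp_eq_zero x' hx' hx'' h) hx''
  refine ⟨y, ?_⟩
  rw [← sub_eq_zero, ← map_sub]
  refine homologyπ_eq_zero (C ⊗ D) W ?_
  rw [map_sub, ← hy]
  exact sub_sub_cancel _ _

/-- The last map of the Künneth sequence is surjective. -/
lemma exists_cycle_torComponent (hr : ∀ n, r n ∘ₗ (C.iCycles n).hom = LinearMap.id) {i j n : ℕ}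
    (h : i + j + 1 = n)
    (u : TensorProduct K (C.homology i) (LinearMap.range (D.toCycles (j + 1) j).hom))
    (hu : (LinearMap.range (D.toCycles (j + 1) j).hom).subtype.lTensor _ u = 0) :
    ∃ z : (C ⊗ D).cycles n,
      TensorProduct.map ((C.homologyπ i).hom ∘ₗ r i) (toBoundaries D j)
        (tensorComp C D i (j + 1) n (((C ⊗ D).iCycles n).hom z)) = u ∧
      ∀ k l, ¬ (k = i ∧ l = j) →
        TensorProduct.map ((C.homologyπ k).hom ∘ₗ r k) (toBoundaries D l)
          (tensorComp C D k (l + 1) n (((C ⊗ D).iCycles n).hom z)) = 0 := by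
  obtain ⟨a, b, hab, hab'⟩ := exists_lift_of_mem_ker (exact_toCycles_homologyπ C i)
    (homologyπ_surjective C i) (D.toCycles (j + 1) j).hom hu
  subst h
  let a' := TensorProduct.map (C.iCycles i).hom (LinearMap.id (R := K) (M := D.X (j + 1))) a
  let b' := TensorProduct.map (LinearMap.id (R := K) (M := C.X (i + 1))) (D.iCycles j).hom b
  -- The boundaries of the two summands are (-1)^i (1 ⊗ d)a' and (-1)^i (d ⊗ 1)b', which are equal
  -- by the choice of `b`. The second summand contributes to no Tor component, because its second
  -- factor is a cycle.
  let x : (C ⊗ D).X (i + j + 1) := tensorInc C D i (j + 1) (i + j + 1) rfl a' -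
    (-1 : ℤ) ^ i • tensorInc C D (i + 1) j (i + j + 1) (by omega) b'
  have ha' : (C.d i (i - 1)).hom.rTensor _ a' = 0 := by
    rw [LinearMap.rTensor, TensorProduct.map_map, d_iCycles, TensorProduct.map_zero_left]
    rfl
  have hb' : (D.d j (j - 1)).hom.lTensor _ b' = 0 := by
    rw [LinearMap.lTensor, TensorProduct.map_map, d_iCycles, TensorProduct.map_zero_right]
    rfl
  have hx : ((C ⊗ D).d (i + j + 1) (i + j)).hom x = 0 := by
    rw [map_sub, map_zsmul, d_tensorInc_left rfl b' hb', d_tensorInc_right rfl a' ha', ← smul_sub,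
      ← map_sub]
    have h1 := congrArg (TensorProduct.map (C.iCycles i).hom (D.iCycles j).hom) hab'
    rw [LinearMap.lTensor, LinearMap.rTensor, TensorProduct.map_map, TensorProduct.map_map,
      iCycles_comp_toCycles, iCycles_comp_toCycles] at h1
    rw [LinearMap.lTensor, LinearMap.rTensor, TensorProduct.map_map, TensorProduct.map_map]
    refine (congrArg _ ((congrArg _ (sub_eq_zero.2 h1)).trans (map_zero _))).trans (smul_zero _)
  obtain ⟨z, hz⟩ := (exact_iCycles (C ⊗ D) (i + j + 1) x).1 hx
  refine ⟨z, ?_, fun k l hkl => ?_⟩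
  · rw [hz, map_sub, map_zsmul, tensorComp_tensorInc, tensorComp_tensorInc_of_ne _ (by omega),
      smul_zero, sub_zero, TensorProduct.map_map, LinearMap.comp_assoc, hr]
    exact hab
  · rw [hz, map_sub, map_zsmul, tensorComp_tensorInc_of_ne (k := i) _ (by omega), zero_sub]
    by_cases hk : i + 1 = k ∧ j = l + 1
    · obtain ⟨rfl, rfl⟩ := hk
      rw [tensorComp_tensorInc, map_neg, map_zsmul, TensorProduct.map_map, toBoundaries_iCycles,
        TensorProduct.map_zero_right, LinearMap.zero_apply, smul_zero, neg_zero]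
    · rw [tensorComp_tensorInc_of_ne _ hk, smul_zero, neg_zero, map_zero]

end Künneth

end

end PathHomology

/-! ### Assembly of the Künneth sequence. -/

namespace PathHomology

noncomputable section

open HomologicalComplex

variable {K : Type u} [CommRing K]

/-- The short exact sequence of the Künneth theorem, assembled from its components. -/
lemma exists_exact_directSum {ι κ N : Type*} {M : ι → Type*} {L : κ → Type*} [Finite ι] [Finite κ]
    [DecidableEq ι] [DecidableEq κ] [AddCommGroup N] [Module K N] [∀ i, AddCommGroup (M i)]
    [∀ i, Module K (M i)] [∀ k, AddCommGroup (L k)] [∀ k, Module K (L k)]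
    (f : ∀ i, M i →ₗ[K] N) (φ : ∀ i, N →ₗ[K] M i) (ψ : ∀ k, N →ₗ[K] L k)
    (hφ : ∀ i x, φ i (f i x) = x) (hφ' : ∀ i i', i ≠ i' → ∀ x, φ i (f i' x) = 0)
    (hψ : ∀ k i x, ψ k (f i x) = 0)
    (hexact : ∀ c, (∀ k, ψ k c = 0) → c ∈ LinearMap.range (DirectSum.toModule K ι N f))
    (hsurj : ∀ k u, ∃ c, ψ k c = u ∧ ∀ k', k' ≠ k → ψ k' c = 0) :
    ∃ g : N →ₗ[K] DirectSum κ L, Function.Injective (DirectSum.toModule K ι N f) ∧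
      Function.Exact (DirectSum.toModule K ι N f) g ∧ Function.Surjective g := by
  have : Fintype κ := Fintype.ofFinite κ
  let e := DirectSum.linearEquivFunOnFintype K κ L
  let g : N →ₗ[K] DirectSum κ L := e.symm.toLinearMap ∘ₗ LinearMap.pi ψ
  have hg : ∀ c, g c = 0 ↔ ∀ k, ψ k c = 0 := fun c => by
    change e.symm (LinearMap.pi ψ c) = 0 ↔ _
    rw [LinearEquiv.map_eq_zero_iff, funext_iff]
    rfl
  refine ⟨g, ?_, fun c => ⟨fun hc => hexact c ((hg c).1 hc), ?_⟩, ?_⟩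
  · have h : ∀ i, φ i ∘ₗ DirectSum.toModule K ι N f = DirectSum.component K ι M i := by
      intro i
      refine DirectSum.linearMap_ext K fun i' => LinearMap.ext fun x => ?_
      rw [LinearMap.comp_apply, LinearMap.comp_apply, LinearMap.comp_apply, DirectSum.toModule_lof]
      by_cases hi : i = i'
      · obtain rfl := hi
        rw [hφ, DirectSum.component.lof_self]
      · rw [hφ' i i' hi, DirectSum.component.of, dif_neg (Ne.symm hi)]
    rw [injective_iff_map_eq_zero]
    intro a ha
    refine DirectSum.ext_component K fun i => ?_
    rw [← h, LinearMap.comp_apply, ha, map_zero, map_zero]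
  · rintro ⟨a, rfl⟩
    rw [hg]
    intro k
    have h : ψ k ∘ₗ DirectSum.toModule K ι N f = 0 :=
      DirectSum.linearMap_ext K fun i => LinearMap.ext fun x => by
        rw [LinearMap.comp_apply, LinearMap.comp_apply, DirectSum.toModule_lof, hψ]
        rfl
    exact LinearMap.congr_fun h a
  · intro y
    choose c hc hc' using hsurj
    -- The chosen preimages have only one nonzero component each, so they can be added without
    -- interference.
    refine ⟨∑ k, c k (e y k), ?_⟩
    change e.symm _ = y
    rw [LinearEquiv.symm_apply_eq]
    funext k
    change ψ k _ = _
    rw [map_sum, Finset.sum_eq_single k, hc]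
    · exact fun k' _ hk' => hc' k' _ k (Ne.symm hk')
    · exact fun h => absurd (Finset.mem_univ _) h

instance finite_add_eq (n : ℕ) : Finite {q : ℕ × ℕ // q.1 + q.2 = n} :=
  Finite.of_injective (β := Finset.HasAntidiagonal.antidiagonal n)
    (fun q => ⟨q.1, Finset.HasAntidiagonal.mem_antidiagonal.2 q.2⟩)
    fun _ _ h => Subtype.ext (congrArg (fun s => s.1) h)

instance finite_add_add_one_eq (n : ℕ) : Finite {q : ℕ × ℕ // q.1 + q.2 + 1 = n} :=
  Finite.of_injective (β := {q : ℕ × ℕ // q.1 + q.2 = n - 1})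
    (fun q => ⟨q.1, by have := q.2; omega⟩) fun _ _ h => Subtype.ext (congrArg (fun s => s.1) h)

/-- The Künneth theorem for chain complexes of projective modules over a principal ideal domain. -/
theorem exists_kunneth [IsDomain K] [IsPrincipalIdealRing K]
    (C D : ChainComplex (ModuleCat.{u} K) ℕ)
    [∀ n, Module.Projective K (C.X n)] [∀ n, Module.Projective K (D.X n)] (n : ℕ) :
    ∃ (f : DirectSum {q : ℕ × ℕ // q.1 + q.2 = n}
          (fun q => TensorProduct K (C.homology q.1.1) (D.homology q.1.2)) →ₗ[K]
            (C ⊗ D).homology n)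
      (g : (C ⊗ D).homology n →ₗ[K] DirectSum {q : ℕ × ℕ // q.1 + q.2 + 1 = n}
          (fun q => ((Tor (ModuleCat.{u} K) 1).obj (C.homology q.1.1)).obj (D.homology q.1.2))),
      Function.Injective f ∧ Function.Exact f g ∧ Function.Surjective g ∧
      ∀ (i j : ℕ) (h : i + j = n) (x : C.cycles i) (y : D.cycles j),
        f (DirectSum.lof K _ _ ⟨(i, j), h⟩
          (TensorProduct.tmul K (C.homologyπ i x) (D.homologyπ j y))) =
          (C ⊗ D).homologyπ n (crossCycles C D i j n h (TensorProduct.tmul K x y)) := by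
  choose r hr using fun n => exists_cycle_retraction (C := C) n
  choose r' hr' using fun n => exists_cycle_retraction (C := D) n
  choose f hf using fun q : {q : ℕ × ℕ // q.1 + q.2 = n} => exists_crossHomology C D q.2
  choose φ hφ using fun q : {q : ℕ × ℕ // q.1 + q.2 = n} => exists_homology_component hr hr' q.2
  choose ψ hψ using fun q : {q : ℕ × ℕ // q.1 + q.2 + 1 = n} => exists_torComponent hr hr' q.2
  -- Boundaries and cycles of `D` are projective, so B_j → Z_j → H_j is a projective resolution of
  -- length one that computes Tor₁.
  have he : ∀ q : {q : ℕ × ℕ // q.1 + q.2 + 1 = n}, Nonempty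
      (((Tor (ModuleCat.{u} K) 1).obj (C.homology q.1.1)).obj (D.homology q.1.2) ≃ₗ[K]
        LinearMap.ker ((LinearMap.range (D.toCycles (q.1.2 + 1) q.1.2).hom).subtype.lTensor
          (C.homology q.1.1))) := fun q =>
    have := projective_cycles (C := D) q.1.2
    have := projective_boundaries (C := D) q.1.2
    exists_tor_one_equiv _ _ _ (D.homologyπ q.1.2).hom Subtype.val_injective
      (LinearMap.exact_iff.2 ((LinearMap.exact_iff.1 (exact_toCycles_homologyπ D q.1.2)).trans
        (Submodule.range_subtype _).symm)) (homologyπ_surjective D q.1.2)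
  let e q := (he q).some
  have hsurj : ∀ q : {q : ℕ × ℕ // q.1 + q.2 = n}, Function.Surjective
      (TensorProduct.map (C.homologyπ q.1.1).hom (D.homologyπ q.1.2).hom) := fun q =>
    TensorProduct.map_surjective (homologyπ_surjective C _) (homologyπ_surjective D _)
  suffices h : ∃ g : (C ⊗ D).homology n →ₗ[K] DirectSum {q : ℕ × ℕ // q.1 + q.2 + 1 = n}
      (fun q => ((Tor (ModuleCat.{u} K) 1).obj (C.homology q.1.1)).obj (D.homology q.1.2)),
      Function.Injective (DirectSum.toModule K _ _ f) ∧
      Function.Exact (DirectSum.toModule K _ _ f) g ∧ Function.Surjective g by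
    obtain ⟨g, h1, h2, h3⟩ := h
    refine ⟨DirectSum.toModule K _ _ f, g, h1, h2, h3, fun i j h x y => ?_⟩
    rw [DirectSum.toModule_lof]
    exact hf ⟨(i, j), h⟩ (TensorProduct.tmul K x y)
  refine exists_exact_directSum f φ (fun q => (e q).symm.toLinearMap ∘ₗ ψ q) ?_ ?_ ?_ ?_ ?_
  · intro q t
    obtain ⟨t, rfl⟩ := hsurj q t
    rw [hf, hφ, homology_component_cross hr hr' q.2]
  · intro q q' hq t
    obtain ⟨t, rfl⟩ := hsurj q' t
    rw [hf, hφ, tensorComp_crossCycles_of_ne q'.2, map_zero]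
    exact fun h => hq (Subtype.ext (Prod.ext h.1.symm h.2.symm))
  · intro q q' t
    obtain ⟨t, rfl⟩ := hsurj q' t
    have h : ψ q (f q' (TensorProduct.map (C.homologyπ q'.1.1).hom (D.homologyπ q'.1.2).hom t)) =
        0 := Subtype.ext (by rw [hf, hψ, torComponent_cross q'.2]; rfl)
    rw [LinearMap.comp_apply, h, map_zero]
  · intro c hc
    obtain ⟨z, rfl⟩ := homologyπ_surjective (C ⊗ D) n c
    obtain ⟨y, hy⟩ := exists_sum_cross_of_torComponent_eq_zero hr hr' z fun i j h => by
      have h4 : ψ ⟨(i, j), h⟩ (((C ⊗ D).homologyπ n).hom z) = 0 :=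
        (e ⟨(i, j), h⟩).symm.map_eq_zero_iff.1 (hc ⟨(i, j), h⟩)
      rw [← hψ ⟨(i, j), h⟩, h4]
      rfl
    rw [hy, map_sum]
    refine Submodule.sum_mem _ fun q _ => ?_
    have hq := Finset.HasAntidiagonal.mem_antidiagonal.1 q.2
    refine ⟨DirectSum.lof K _ _ ⟨q.1, hq⟩
      (TensorProduct.map (C.homologyπ q.1.1).hom (D.homologyπ q.1.2).hom (y q)), ?_⟩
    rw [DirectSum.toModule_lof]
    exact hf ⟨q.1, hq⟩ (y q)
  · intro q u
    obtain ⟨z, hz, hz'⟩ := exists_cycle_torComponent hr q.2 (e q u).1 (e q u).2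
    refine ⟨((C ⊗ D).homologyπ n).hom z, ?_, fun q' hq' => ?_⟩
    · have h : ψ q (((C ⊗ D).homologyπ n).hom z) = e q u := Subtype.ext ((hψ q z).trans hz)
      rw [LinearMap.comp_apply, h]
      exact (e q).symm_apply_apply u
    · have h : ψ q' (((C ⊗ D).homologyπ n).hom z) = 0 := Subtype.ext ((hψ q' z).trans
        (hz' _ _ fun h => hq' (Subtype.ext (Prod.ext h.1 h.2))))
      rw [LinearMap.comp_apply, h, map_zero]

end

end PathHomology

/-! ### The theorem, from the isomorphism and the Künneth sequence. -/

namespace PathHomology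

namespace PathPair

variable {K : Type u} [CommRing K]

lemma projective_Omega [IsDomain K] [IsPrincipalIdealRing K] (P : PathPair K)
    (hA : ∀ n, Module.Free K (P.A _⦋n⦌)) (n : ℕ) : Module.Projective K (P.Omega.X n) :=
  have := hA n
  have := projective_moore P.A n
  projective_of_injective (omegaSub (moore P.A) P.barB n).subtype Subtype.val_injective

end PathPair

end PathHomology

theorem mainTheorem1 {K : Type u} [CommRing K] [IsDomain K] [IsPrincipalIdealRing K]
    (P P' : PathHomology.PathPair K)
    (hA : ∀ n, Module.Free K (P.A _⦋n⦌)) (hA' : ∀ n, Module.Free K (P'.A _⦋n⦌))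
    (hB : ∀ n, IsComplemented (P.barB n)) (hB' : ∀ n, IsComplemented (P'.barB n)) :
    ∃ e : P.Omega ⊗ P'.Omega ≅ (P.box P').Omega,
      (∀ n, e.hom.f n ≫ (P.box P').OmegaIncl.f n =
        (P.OmegaIncl ⊗ₘ P'.OmegaIncl).f n ≫ PathHomology.normalizedEZ P.A P'.A n) ∧
      (∀ n, e.inv.f n ≫ (P.OmegaIncl ⊗ₘ P'.OmegaIncl).f n =
        (P.box P').OmegaIncl.f n ≫ PathHomology.normalizedAW P.A P'.A n) ∧
      ∀ n : ℕ,
        ∃ (f : DirectSum {q : ℕ × ℕ // q.1 + q.2 = n}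
              (fun q => TensorProduct K (P.H q.1.1) (P'.H q.1.2)) →ₗ[K] (P.box P').H n)
          (g : (P.box P').H n →ₗ[K] DirectSum {q : ℕ × ℕ // q.1 + q.2 + 1 = n}
              (fun q => ((Tor (ModuleCat.{u} K) 1).obj (P.H q.1.1)).obj (P'.H q.1.2))),
          Function.Injective f ∧ Function.Exact f g ∧ Function.Surjective g ∧
          ∀ (i j : ℕ) (h : i + j = n) (x : P.Omega.cycles i) (y : P'.Omega.cycles j)
            (z : (P.box P').Omega.cycles n),
            (P.box P').Omega.iCycles n z =
              e.hom.f n (HomologicalComplex.ιTensorObj P.Omega P'.Omega i j n h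
                (TensorProduct.tmul K (P.Omega.iCycles i x) (P'.Omega.iCycles j y))) →
            f (DirectSum.lof K _ _ ⟨(i, j), h⟩
                (TensorProduct.tmul K (P.Omega.homologyπ i x) (P'.Omega.homologyπ j y))) =
              (P.box P').Omega.homologyπ n z := by
  have := P.projective_Omega hA
  have := P'.projective_Omega hA'
  obtain ⟨e, h1, h2⟩ := PathHomology.PathPair.exists_omegaEZ_iso hA hA' hB hB'
  refine ⟨e, h1, h2, fun n => ?_⟩
  obtain ⟨f, g, hf, hfg, hg, hcross⟩ := PathHomology.exists_kunneth P.Omega P'.Omega n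
  let E : (P.Omega ⊗ P'.Omega).homology n ≃ₗ[K] (P.box P').H n :=
    ((HomologicalComplex.homologyFunctor (ModuleCat.{u} K) _ n).mapIso e).toLinearEquiv
  refine ⟨E.toLinearMap ∘ₗ f, g ∘ₗ E.symm.toLinearMap, E.injective.comp hf, fun c => ?_,
    hg.comp E.symm.surjective, fun i j h x y z hz => ?_⟩
  · refine (hfg (E.symm c)).trans (exists_congr fun a => ?_)
    exact E.eq_symm_apply
  · refine (congrArg E (hcross i j h x y)).trans ?_
    have h3 := congr($(HomologicalComplex.homologyπ_naturality e.hom n).hom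
      (PathHomology.crossCycles P.Omega P'.Omega i j n h (TensorProduct.tmul K x y)))
    refine h3.trans (congrArg ((P.box P').Omega.homologyπ n).hom ?_)
    -- A cycle is determined by its underlying chain, and `hz` prescribes the chain of `z`, so it
    -- suffices to compare chains.
    apply PathHomology.iCycles_injective
    refine Eq.trans ?_ hz.symm
    have h4 := congr($(HomologicalComplex.cyclesMap_i e.hom n).hom
      (PathHomology.crossCycles P.Omega P'.Omega i j n h (TensorProduct.tmul K x y)))
    refine h4.trans (congrArg (e.hom.f n).hom ?_)
    exact PathHomology.iCycles_crossCycles ..
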